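/- Let $-3<\gamma<0$ and $T>0$. Put $\mu(v)=(2\pi)^{-3/2}e^{-|v|^2/2}$ on $\mathbb R^3$, $a_{jk}(z)=(\delta_{jk}|z|^2-z_jz_k)|z|^\gamma$, $\bar a_{jk}=a_{jk}*\mu$, $$Q(G,F)(v)=\sum_{j,k=1}^3\partial_j\int_{\mathbb R^3}a_{jk}(v-v_*)\bigl[G(v_*)\partial_kF(v)-\partial_kG(v_*)F(v)\bigr]dv_*,\qquad \Gamma(f,h)=\mu^{-1/2}Q(\sqrt\mu f,\sqrt\mu h),$$ $\mathcal Lf=-\Gamma(\sqrt\mu,f)-\Gamma(f,\sqrt\mu)$, and $$\|f\|_A^2=\int_{\mathbb R^3}\sum_{j,k=1}^3\Bigl(\bar a_{jk}\,\partial_jf\,\partial_kf+\tfrac14\bar a_{jk}v_jv_kf^2\Bigr)dv$$ (weak derivatives; $\|f\|_A=\infty$ if $f$ has no weak gradient in $L^1_{loc}$). Let $g$ be analytic on $\Omega=\,]0,T[\,\times\mathbb R^3$ in the $L^2$ sense: $g\in C^\infty(\Omega)$ and there is $C>0$ with $\|\partial^\alpha g\|_{L^2(\Omega)}\le C^{|\alpha|+1}\alpha!$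 for all multi-indices $\alpha\in\mathbb N^{4}$ (derivatives in $t$ and $v$). Let $f_0\in L^2(\mathbb R^3)$ and let $f$ be a weak solution on $[0,T]$ of the Cauchy problem $$\partial_tf+\mathcal Lf=g,\qquad f|_{t=0}=f_0,$$ that is, $f\in C([0,T];L^2(\mathbb R^3))$, $f(0)=f_0$, $\int_0^T\|f(t)\|_A^2dt<\infty$, and for all $\varphi\in C_c^\infty(\mathbb R^3)$ and $t\in[0,T]$ $$(f(t),\varphi)_{L^2}-(f_0,\varphi)_{L^2}+\int_0^t\langle\mathcal Lf(s),\varphi\rangle\,ds=\int_0^t(g(s),\varphi)_{L^2}\,ds,$$ where $\mathcal Lf(s)$ is taken in the sense of distributions. Then $f\in C^\infty(]0,T];L^2(\mathbb R^3))$, and there exists a constant $B>0$ such that for every $k\in\mathbb N$ (including $k=0$) $$\sup_{0<t\le T}\|t^k\partial_t^kf(t)\|_{L^2(\mathbb R^3)}^2+\int_0^T\|t^k\partial_t^kf(t)\|_A^2\,dt\le\bigl(B^{k+1}k!\bigr)^2 .$$ -/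

import Mathlib

open MeasureTheory Set
open scoped ContDiff ENNReal

noncomputable section

namespace Landau

/-- The velocity space `ℝ³` with its Euclidean norm. -/
abbrev Vel : Type := EuclideanSpace ℝ (Fin 3)

/-- The Hilbert space `L²(ℝ³)` of real functions. -/
abbrev L2Vel : Type := Lp ℝ 2 (volume : Measure Vel)

/-- The `j`-th vector of the standard basis of `ℝ³`. -/
def basisVec (j : Fin 3) : Vel := EuclideanSpace.single j 1

/-- The derivative of `u` in the direction of the vector `w`. -/
def dirDeriv {X : Type*} [NormedAddCommGroup X] [NormedSpace ℝ X] (w : X) (u : X → ℝ) : X → ℝ :=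
  fun x => fderiv ℝ u x w

/-- Test functions on `ℝ³`: the class `C_c^∞(ℝ³)`. -/
def IsTestFunction (φ : Vel → ℝ) : Prop :=
  ContDiff ℝ ∞ φ ∧ HasCompactSupport φ

/-! ### Weak gradients -/

/-- `p` is a weak (distributional) gradient of `u` on `ℝ³`. -/
def IsWeakGradient (u : Vel → ℝ) (p : Vel → Vel) : Prop :=
  LocallyIntegrable u ∧ LocallyIntegrable p ∧
    ∀ φ : Vel → ℝ, IsTestFunction φ → ∀ j : Fin 3,
      ∫ v, u v * dirDeriv (basisVec j) φ v = -∫ v, p v j * φ v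

/-- `u` has a weak gradient (which is then unique up to a null set). -/
def HasWeakGradient (u : Vel → ℝ) : Prop := ∃ p, IsWeakGradient u p

open scoped Classical in
/-- The weak gradient of `u`, defined up to a null set; used only where it exists. -/
def weakGrad (u : Vel → ℝ) : Vel → Vel :=
  if h : HasWeakGradient u then h.choose else 0

/-! ### The Landau collision operator and its linearization -/

/-- The Maxwellian `μ(v) = (2π)^{-3/2} exp(-|v|²/2)`. -/
def maxwellian (v : Vel) : ℝ :=
  (2 * Real.pi) ^ (-(3 / 2) : ℝ) * Real.exp (-‖v‖ ^ 2 / 2)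

/-- The square root of the Maxwellian. -/
def sqrtMaxwellian (v : Vel) : ℝ := Real.sqrt (maxwellian v)

/-- The collision matrix `a_{jk}(z) = (δ_{jk}|z|² - z_j z_k)|z|^γ`. -/
def collisionMatrix (γ : ℝ) (j k : Fin 3) (z : Vel) : ℝ :=
  ((if j = k then ‖z‖ ^ 2 else 0) - z j * z k) * ‖z‖ ^ γ

/-- The averaged matrix `ā_{jk} = a_{jk} * μ`. -/
def meanMatrix (γ : ℝ) (j k : Fin 3) (v : Vel) : ℝ :=
  ∫ w, collisionMatrix γ j k (v - w) * maxwellian w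

/-- The `j`-th component of the collision flux,
`∑_k ∫ a_{jk}(v-w) [G(w) ∂_k F(v) - ∂_k G(w) F(v)] dw`,
so that `Q(G, F) = ∑_j ∂_j (collisionFlux γ G F j)`. -/
def collisionFlux (γ : ℝ) (G F : Vel → ℝ) (j : Fin 3) (v : Vel) : ℝ :=
  ∑ k : Fin 3, ∫ w, collisionMatrix γ j k (v - w) *
    (G w * weakGrad F v k - weakGrad G w k * F v)

/-- The Landau collision operator `Q(G, F)`, as a distribution: its value
`⟨Q(G, F), ψ⟩` at the test function `ψ`. -/
def collisionPairing (γ : ℝ) (G F ψ : Vel → ℝ) : ℝ :=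
  -∑ j : Fin 3, ∫ v, collisionFlux γ G F j v * dirDeriv (basisVec j) ψ v

/-- `⟨Γ(f, h), φ⟩`, where `Γ(f, h) = μ^{-1/2} Q(√μ f, √μ h)`. -/
def gammaPairing (γ : ℝ) (f h φ : Vel → ℝ) : ℝ :=
  collisionPairing γ (fun v => sqrtMaxwellian v * f v) (fun v => sqrtMaxwellian v * h v)
    (fun v => (sqrtMaxwellian v)⁻¹ * φ v)

/-- `⟨𝓛 f, φ⟩`, where `𝓛 = 𝓛₁ + 𝓛₂`, `𝓛₁ f = -Γ(√μ, f)` and `𝓛₂ f = -Γ(f, √μ)`. -/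
def linearPairing (γ : ℝ) (f φ : Vel → ℝ) : ℝ :=
  -gammaPairing γ sqrtMaxwellian f φ + -gammaPairing γ f sqrtMaxwellian φ

/-! ### The energy norm -/

/-- The nonnegative density `∑_{j,k} (ā_{jk} ∂_j f ∂_k f + ¼ ā_{jk} v_j v_k f²)`. -/
def energyDensity (γ : ℝ) (f : Vel → ℝ) (v : Vel) : ℝ :=
  ∑ j : Fin 3, ∑ k : Fin 3,
    (meanMatrix γ j k v * weakGrad f v j * weakGrad f v k
      + 1 / 4 * meanMatrix γ j k v * v j * v k * f v ^ 2)

open scoped Classical in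
/-- The squared energy norm `‖f‖_A²`, with value `∞` where it is not finite. -/
def normASq (γ : ℝ) (f : Vel → ℝ) : ℝ≥0∞ :=
  if HasWeakGradient f then ∫⁻ v, ENNReal.ofReal (energyDensity γ f v) else ⊤

/-! ### Analytic sources and weak solutions -/

/-- The partial derivative `∂_t^k ∂_v^β g` of a function of `(t, v) ∈ ℝ × ℝ³`. -/
def mixedPartial (k : ℕ) (β : Fin 3 → ℕ) (g : ℝ × Vel → ℝ) : ℝ × Vel → ℝ :=
  (dirDeriv ((1 : ℝ), (0 : Vel)))^[k]
    ((dirDeriv ((0 : ℝ), basisVec 0))^[β 0]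
      ((dirDeriv ((0 : ℝ), basisVec 1))^[β 1]
        ((dirDeriv ((0 : ℝ), basisVec 2))^[β 2] g)))

/-- `g` is analytic on the open set `Ω`, in the `L²` sense: `g ∈ C^∞(Ω)` and
`‖∂^α g‖_{L²(Ω)} ≤ C^{|α|+1} α!` for all multi-indices `α = (k, β) ∈ ℕ × ℕ³`. -/
def IsAnalyticL2 (g : ℝ × Vel → ℝ) (Ω : Set (ℝ × Vel)) : Prop :=
  ContDiffOn ℝ ∞ g Ω ∧ ∃ C : ℝ, 0 < C ∧ ∀ (k : ℕ) (β : Fin 3 → ℕ),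
    eLpNorm (mixedPartial k β g) 2 (volume.restrict Ω) ≤
      ENNReal.ofReal (C ^ (k + ∑ i, β i + 1) * (k.factorial * ∏ i, (β i).factorial : ℕ))

/-- `f` is a weak solution on `[0, T]` of the Cauchy problem `∂_t f + 𝓛 f = g`, `f(0) = f₀`:
`f ∈ C([0, T]; L²(ℝ³))`, `∫₀ᵀ ‖f(t)‖_A² dt < ∞`, and the equation holds in the sense of
distributions, integrated in time from the initial time. -/
structure IsWeakSolution (γ T : ℝ) (g : ℝ × Vel → ℝ) (f₀ : L2Vel) (f : ℝ → L2Vel) : Prop where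
  continuousOn : ContinuousOn f (Icc 0 T)
  initial : f 0 = f₀
  energy_lt_top : ∫⁻ t in Ioc 0 T, normASq γ (f t) < ⊤
  equation : ∀ φ : Vel → ℝ, IsTestFunction φ → ∀ t ∈ Icc 0 T,
    (∫ v, f t v * φ v) - (∫ v, f₀ v * φ v) + (∫ s in (0 : ℝ)..t, linearPairing γ (f s) φ)
      = ∫ s in (0 : ℝ)..t, ∫ v, g (s, v) * φ v

end Landau

end

noncomputable section

namespace Landau

open Filter Topology

local notation "⟪" x ", " y "⟫" => inner ℝ x y

/-! ### Energy inequality and resolvents in a Hilbert space. -/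

section Abstract

variable {H : Type*} [NormedAddCommGroup H] [InnerProductSpace ℝ H]

/-! The linearized operator is a symmetric nonnegative form. Put `twist u = ∇u + (u/2) v`, which is
√μ ∇(u/√μ), and k_u(v,w) = √μ(w) a(v-w)^{1/2} (twist u)(v). Because a(z)z = 0, the two halves of 𝓛
combine into ⟨𝓛u, φ⟩ = ⟪k_u, k_φ⟫ - ⟪σ k_u, k_φ⟫, where σ exchanges v and w (`linearPairing_eq`).
Since σ is an isometric involution, the form is symmetric and nonnegative. The kernel of the
exchange term is square integrable once damped by Gaussian weights, so this term is at most ½‖k_u‖²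
+ C‖u‖² on test functions (`exists_exchange_le`), and the form plus a multiple of ‖u‖² is coercive
(`exchangeForm_coercive`). Comparing ‖k_u‖² with ‖u‖_A² leaves a cross term u ā v·∇u. After
integration by parts it is controlled by an upper bound on tr ā - āv·v, where the growth of order
|v|^{γ+2} cancels (`exists_halfTrace_le`).

What remains is an equation f' + Af = g with A symmetric, nonnegative and independent of t. In the
energy identity for t^{k+1} f^{(k+1)} the only bad term is (k+1) t^k f^{(k+1)}. Replacing this
f^{(k+1)} by -A f^{(k)} + g^{(k)} and using Cauchy-Schwarz for the form of A, it is bounded by half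
of the new dissipation, plus (k+1)² times the dissipation of t^k f^{(k)}, plus a source. The factor
k+1 is exactly what turns k! into (k+1)!, so the induction loses nothing except to the source, which
is paid for by one factor B (`reg_bound`).

A weak solution has no time derivatives a priori. With R = (A + λ)⁻¹, the functions R^k f^{(k)} make
sense and are continuous. They are regularized by K = (R + ε)⁻¹, which nearly inverts R while KR
stays a contraction. The estimates are uniform in ε, and ε → 0 produces the derivatives
(`smoothing`, `variational_smoothing`).

The remaining work matches the two settings. The energy space is the closure of the pairs (φ, k_φ)
over test functions. Truncation and mollification place every function of finite A-norm in it
(`mem_energySpace`); conversely its elements have weak gradients and finite A-norm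
(`exists_of_mem_energySpace`). The source becomes a smooth curve in L² on the closed interval by a
Sobolev bound in time (`IsAnalyticL2.exists_curve`). -/

/-- A differential energy inequality with a source term, integrated in time. -/
theorem energy_inequality_integrated {T : ℝ} (hT : 0 < T) {u u' : ℝ → H} {β₀ β₁ : ℝ → ℝ}
    {p s m : ℝ} (hp : 0 ≤ p) (hs : 0 ≤ s) (hm : 0 ≤ m)
    (hu : ∀ t ∈ Icc 0 T, HasDerivWithinAt u (u' t) (Icc 0 T) t)
    (hu' : ContinuousOn u' (Icc 0 T))
    (hβ₀ : ContinuousOn β₀ (Icc 0 T)) (hβ₁ : ContinuousOn β₁ (Icc 0 T))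
    (h₀ : ∀ t ∈ Icc 0 T, 0 ≤ β₀ t) (h₁ : ∀ t ∈ Icc 0 T, 0 ≤ β₁ t)
    (hineq : ∀ t ∈ Icc 0 T, 2 * ⟪u' t, u t⟫ ≤ -β₁ t + β₀ t + 2 * p * ‖u t‖)
    (hI : ∫ t in (0 : ℝ)..T, β₀ t ≤ s ^ 2) (hinit : ‖u 0‖ ≤ m) :
    (∀ t ∈ Icc 0 T, ‖u t‖ ≤ s + m + 2 * p * T) ∧
      ∫ t in (0 : ℝ)..T, β₁ t ≤ (s + m + 2 * p * T) ^ 2 := by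
  have huc : ContinuousOn u (Icc 0 T) := fun t ht => (hu t ht).continuousWithinAt
  -- The source contributes linearly in M = max ‖u‖. Evaluating the integrated inequality where the
  -- maximum is attained gives M² ≤ m² + s² + 2pTM, which forces M ≤ s + m + 2pT; the bound on the
  -- dissipation follows by reinserting this at t = T.
  obtain ⟨tm, htm, hmax⟩ := isCompact_Icc.exists_isMaxOn (nonempty_Icc.2 hT.le) huc.norm
  set M := ‖u tm‖ with hM
  have hMle : ∀ t ∈ Icc 0 T, ‖u t‖ ≤ M := fun t ht => hmax ht
  have hM0 : 0 ≤ M := norm_nonneg _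
  have key : ∀ t ∈ Icc 0 T, ‖u t‖ ^ 2 + ∫ r in (0 : ℝ)..t, β₁ r ≤ m ^ 2 + s ^ 2 + 2 * p * T * M := by
    intro t ht
    have hsub : Icc 0 t ⊆ Icc 0 T := Icc_subset_Icc_right ht.2
    have hui : uIcc 0 t ⊆ Icc 0 T := by rw [uIcc_of_le ht.1]; exact hsub
    have hcont : ContinuousOn (fun r => 2 * ⟪u' r, u r⟫) (Icc 0 T) :=
      continuousOn_const.mul (hu'.inner huc)
    have hftc : ∫ r in (0 : ℝ)..t, 2 * ⟪u' r, u r⟫ = ‖u t‖ ^ 2 - ‖u 0‖ ^ 2 := by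
      refine intervalIntegral.integral_eq_sub_of_hasDerivAt_of_le ht.1
        (f := fun r => ‖u r‖ ^ 2) ((huc.norm.pow 2).mono hsub) ?_
        ((hcont.mono hui).intervalIntegrable)
      intro r hr
      have hr' : r ∈ Icc 0 T := hsub (Ioo_subset_Icc_self hr)
      have hd : HasDerivAt u (u' r) r :=
        (hu r hr').hasDerivAt (Icc_mem_nhds hr.1 (hr.2.trans_le ht.2))
      have := hd.norm_sq
      rw [real_inner_comm] at this
      exact this
    have hle : ∫ r in (0 : ℝ)..t, 2 * ⟪u' r, u r⟫
        ≤ ∫ r in (0 : ℝ)..t, (-β₁ r + β₀ r + 2 * p * M) := by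
      refine intervalIntegral.integral_mono_on ht.1 ((hcont.mono hui).intervalIntegrable)
        (((hβ₁.neg.add hβ₀).add continuousOn_const).mono hui).intervalIntegrable ?_
      intro r hr
      refine (hineq r (hsub hr)).trans ?_
      have := mul_le_mul_of_nonneg_left (hMle r (hsub hr)) (by positivity : 0 ≤ 2 * p)
      linarith
    have i1 := (hβ₁.mono hui).intervalIntegrable (μ := volume)
    have i0 := (hβ₀.mono hui).intervalIntegrable (μ := volume)
    have hsum : ∫ r in (0 : ℝ)..t, (-β₁ r + β₀ r + 2 * p * M)
        = -(∫ r in (0 : ℝ)..t, β₁ r) + (∫ r in (0 : ℝ)..t, β₀ r) + t * (2 * p * M) := by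
      have i1' : IntervalIntegrable (fun r => -β₁ r) volume 0 t := i1.neg
      rw [intervalIntegral.integral_add (f := fun r => -β₁ r + β₀ r) (i1'.add i0)
        intervalIntegrable_const, intervalIntegral.integral_add i1' i0,
        intervalIntegral.integral_neg, intervalIntegral.integral_const, smul_eq_mul, sub_zero]
    rw [hsum, hftc] at hle
    have hβ₀le : ∫ r in (0 : ℝ)..t, β₀ r ≤ s ^ 2 := by
      refine le_trans ?_ hI
      refine intervalIntegral.integral_mono_interval le_rfl ht.1 ht.2 ?_ ?_
      · refine (ae_restrict_iff' measurableSet_Ioc).2 (.of_forall fun r hr => ?_)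
        exact h₀ r (Ioc_subset_Icc_self hr)
      · exact (hβ₀.mono (by rw [uIcc_of_le hT.le])).intervalIntegrable
    have h2 : ‖u 0‖ ^ 2 ≤ m ^ 2 := by gcongr
    have h3 : t * (2 * p * M) ≤ T * (2 * p * M) := by
      gcongr; exact ht.2
    nlinarith
  have hβ₁nn : ∀ t ∈ Icc 0 T, 0 ≤ ∫ r in (0 : ℝ)..t, β₁ r := fun t ht =>
    intervalIntegral.integral_nonneg ht.1 fun r hr => h₁ r ⟨hr.1, hr.2.trans ht.2⟩
  have hMb : M ≤ s + m + 2 * p * T := by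
    have h := key tm htm
    have h' := hβ₁nn tm htm
    by_contra! hcon
    have : 0 ≤ p * T := by positivity
    have e : M ^ 2 ≤ m ^ 2 + s ^ 2 + 2 * p * T * M := by rw [← hM] at h; linarith
    nlinarith [mul_nonneg hs hm, mul_nonneg hs this, mul_nonneg hm this]
  refine ⟨fun t ht => (hMle t ht).trans hMb, ?_⟩
  have h := key T ⟨hT.le, le_rfl⟩
  have : 0 ≤ p * T := by positivity
  nlinarith [mul_nonneg hs hm, mul_nonneg hs this, mul_nonneg hm this, sq_nonneg ‖u T‖,
    mul_le_mul_of_nonneg_left hMb this]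

variable [CompleteSpace H]

/-- The resolvent `(R + ε)⁻¹` of a bounded nonnegative symmetric operator. -/
theorem exists_resolvent {R : H →L[ℝ] H} (hnn : ∀ x, 0 ≤ ⟪R x, x⟫) {ε : ℝ} (hε : 0 < ε) :
    ∃ K : H →L[ℝ] H, (∀ x, R (K x) = x - ε • K x) ∧ (∀ x, K (R x) = R (K x)) ∧
      (∀ x, ‖R (K x)‖ ≤ ‖x‖) := by
  let A : H →L[ℝ] H := R + ε • ContinuousLinearMap.id ℝ H
  let B : H →L[ℝ] H →L[ℝ] ℝ := (innerSL ℝ (E := H)).comp A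
  -- Lax-Milgram for R + ε: the nonnegativity of R makes the form coercive with constant ε.
  have hB : IsCoercive B := ⟨ε, hε, fun x => by
    have : B x x = ⟪R x, x⟫ + ε * ⟪x, x⟫ := by
      change ⟪R x + ε • x, x⟫ = _
      rw [inner_add_left, real_inner_smul_left]
    rw [this, real_inner_self_eq_norm_mul_norm]
    linarith [hnn x]⟩
  let e := hB.continuousLinearEquivOfBilin
  have he : ∀ x, e x = R x + ε • x := fun x => by
    refine ext_inner_right ℝ fun w => ?_
    rw [hB.continuousLinearEquivOfBilin_apply]
    rfl
  have hK : ∀ x, R (e.symm x) + ε • e.symm x = x := fun x => by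
    rw [← he, e.apply_symm_apply]
  have hcomm : ∀ x, e.symm (R x) = R (e.symm x) := fun x => by
    apply e.injective
    rw [e.apply_symm_apply, he]
    conv_lhs => rw [← hK x]
    simp
  refine ⟨(e.symm : H →L[ℝ] H), fun x => eq_sub_of_add_eq (hK x), hcomm, fun x => ?_⟩
  have h1 := hK x
  set y := e.symm x with hy
  -- Expanding ‖Ry + εy‖², the cross term 2ε⟪Ry, y⟫ is nonnegative, so ‖Ry‖ ≤ ‖x‖ with constant 1,
  -- uniformly in ε.
  have h2 : ‖x‖ ^ 2 = ‖R y‖ ^ 2 + 2 * ε * ⟪R y, y⟫ + ε ^ 2 * ‖y‖ ^ 2 := by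
    rw [← h1, norm_add_sq_real, inner_smul_right, norm_smul, Real.norm_of_nonneg hε.le]
    ring
  have h3 : ‖R y‖ ^ 2 ≤ ‖x‖ ^ 2 := by
    rw [h2]; nlinarith [hnn y, sq_nonneg ‖y‖, mul_nonneg hε.le (hnn y), mul_nonneg (sq_nonneg ε) (sq_nonneg ‖y‖)]
  exact le_of_sq_le_sq h3 (norm_nonneg _) 

end Abstract

/-! ### Regularized energy estimates for the abstract evolution equation. -/

section Abstract

variable {H : Type*} [NormedAddCommGroup H] [InnerProductSpace ℝ H]

/-- An abstract evolution equation `f' + (R⁻¹ - lam) f = G₀` on `[0, T]`, written after the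
application of the bounded operator `R`, with a source `G₀` whose successive derivatives `G k`
satisfy analytic bounds. -/
structure IsEvolution (R : H →L[ℝ] H) (lam T C : ℝ) (f : ℝ → H) (G : ℕ → ℝ → H) : Prop where
  symm : ∀ x y, ⟪R x, y⟫ = ⟪x, R y⟫
  lam_pos : 0 < lam
  lower : ∀ x, lam * ‖R x‖ ^ 2 ≤ ⟪R x, x⟫
  pos : 0 < T
  C_pos : 0 < C
  cont : ContinuousOn f (Icc 0 T)
  source_deriv : ∀ k, ∀ t ∈ Icc 0 T, HasDerivWithinAt (G k) (G (k + 1) t) (Icc 0 T) t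
  source_bound : ∀ k, ∀ t ∈ Icc 0 T, ‖G k t‖ ≤ C ^ (k + 1) * k.factorial
  deriv : ∀ t ∈ Icc 0 T,
    HasDerivWithinAt (fun t => R (f t)) (-f t + lam • R (f t) + R (G 0 t)) (Icc 0 T) t

/-- The form `⟪x, R y⟫ - lam ⟪R x, R y⟫`, i.e. the form of `R⁻¹ - lam` at `R x`, `R y`. -/
def resolventForm (R : H →L[ℝ] H) (lam : ℝ) (x y : H) : ℝ := ⟪x, R y⟫ - lam * ⟪R x, R y⟫

/-- The functions `R ^ k f⁽ᵏ⁾`, computed formally from the evolution equation. -/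
def formalDeriv (R : H →L[ℝ] H) (lam : ℝ) (f : ℝ → H) (G : ℕ → ℝ → H) : ℕ → ℝ → H
  | 0 => f
  | k + 1 => fun t => -formalDeriv R lam f G k t + lam • R (formalDeriv R lam f G k t)
      + (R ^ (k + 1)) (G k t)

namespace IsEvolution

variable {R K : H →L[ℝ] H} {lam T C : ℝ} {f : ℝ → H} {G : ℕ → ℝ → H}

theorem nonneg (h : IsEvolution R lam T C f G) (x : H) : 0 ≤ ⟪R x, x⟫ :=
  le_trans (mul_nonneg h.lam_pos.le (sq_nonneg _)) (h.lower x)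

theorem form_self_nonneg (h : IsEvolution R lam T C f G) (x : H) :
    0 ≤ resolventForm R lam x x := by
  rw [resolventForm, real_inner_self_eq_norm_sq, real_inner_comm]
  linarith [h.lower x]

/-- Nonnegativity of the form at κx + y. This is the inequality that absorbs the term produced by
differentiating the weight t^k. -/
theorem form_mul_le (h : IsEvolution R lam T C f G) (κ : ℝ) (x y : H) :
    -2 * κ * resolventForm R lam x y ≤
      κ ^ 2 * resolventForm R lam x x + resolventForm R lam y y := by
  have h1 := h.form_self_nonneg (κ • x + y)
  have e : resolventForm R lam (κ • x + y) (κ • x + y) =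
      κ ^ 2 * resolventForm R lam x x + 2 * κ * resolventForm R lam x y
        + resolventForm R lam y y := by
    have s1 : ⟪y, R x⟫ = ⟪x, R y⟫ := by rw [real_inner_comm, h.symm]
    have s2 : ⟪R y, R x⟫ = ⟪R x, R y⟫ := real_inner_comm _ _
    simp only [resolventForm, map_add, map_smul, inner_add_left, inner_add_right,
      real_inner_smul_left, real_inner_smul_right, s1, s2]
    ring
  rw [e] at h1
  linarith

theorem source_cont (h : IsEvolution R lam T C f G) (k : ℕ) : ContinuousOn (G k) (Icc 0 T) :=
  fun t ht => (h.source_deriv k t ht).continuousWithinAt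

theorem formalDeriv_cont (h : IsEvolution R lam T C f G) (k : ℕ) :
    ContinuousOn (formalDeriv R lam f G k) (Icc 0 T) := by
  induction k with
  | zero => exact h.cont
  | succ k ih =>
    exact (ih.neg.add ((R.continuous.comp_continuousOn ih).const_smul lam)).add
      ((R ^ (k + 1)).continuous.comp_continuousOn (h.source_cont k))

/-- The unbounded generator R⁻¹ - lam never has to be applied: one spare factor R makes the k-th
formal derivative differentiable, and the recursion is the equation differentiated k times and
multiplied by R^{k+1}. -/
theorem hasDerivWithinAt_formalDeriv (h : IsEvolution R lam T C f G) (k : ℕ) {t : ℝ}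
    (ht : t ∈ Icc 0 T) :
    HasDerivWithinAt (fun t => R (formalDeriv R lam f G k t)) (formalDeriv R lam f G (k + 1) t)
      (Icc 0 T) t := by
  induction k with
  | zero => simpa [formalDeriv] using h.deriv t ht
  | succ k ih =>
    have h1 := ih.neg.add (((R.hasFDerivAt.comp_hasDerivWithinAt t ih)).const_smul lam)
    have h2 := h1.add ((R ^ (k + 2)).hasFDerivAt.comp_hasDerivWithinAt t (h.source_deriv k t ht))
    refine (h2.congr_deriv ?_).congr_of_mem (fun s _ => ?_) ht
    · rfl
    · simp only [formalDeriv, map_add, map_neg, map_smul, Pi.add_apply, Pi.neg_apply,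
        Pi.smul_apply, Function.comp]
      rw [pow_succ' R (k + 1)]
      rfl

variable (R K lam f G) in
/-- The regularization `K ^ (k + j) R ^ j (R ^ k f⁽ᵏ⁾)` of the `k`-th derivative of `f`. -/
def reg (k j : ℕ) (t : ℝ) : H := (K ^ (k + j)) ((R ^ j) (formalDeriv R lam f G k t))

variable (R K lam f G) in
/-- The element whose image under `R` is `reg k (j + 1)`. -/
def pre (k j : ℕ) (t : ℝ) : H := (K ^ (k + j + 1)) ((R ^ j) (formalDeriv R lam f G k t))

theorem comm_pow (hK : ∀ x, K (R x) = R (K x)) (m n : ℕ) (x : H) :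
    (K ^ m) ((R ^ n) x) = (R ^ n) ((K ^ m) x) := by
  have hc : Commute K R := by ext x; exact hK x
  have := (hc.pow_pow m n).eq
  exact congrArg (fun A : H →L[ℝ] H => A x) this

theorem map_pre (hK : ∀ x, K (R x) = R (K x)) (k j : ℕ) (t : ℝ) :
    R (pre R K lam f G k j t) = reg R K lam f G k (j + 1) t := by
  have := comm_pow hK (k + j + 1) 1 ((R ^ j) (formalDeriv R lam f G k t))
  rw [pow_one] at this
  rw [pre, reg, ← this, ← add_assoc, pow_succ' R j]
  rfl

/-- The evolution equation at the regularized level. Since `pre` is the preimage under R of the next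
`reg`, the first two terms are -(R⁻¹ - lam) applied to it. -/
theorem reg_succ (k j : ℕ) (t : ℝ) :
    reg R K lam f G (k + 1) j t = -pre R K lam f G k j t + lam • reg R K lam f G k (j + 1) t
      + (K ^ (k + j + 1)) ((R ^ (k + j + 1)) (G k t)) := by
  have e1 : k + 1 + j = k + j + 1 := by ring
  have e3 : R ^ (k + j + 1) = R ^ j * R ^ (k + 1) := by rw [← pow_add]; congr 1; ring
  have e4 : (R ^ (j + 1)) (formalDeriv R lam f G k t)
    = (R ^ j) (R (formalDeriv R lam f G k t)) := by rw [pow_succ]; rfl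
  rw [reg, pre, reg, e1, ← add_assoc, e3, e4, formalDeriv]
  simp only [map_add, map_neg, map_smul]
  rfl

theorem reg_cont (h : IsEvolution R lam T C f G) (k j : ℕ) :
    ContinuousOn (reg R K lam f G k j) (Icc 0 T) :=
  (K ^ (k + j)).continuous.comp_continuousOn
    ((R ^ j).continuous.comp_continuousOn (h.formalDeriv_cont k))

theorem pre_cont (h : IsEvolution R lam T C f G) (k j : ℕ) :
    ContinuousOn (pre R K lam f G k j) (Icc 0 T) :=
  (K ^ (k + j + 1)).continuous.comp_continuousOn
    ((R ^ j).continuous.comp_continuousOn (h.formalDeriv_cont k))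

/-- A time derivative trades one spare factor of R for one more order, while the power of K, which
is the sum of the two indices, does not change. -/
theorem hasDerivWithinAt_reg (h : IsEvolution R lam T C f G) (k j : ℕ) {t : ℝ}
    (ht : t ∈ Icc 0 T) :
    HasDerivWithinAt (reg R K lam f G k (j + 1)) (reg R K lam f G (k + 1) j t) (Icc 0 T) t := by
  have h1 := (K ^ (k + (j + 1)) * R ^ j).hasFDerivAt.comp_hasDerivWithinAt t
    (h.hasDerivWithinAt_formalDeriv k ht)
  refine (h1.congr_deriv ?_).congr_of_mem (fun s _ => ?_) ht
  · rw [reg, show k + 1 + j = k + (j + 1) by ring]; rfl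
  · rw [reg, pow_succ]; rfl

/-- K and R commute, so K^n R^n = (KR)^n, and KR is a contraction. -/
theorem norm_pow_le (hP : ∀ x, ‖R (K x)‖ ≤ ‖x‖) (hK : ∀ x, K (R x) = R (K x)) (n : ℕ) (x : H) :
    ‖(K ^ n) ((R ^ n) x)‖ ≤ ‖x‖ := by
  induction n generalizing x with
  | zero => simp
  | succ n ih =>
    have : (K ^ (n + 1)) ((R ^ (n + 1)) x) = (K ^ n) ((R ^ n) (K (R x))) := by
      rw [pow_succ, pow_succ]
      change (K ^ n) (K ((R ^ n) (R x))) = _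
      have := comm_pow hK 1 n (R x)
      rw [pow_one] at this
      rw [this]
    rw [this]
    refine (ih _).trans ?_
    rw [hK]
    exact hP x

/-- The form bound constant: the weighted norms of `f⁽ᵏ⁾` are at most `B ^ (k + 1) * k!`. -/
theorem reg_bound (h : IsEvolution R lam T C f G) (hK : ∀ x, K (R x) = R (K x))
    (hP : ∀ x, ‖R (K x)‖ ≤ ‖x‖) {B : ℝ}
    (hB : B = 1 + ‖f 0‖ + 4 * T * ((1 + T) * (1 + C)) + (1 + T) * (1 + C)) (k : ℕ) : ∀ j : ℕ,
    (∀ t ∈ Icc 0 T, ‖t ^ k • reg R K lam f G k (j + 1) t‖ ≤ B ^ (k + 1) * k.factorial) ∧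
    ∫ t in (0 : ℝ)..T, resolventForm R lam (t ^ k • pre R K lam f G k j t)
      (t ^ k • pre R K lam f G k j t) ≤ (B ^ (k + 1) * k.factorial) ^ 2 := by
  have hT := h.pos
  have hC := h.C_pos
  have hf0 := norm_nonneg (f 0)
  have hformc : ∀ k j, ContinuousOn (fun t => resolventForm R lam (t ^ k • pre R K lam f G k j t)
      (t ^ k • pre R K lam f G k j t)) (Icc 0 T) := fun k j => by
    have c1 : ContinuousOn (fun t : ℝ => t ^ k • pre R K lam f G k j t) (Icc 0 T) :=
      ((continuous_pow k).continuousOn).smul (h.pre_cont k j)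
    have c2 := R.continuous.comp_continuousOn c1
    exact (c1.inner c2).sub (continuousOn_const.mul (c2.inner c2))
  -- A single number majorizing both the time weights and the analytic constant of the source: t^k
  -- C^{k+1} ≤ X^{k+1}.
  set X := (1 + T) * (1 + C) with hX
  have hX1 : 1 ≤ X := by nlinarith
  have hTX : 1 + T ≤ X := by nlinarith
  have hCX : 1 + C ≤ X := by nlinarith
  have hB1 : 1 ≤ B := by nlinarith
  have hBX : X ≤ B := by nlinarith
  have hB0 : 0 ≤ B := by linarith
  have hform_nn := h.form_self_nonneg
  -- The bound must be proved for all j together, because order k + 1 with index j uses the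
  -- dissipation of order k with index j + 1.
  induction k with
  | zero =>
    intro j
    have hb : 0 + ‖f 0‖ + 2 * C * T ≤ B ^ (0 + 1) * (Nat.factorial 0 : ℕ) := by
      simp only [zero_add, pow_one, Nat.factorial_zero, Nat.cast_one, mul_one]
      nlinarith
    have hnn : 0 ≤ 0 + ‖f 0‖ + 2 * C * T := by positivity
    have key := energy_inequality_integrated hT (p := C) (s := 0) (m := ‖f 0‖)
      (u := reg R K lam f G 0 (j + 1)) (u' := reg R K lam f G 1 j) (β₀ := fun _ => 0)
      (β₁ := fun t => resolventForm R lam (t ^ 0 • pre R K lam f G 0 j t)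
        (t ^ 0 • pre R K lam f G 0 j t)) hC.le le_rfl (norm_nonneg _)
      (fun t ht => h.hasDerivWithinAt_reg 0 j ht) (h.reg_cont 1 j) continuousOn_const
      (hformc 0 j) (fun _ _ => le_rfl) (fun t _ => hform_nn _) ?_ (by simp) ?_
    · refine ⟨fun t ht => ?_, key.2.trans (by gcongr)⟩
      rw [pow_zero, one_smul]
      exact (key.1 t ht).trans hb
    · intro t ht
      rw [pow_zero, one_smul, reg_succ, ← map_pre hK]
      set a := pre R K lam f G 0 j t
      have hg : ‖(K ^ (0 + j + 1)) ((R ^ (0 + j + 1)) (G 0 t))‖ ≤ C := by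
        refine (norm_pow_le hP hK _ _).trans ((h.source_bound 0 t ht).trans (by simp))
      set g := (K ^ (0 + j + 1)) ((R ^ (0 + j + 1)) (G 0 t))
      have h1 : ⟪g, R a⟫ ≤ C * ‖R a‖ := (real_inner_le_norm _ _).trans (by gcongr)
      rw [inner_add_left, inner_add_left, inner_neg_left, real_inner_smul_left, resolventForm]
      have := h.form_self_nonneg a
      rw [resolventForm] at this
      linarith
    · have : reg R K lam f G 0 (j + 1) 0 = (K ^ (j + 1)) ((R ^ (j + 1)) (f 0)) := by
        simp [reg, formalDeriv]
      rw [this]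
      exact norm_pow_le hP hK _ _
  | succ k ih =>
    intro j
    obtain ⟨-, ih2⟩ := ih (j + 1)
    set s := B ^ (k + 1) * k.factorial with hs
    have hs0 : 0 ≤ s := by positivity
    set κ : ℝ := ((k + 1 : ℕ) : ℝ) with hκ
    have hκ0 : 0 ≤ κ := by positivity
    set p : ℝ := (k + 1).factorial * (2 * X ^ (k + 2)) with hp
    have hp0 : 0 ≤ p := by positivity
    -- The inherited part κs equals B^{k+1}(k+1)! exactly. The missing factor B - 1 ≥ 4TX is what
    -- pays for the source.
    have hb : κ * s + 0 + 2 * p * T ≤ B ^ (k + 1 + 1) * (k + 1).factorial := by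
      have e1 : κ * s = B ^ (k + 1) * (k + 1).factorial := by
        rw [hs, hκ, Nat.factorial_succ]; push_cast; ring
      rw [e1, hp]
      have e2 : X ^ (k + 1) ≤ B ^ (k + 1) := by gcongr
      have e3 : 4 * T * X ≤ B - 1 := by rw [hB]; nlinarith
      have e4 : X ^ (k + 1) * (4 * T * X) ≤ B ^ (k + 1) * (B - 1) := by gcongr
      have e5 : (0 : ℝ) ≤ (k + 1).factorial := by positivity
      have e6 := mul_le_mul_of_nonneg_left e4 e5
      have e7 : X ^ (k + 2) = X ^ (k + 1) * X := pow_succ _ _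
      have e8 : B ^ (k + 1 + 1) = B ^ (k + 1) * B := pow_succ _ _
      rw [e7, e8]
      nlinarith
    have hnn : 0 ≤ κ * s + 0 + 2 * p * T := by positivity
    have key := energy_inequality_integrated hT (p := p) (s := κ * s) (m := 0)
      (u := fun t => t ^ (k + 1) • reg R K lam f G (k + 1) (j + 1) t)
      (u' := fun t => (κ * t ^ k) • reg R K lam f G (k + 1) (j + 1) t
        + t ^ (k + 1) • reg R K lam f G (k + 2) j t)
      (β₀ := fun t => κ ^ 2 * resolventForm R lam (t ^ k • pre R K lam f G k (j + 1) t)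
        (t ^ k • pre R K lam f G k (j + 1) t))
      (β₁ := fun t => resolventForm R lam (t ^ (k + 1) • pre R K lam f G (k + 1) j t)
        (t ^ (k + 1) • pre R K lam f G (k + 1) j t)) hp0 (by positivity) le_rfl
      ?_ ?_ (continuousOn_const.mul (hformc k (j + 1)))
      (hformc (k + 1) j) (fun _ _ => mul_nonneg (sq_nonneg _) (hform_nn _))
      (fun t _ => hform_nn _) ?_ ?_ (by simp)
    · exact ⟨fun t ht => (key.1 t ht).trans hb, key.2.trans (by gcongr)⟩
    · intro t ht
      have h1 := ((hasDerivAt_pow (k + 1) t).hasDerivWithinAt (s := Icc 0 T)).smul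
        (h.hasDerivWithinAt_reg (K := K) (k + 1) j ht)
      refine h1.congr_deriv ?_
      rw [add_comm]
      rfl
    · exact ((continuousOn_const.mul (continuous_pow k).continuousOn).smul (h.reg_cont _ _)).add
        ((continuous_pow (k + 1)).continuousOn.smul (h.reg_cont _ _))
    · intro t ht
      have ht0 : 0 ≤ t := ht.1
      have htX : t ≤ X := by linarith [ht.2]
      have hCX' : C ≤ X := by linarith
      set n := k + 1 + j + 1 with hn
      have e1 := reg_succ (lam := lam) (f := f) (G := G) (K := K) (R := R) k (j + 1) t
      have e2 := reg_succ (lam := lam) (f := f) (G := G) (K := K) (R := R) (k + 1) j t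
      rw [show k + (j + 1) + 1 = n by rw [hn]; ring] at e1
      rw [← hn] at e2
      have hg0 : ‖(K ^ n) ((R ^ n) (G k t))‖ ≤ C ^ (k + 1) * k.factorial :=
        (norm_pow_le hP hK _ _).trans (h.source_bound k t ht)
      have hg1 : ‖(K ^ n) ((R ^ n) (G (k + 1) t))‖ ≤ C ^ (k + 2) * (k + 1).factorial :=
        (norm_pow_le hP hK _ _).trans (h.source_bound (k + 1) t ht)
      set g0 := (K ^ n) ((R ^ n) (G k t))
      set g1 := (K ^ n) ((R ^ n) (G (k + 1) t))
      set x := pre R K lam f G k (j + 1) t with hx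
      set y := pre R K lam f G (k + 1) j t with hy
      have e3 : reg R K lam f G k (j + 1 + 1) t = R x := (map_pre hK _ _ _).symm
      have e4 : reg R K lam f G (k + 1) (j + 1) t = R y := (map_pre hK _ _ _).symm
      rw [e3] at e1
      rw [e4] at e2
      -- The derivative of the weight is removed by the equation: in κ t^k f^{(k+1)} the factor
      -- f^{(k+1)} is expressed through x, the preimage of order k, so that pairing with R y' yields
      -- the form at (x', y').
      have e5 : (κ * t ^ k) • reg R K lam f G (k + 1) (j + 1) t
          + t ^ (k + 1) • reg R K lam f G (k + 2) j t
          = κ • (-(t ^ k • x) + lam • R (t ^ k • x))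
            + (-(t ^ (k + 1) • y) + lam • R (t ^ (k + 1) • y))
            + ((κ * t ^ k) • g0 + t ^ (k + 1) • g1) := by
        rw [e1, show k + 2 = k + 1 + 1 from rfl, e2]
        simp only [map_smul]
        module
      have hgb : ‖(κ * t ^ k) • g0 + t ^ (k + 1) • g1‖ ≤ p := by
        have hX0 : 0 ≤ X := by linarith
        have q1 : ‖(κ * t ^ k) • g0‖ ≤ (k + 1).factorial * X ^ (k + 2) := by
          rw [norm_smul, Real.norm_of_nonneg (by positivity)]
          have r1 : t ^ k * C ^ (k + 1) ≤ (1 + T) ^ (k + 1) * (1 + C) ^ (k + 1) := by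
            have : t ^ k ≤ (1 + T) ^ (k + 1) :=
              (pow_le_pow_left₀ ht0 (by linarith [ht.2]) k).trans
                (pow_le_pow_right₀ (by linarith) (Nat.le_succ k))
            gcongr
            linarith
          have r2 : X ^ (k + 1) ≤ X ^ (k + 2) := pow_le_pow_right₀ hX1 (Nat.le_succ _)
          rw [← mul_pow, ← hX] at r1
          calc κ * t ^ k * ‖g0‖ ≤ κ * t ^ k * (C ^ (k + 1) * k.factorial) := by gcongr
            _ = (k + 1).factorial * (t ^ k * C ^ (k + 1)) := by
              rw [hκ, Nat.factorial_succ]; push_cast; ring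
            _ ≤ (k + 1).factorial * X ^ (k + 2) := by gcongr; exact r1.trans r2
        have q2 : ‖t ^ (k + 1) • g1‖ ≤ (k + 1).factorial * X ^ (k + 2) := by
          rw [norm_smul, Real.norm_of_nonneg (by positivity)]
          have r1 : t ^ (k + 1) * C ^ (k + 2) ≤ (1 + T) ^ (k + 2) * (1 + C) ^ (k + 2) := by
            have : t ^ (k + 1) ≤ (1 + T) ^ (k + 2) :=
              (pow_le_pow_left₀ ht0 (by linarith [ht.2]) _).trans
                (pow_le_pow_right₀ (by linarith) (Nat.le_succ _))
            gcongr
            linarith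
          rw [← mul_pow, ← hX] at r1
          calc t ^ (k + 1) * ‖g1‖ ≤ t ^ (k + 1) * (C ^ (k + 2) * (k + 1).factorial) := by gcongr
            _ = (k + 1).factorial * (t ^ (k + 1) * C ^ (k + 2)) := by ring
            _ ≤ (k + 1).factorial * X ^ (k + 2) := by gcongr
        refine (norm_add_le _ _).trans ?_
        rw [hp]
        linarith
      have e6 : t ^ (k + 1) • R y = R (t ^ (k + 1) • y) := (map_smul _ _ _).symm
      rw [e5, e4, e6]
      set x' := t ^ k • x
      set y' := t ^ (k + 1) • y
      set g := (κ * t ^ k) • g0 + t ^ (k + 1) • g1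
      have h1 : ⟪g, R y'⟫ ≤ p * ‖R y'‖ := (real_inner_le_norm _ _).trans (by gcongr)
      -- Of the two copies of the form at y' coming from 2⟪u', u⟫, one absorbs the cross term and
      -- the other remains as dissipation.
      have h2 := h.form_mul_le κ x' y'
      simp only [inner_add_left, inner_neg_left, real_inner_smul_left]
      simp only [resolventForm] at h2 ⊢
      linarith
    · rw [intervalIntegral.integral_const_mul, mul_pow]
      gcongr

end IsEvolution

end Abstract

/-! ### Removing the regularization. -/

section Abstract

variable {H : Type*} [NormedAddCommGroup H] [InnerProductSpace ℝ H]

/-- A quadratic Taylor bound implies differentiability within a set. -/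
theorem hasDerivWithinAt_of_quadratic {F : ℝ → H} {v : H} {s : Set ℝ} {t C : ℝ}
    (hF : ∀ᶠ r in 𝓝[s] t, ‖F r - F t - (r - t) • v‖ ≤ C * |r - t| ^ 2) :
    HasDerivWithinAt F v s t := by
  rw [hasDerivWithinAt_iff_isLittleO]
  refine (Asymptotics.IsBigO.of_bound C (g := fun r => |r - t| ^ 2) ?_).trans_isLittleO ?_
  · filter_upwards [hF] with r hr
    rwa [Real.norm_of_nonneg (by positivity)]
  · have : (fun r : ℝ => |r - t| ^ 2) = fun r => (r - t) ^ 2 := by ext r; exact sq_abs _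
    rw [this]
    have h2 : Tendsto (fun r : ℝ => r - t) (𝓝[s] t) (𝓝 0) := by
      have : Tendsto (fun r : ℝ => r - t) (𝓝 t) (𝓝 (t - t)) := (continuous_sub_right t).tendsto t
      rw [sub_self] at this
      exact this.mono_left nhdsWithin_le_nhds
    exact (Asymptotics.isLittleO_pow_id one_lt_two).comp_tendsto h2

/-- The mean value inequality is applied twice: to u' between t and r, then to r ↦ u r - r u'(t).
The loss of the factor ½ is harmless. -/
theorem norm_taylor_le {u u' u'' : ℝ → H} {a b C : ℝ}
    (h₁ : ∀ t ∈ Icc a b, HasDerivWithinAt u (u' t) (Icc a b) t)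
    (h₂ : ∀ t ∈ Icc a b, HasDerivWithinAt u' (u'' t) (Icc a b) t)
    (hC : ∀ t ∈ Icc a b, ‖u'' t‖ ≤ C) {s t : ℝ} (hs : s ∈ Icc a b) (ht : t ∈ Icc a b) :
    ‖u s - u t - (s - t) • u' t‖ ≤ C * |s - t| ^ 2 := by
  have hC0 : 0 ≤ C := (norm_nonneg _).trans (hC t ht)
  have hsub : uIcc t s ⊆ Icc a b := uIcc_subset_Icc ht hs
  have key := Convex.norm_image_sub_le_of_norm_hasDerivWithin_le (s := uIcc t s)
    (f := fun r => u r - r • u' t) (f' := fun r => u' r - u' t) (C := C * |s - t|) (x := t) (y := s)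
    (fun r hr => ((h₁ r (hsub hr)).mono hsub).sub
      (by simpa using (hasDerivWithinAt_id r (uIcc t s)).smul_const (u' t))) ?_ (convex_uIcc _ _)
      left_mem_uIcc right_mem_uIcc
  · rw [Real.norm_eq_abs] at key
    calc _ = ‖u s - s • u' t - (u t - t • u' t)‖ := by congr 1; module
      _ ≤ _ := key
      _ = _ := by ring
  · intro r hr
    have := (convex_Icc a b).norm_image_sub_le_of_norm_hasDerivWithin_le h₂ hC ht (hsub hr)
    refine this.trans ?_
    gcongr
    rw [Real.norm_eq_abs]
    exact abs_sub_left_of_mem_uIcc hr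

namespace IsEvolution

variable {R : H →L[ℝ] H} {lam T C : ℝ} {f : ℝ → H} {G : ℕ → ℝ → H}

variable (R) in
/-- A sequence of resolvents `(R + ε n)⁻¹` with `ε n → 0`. -/
structure IsResolventSeq (K : ℕ → H →L[ℝ] H) (ε : ℕ → ℝ) : Prop where
  eps_pos : ∀ n, 0 < ε n
  eps_tendsto : Tendsto ε atTop (𝓝 0)
  eq : ∀ n x, R (K n x) = x - ε n • K n x
  comm : ∀ n x, K n (R x) = R (K n x)
  contr : ∀ n x, ‖R (K n x)‖ ≤ ‖x‖

theorem exists_resolventSeq [CompleteSpace H] (h : IsEvolution R lam T C f G) :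
    ∃ K ε, IsResolventSeq R K ε := by
  choose K h1 h2 h3 using fun n : ℕ => exists_resolvent h.nonneg (Nat.one_div_pos_of_nat (α := ℝ) (n := n))
  exact ⟨K, _, ⟨fun n => Nat.one_div_pos_of_nat, tendsto_one_div_add_atTop_nhds_zero_nat, h1, h2, h3⟩⟩

namespace IsResolventSeq

variable {K : ℕ → H →L[ℝ] H} {ε : ℕ → ℝ}

theorem commute (hK : IsResolventSeq R K ε) (l n : ℕ) : Commute (K l) (K n) := by
  have e1 : ∀ n x, K n (R x + ε n • x) = x := fun n x => by
    rw [map_add, hK.comm, hK.eq, map_smul]; abel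
  have e2 : ∀ n x, R (K n x) + ε n • K n x = x := fun n x => by rw [hK.eq]; abel
  ext x
  change K l (K n x) = K n (K l x)
  have : K n x = R (K n (K l x)) + ε l • K n (K l x) := by
    conv_lhs => rw [← e2 l x]
    rw [map_add, hK.comm, map_smul]
  rw [this, e1]

theorem pow_pow_apply_comm (hK : IsResolventSeq R K ε) (l n a b c : ℕ) (x : H) :
    (K l ^ a) ((R ^ b) ((K n ^ a) ((R ^ c) x)))
      = (K n ^ a) ((R ^ b) ((K l ^ a) ((R ^ c) x))) := by
  rw [← comm_pow (hK.comm n), ← comm_pow (hK.comm l)]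
  exact congrArg (fun A : H →L[ℝ] H => A ((R ^ b) ((R ^ c) x))) ((hK.commute l n).pow_pow a a).eq

/-- On the range of R the error x - RKx is ε R K y, hence O(ε); density of the range and the uniform
contraction bound do the rest. -/
theorem tendsto_one (hK : IsResolventSeq R K ε) (hR : DenseRange R) (x : H) :
    Tendsto (fun n => R (K n x)) atTop (𝓝 x) := by
  rw [Metric.tendsto_atTop]
  intro δ hδ
  obtain ⟨y, hy⟩ := hR.exists_dist_lt x (by positivity : 0 < δ / 4)
  rw [dist_eq_norm] at hy
  have : Tendsto (fun n => ε n * ‖y‖) atTop (𝓝 0) := by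
    simpa using hK.eps_tendsto.mul_const ‖y‖
  obtain ⟨N, hN⟩ := Metric.tendsto_atTop.1 this (δ / 4) (by positivity)
  refine ⟨N, fun n hn => ?_⟩
  have hn' := hN n hn
  rw [Real.dist_eq, sub_zero, abs_of_nonneg (mul_nonneg (hK.eps_pos n).le (norm_nonneg _))] at hn'
  have e : R (K n x) - x = R (K n (x - R y)) - (x - R y) - ε n • R (K n y) := by
    have h1 : R (K n (R y)) = R y - ε n • R (K n y) := by rw [hK.eq, hK.comm]
    rw [map_sub, map_sub, h1]; abel
  rw [dist_eq_norm, e]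
  have h1 := norm_sub_le (R (K n (x - R y)) - (x - R y)) (ε n • R (K n y))
  have h2 := norm_sub_le (R (K n (x - R y))) (x - R y)
  have h3 := hK.contr n (x - R y)
  have h4 : ‖ε n • R (K n y)‖ ≤ ε n * ‖y‖ := by
    rw [norm_smul, Real.norm_of_nonneg (hK.eps_pos n).le]
    exact mul_le_mul_of_nonneg_left (hK.contr n y) (hK.eps_pos n).le
  linarith

theorem tendsto_seq (hK : IsResolventSeq R K ε) (hR : DenseRange R) {x : ℕ → H} {y : H}
    (hx : Tendsto x atTop (𝓝 y)) : Tendsto (fun n => R (K n (x n))) atTop (𝓝 y) := by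
  have h1 : Tendsto (fun n => R (K n (x n - y))) atTop (𝓝 0) := by
    refine squeeze_zero_norm (fun n => hK.contr n _) ?_
    simpa using (hx.sub_const y).norm
  have := h1.add (hK.tendsto_one hR y)
  simpa using this

theorem tendsto_pow (hK : IsResolventSeq R K ε) (hR : DenseRange R) (m : ℕ) (x : H) :
    Tendsto (fun n => (K n ^ m) ((R ^ m) x)) atTop (𝓝 x) := by
  induction m with
  | zero => simp
  | succ m ih =>
    refine (hK.tendsto_seq hR ih).congr fun n => ?_
    have := comm_pow (hK.comm n) m 1 ((R ^ m) x)
    rw [pow_one] at this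
    rw [← hK.comm, ← this, pow_succ', pow_succ']
    rfl

/-- Each factor KR differs from the identity by εK, which costs ε‖a‖ on a vector R a. -/
theorem norm_sub_pow_le (hK : IsResolventSeq R K ε) (n m : ℕ) (a : H) :
    ‖R a - (K n ^ m) ((R ^ m) (R a))‖ ≤ m * (ε n * ‖a‖) := by
  induction m with
  | zero => simp
  | succ m ih =>
    have e : R a - (K n ^ (m + 1)) ((R ^ (m + 1)) (R a)) = (R a - (K n ^ m) ((R ^ m) (R a)))
        + (K n ^ m) ((R ^ m) (ε n • R (K n a))) := by
      have h1 : K n (R (R a)) = R a - ε n • R (K n a) := by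
        rw [hK.comm, hK.eq, hK.comm]
      have h2 : (K n ^ (m + 1)) ((R ^ (m + 1)) (R a)) = (K n ^ m) ((R ^ m) (K n (R (R a)))) := by
        have := comm_pow (hK.comm n) 1 m (R (R a))
        rw [pow_one] at this
        rw [← this, pow_succ, pow_succ]; rfl
      rw [h2, h1, map_sub, map_sub]; abel
    rw [e]
    refine (norm_add_le _ _).trans ?_
    have h3 : ‖(K n ^ m) ((R ^ m) (ε n • R (K n a)))‖ ≤ ε n * ‖a‖ := by
      refine (norm_pow_le (hK.contr n) (hK.comm n) _ _).trans ?_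
      rw [norm_smul, Real.norm_of_nonneg (hK.eps_pos n).le]
      exact mul_le_mul_of_nonneg_left (hK.contr n a) (hK.eps_pos n).le
    rw [Nat.cast_succ]
    linarith

/-- If the preimages of the regularizations stay bounded, the regularizations converge. -/
theorem exists_limit [CompleteSpace H] (hK : IsResolventSeq R K ε) {k j : ℕ} {t A : ℝ}
    (hA : ∀ n, ‖pre R (K n) lam f G k j t‖ ≤ A) :
    ∃ y, Tendsto (fun n => reg R (K n) lam f G k (j + 1) t) atTop (𝓝 y) := by
  refine cauchySeq_tendsto_of_complete ?_
  set m := k + j + 1 with hm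
  have hA0 : 0 ≤ A := (norm_nonneg _).trans (hA 0)
  have key : ∀ n l, ‖reg R (K n) lam f G k (j + 1) t - (K l ^ m) ((R ^ m)
      (reg R (K n) lam f G k (j + 1) t))‖ ≤ m * (ε l * A) := fun n l => by
    rw [← map_pre (hK.comm n)]
    refine (hK.norm_sub_pow_le l m _).trans ?_
    have := (hK.eps_pos l).le
    gcongr
    exact hA n
  have hlim : Tendsto (fun n => m * (ε n * A)) atTop (𝓝 0) := by
    simpa using (hK.eps_tendsto.mul_const A).const_mul (m : ℝ)
  rw [Metric.cauchySeq_iff]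
  intro δ hδ
  obtain ⟨N, hN⟩ := Metric.tendsto_atTop.1 hlim (δ / 2) (by positivity)
  refine ⟨N, fun n hn l hl => ?_⟩
  have b1 := hN n hn
  have b2 := hN l hl
  rw [Real.dist_eq, sub_zero] at b1 b2
  have c1 := key n l
  have c2 := key l n
  -- All the operators commute, so smoothing the n-th regularization with the l-th resolvent gives
  -- the same vector as the reverse. This common vector lies close to both, which gives the Cauchy
  -- property.
  have e : (K l ^ m) ((R ^ m) (reg R (K n) lam f G k (j + 1) t))
      = (K n ^ m) ((R ^ m) (reg R (K l) lam f G k (j + 1) t)) := by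
    rw [reg, reg, show k + (j + 1) = m by rw [hm]; ring]
    exact hK.pow_pow_apply_comm l n m m (j + 1) _
  rw [e] at c1
  rw [dist_eq_norm]
  have := norm_sub_le_norm_sub_add_norm_sub (reg R (K n) lam f G k (j + 1) t)
    ((K n ^ m) ((R ^ m) (reg R (K l) lam f G k (j + 1) t))) (reg R (K l) lam f G k (j + 1) t)
  rw [norm_sub_rev ((K n ^ m) _) _] at this
  linarith [le_abs_self (m * (ε n * A)), le_abs_self (m * (ε l * A))]

end IsResolventSeq

/-- The solution of an abstract evolution equation is smooth for positive times, with analytic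
bounds which degenerate like powers of `t` at the initial time. -/
theorem smoothing [CompleteSpace H] (h : IsEvolution R lam T C f G) (hR : DenseRange R) :
    ∃ F : ℕ → ℝ → H, (∀ t ∈ Ioc 0 T, F 0 t = f t) ∧
      (∀ k, ∀ t ∈ Ioc 0 T, HasDerivWithinAt (F k) (F (k + 1) t) (Ioc 0 T) t) ∧
      (∀ k, ∀ t ∈ Ioc 0 T, F k t = R (-F (k + 1) t + lam • F k t + G k t)) ∧
      ∃ B : ℝ, 0 < B ∧ ∀ k : ℕ, (∀ t ∈ Ioc 0 T, ‖t ^ k • F k t‖ ≤ B ^ (k + 1) * k.factorial) ∧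
        ∫⁻ t in Ioc 0 T, ENNReal.ofReal (resolventForm R lam
          (t ^ k • (-F (k + 1) t + lam • F k t + G k t))
          (t ^ k • (-F (k + 1) t + lam • F k t + G k t)))
          ≤ ENNReal.ofReal ((B ^ (k + 1) * k.factorial) ^ 2) := by
  obtain ⟨K, ε, hK⟩ := h.exists_resolventSeq
  have hT := h.pos
  set B := 1 + ‖f 0‖ + 4 * T * ((1 + T) * (1 + C)) + (1 + T) * (1 + C) with hB
  have hB0 : 0 < B := by
    have := h.C_pos
    positivity
  have hsub : Ioc 0 T ⊆ Icc 0 T := Ioc_subset_Icc_self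
  have hb := fun n k j => h.reg_bound (hK.comm n) (hK.contr n) hB k j
  have hreg : ∀ n k j, ∀ t ∈ Ioc 0 T,
      ‖reg R (K n) lam f G k (j + 1) t‖ ≤ B ^ (k + 1) * k.factorial / t ^ k := by
    intro n k j t ht
    have := (hb n k j).1 t (hsub ht)
    rw [norm_smul, Real.norm_of_nonneg (pow_nonneg ht.1.le k)] at this
    rwa [le_div_iff₀' (pow_pos ht.1 k)]
  have hpre : ∀ n k j t, pre R (K n) lam f G k j t = -reg R (K n) lam f G (k + 1) j t
      + lam • reg R (K n) lam f G k (j + 1) t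
      + (K n ^ (k + j + 1)) ((R ^ (k + j + 1)) (G k t)) := fun n k j t => by
    rw [reg_succ]; abel
  -- Solving the equation for the preimage bounds it by the estimates of orders k + 1 and k,
  -- uniformly in n for fixed t > 0. Index 1 leaves the spare factor of R that the bound of order k
  -- + 1 requires.
  have hpreb : ∀ k, ∀ t ∈ Ioc 0 T, ∃ A, ∀ n, ‖pre R (K n) lam f G k 1 t‖ ≤ A := by
    intro k t ht
    refine ⟨B ^ (k + 2) * (k + 1).factorial / t ^ (k + 1)
      + lam * (B ^ (k + 1) * k.factorial / t ^ k) + ‖G k t‖, fun n => ?_⟩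
    rw [hpre]
    refine (norm_add₃_le).trans ?_
    rw [norm_neg, norm_smul, Real.norm_of_nonneg h.lam_pos.le]
    have := h.lam_pos.le
    gcongr
    · exact hreg n (k + 1) 0 t ht
    · exact hreg n k 1 t ht
    · exact norm_pow_le (hK.contr n) (hK.comm n) _ _
  have hex : ∀ k t, ∃ y, t ∈ Ioc 0 T → Tendsto (fun n => reg R (K n) lam f G k 2 t) atTop (𝓝 y) := by
    intro k t
    by_cases ht : t ∈ Ioc 0 T
    · obtain ⟨A, hA⟩ := hpreb k t ht
      obtain ⟨y, hy⟩ := hK.exists_limit hA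
      exact ⟨y, fun _ => hy⟩
    · exact ⟨0, fun h => absurd h ht⟩
  choose F hF using hex
  -- Additional factors RK tend strongly to the identity, so every index at least 2 has the same
  -- limit.
  have hFj : ∀ k j t, t ∈ Ioc 0 T →
      Tendsto (fun n => reg R (K n) lam f G k (j + 2) t) atTop (𝓝 (F k t)) := by
    intro k j t ht
    induction j with
    | zero => exact hF k t ht
    | succ j ih =>
      refine (hK.tendsto_seq hR ih).congr fun n => ?_
      have := comm_pow (hK.comm n) (k + (j + 2)) 1 ((R ^ (j + 2)) (formalDeriv R lam f G k t))
      rw [pow_one] at this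
      rw [← hK.comm, reg, reg, ← this,
        show k + (j + 1 + 2) = (k + (j + 2)) + 1 by ring, show j + 1 + 2 = (j + 2) + 1 by ring,
        pow_succ' (K n), pow_succ' R (j + 2)]
      rfl
  have hFpre : ∀ k t, t ∈ Ioc 0 T → Tendsto (fun n => pre R (K n) lam f G k 2 t) atTop
      (𝓝 (-F (k + 1) t + lam • F k t + G k t)) := by
    intro k t ht
    simp only [hpre]
    exact ((hFj (k + 1) 0 t ht).neg.add ((hFj k 1 t ht).const_smul lam)).add
      (hK.tendsto_pow hR _ _)
  refine ⟨F, fun t ht => ?_, fun k t ht => ?_, fun k t ht => ?_, B, hB0, fun k => ⟨fun t ht => ?_, ?_⟩⟩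
  · refine tendsto_nhds_unique (hF 0 t ht) ?_
    simpa [reg, formalDeriv] using hK.tendsto_pow hR 2 (f t)
  · have htpos := ht.1
    -- On [t/2, T] the weights t^k are bounded below, so second derivatives are bounded uniformly in
    -- n and a quadratic Taylor estimate survives the limit.
    refine hasDerivWithinAt_of_quadratic (C := B ^ (k + 3) * (k + 2).factorial / (t / 2) ^ (k + 2)) ?_
    have hmem : Ioc 0 T ∩ Ioi (t / 2) ∈ 𝓝[Ioc 0 T] t :=
      inter_mem_nhdsWithin _ (Ioi_mem_nhds (by linarith))
    filter_upwards [hmem] with s hs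
    have hsub' : Icc (t / 2) T ⊆ Icc 0 T := Icc_subset_Icc_left (by positivity)
    have hlim : Tendsto (fun n => ‖reg R (K n) lam f G k 3 s - reg R (K n) lam f G k 3 t
        - (s - t) • reg R (K n) lam f G (k + 1) 2 t‖) atTop
        (𝓝 ‖F k s - F k t - (s - t) • F (k + 1) t‖) :=
      (((hFj k 1 s hs.1).sub (hFj k 1 t ht)).sub ((hFj (k + 1) 0 t ht).const_smul _)).norm
    refine le_of_tendsto hlim (.of_forall fun n => ?_)
    -- Index 3 is used because two differentiations lower it to 1, the smallest index for which the
    -- uniform bound is available.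
    refine norm_taylor_le (a := t / 2) (b := T) (u'' := reg R (K n) lam f G (k + 2) 1)
      (fun r hr => (h.hasDerivWithinAt_reg k 2 (hsub' hr)).mono hsub')
      (fun r hr => (h.hasDerivWithinAt_reg (k + 1) 1 (hsub' hr)).mono hsub') (fun r hr => ?_)
      ⟨hs.2.le, hs.1.2⟩ ⟨by linarith, ht.2⟩
    have hr0 : 0 < r := lt_of_lt_of_le (by positivity) hr.1
    refine (hreg n (k + 2) 0 r ⟨hr0, hr.2⟩).trans ?_
    gcongr
    exact hr.1
  · refine tendsto_nhds_unique (hFj k 1 t ht) ?_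
    refine ((R.continuous.tendsto _).comp (hFpre k t ht)).congr fun n => ?_
    exact map_pre (hK.comm n) k 2 t
  · refine le_of_tendsto ((hF k t ht).const_smul (t ^ k)).norm (.of_forall fun n => ?_)
    exact (hb n k 1).1 t (hsub ht)
  · set φ : ℕ → ℝ → ℝ := fun n t => resolventForm R lam (t ^ k • pre R (K n) lam f G k 2 t)
      (t ^ k • pre R (K n) lam f G k 2 t) with hφ
    have hφc : ∀ n, ContinuousOn (φ n) (Icc 0 T) := fun n => by
      have c1 : ContinuousOn (fun t : ℝ => t ^ k • pre R (K n) lam f G k 2 t) (Icc 0 T) :=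
        ((continuous_pow k).continuousOn).smul (h.pre_cont k 2)
      have c2 := R.continuous.comp_continuousOn c1
      exact (c1.inner c2).sub (continuousOn_const.mul (c2.inner c2))
    have hφlim : ∀ t ∈ Ioc 0 T, Tendsto (fun n => ENNReal.ofReal (φ n t)) atTop
        (𝓝 (ENNReal.ofReal (resolventForm R lam
          (t ^ k • (-F (k + 1) t + lam • F k t + G k t))
          (t ^ k • (-F (k + 1) t + lam • F k t + G k t))))) := fun t ht => by
      refine (ENNReal.continuous_ofReal.tendsto _).comp ?_
      have c1 := (hFpre k t ht).const_smul (t ^ k)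
      have c2 := (R.continuous.tendsto _).comp c1
      exact (c1.inner c2).sub ((c2.inner c2).const_mul lam)
    -- Fatou's lemma: the dissipation converges pointwise, and its integrals are bounded uniformly
    -- in n.
    calc _ = ∫⁻ t in Ioc 0 T, liminf (fun n => ENNReal.ofReal (φ n t)) atTop :=
          setLIntegral_congr_fun measurableSet_Ioc fun t ht => (hφlim t ht).liminf_eq.symm
      _ ≤ liminf (fun n => ∫⁻ t in Ioc 0 T, ENNReal.ofReal (φ n t)) atTop :=
          lintegral_liminf_le' fun n =>
            (((hφc n).mono hsub).aemeasurable measurableSet_Ioc).ennreal_ofReal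
      _ ≤ _ := by
        refine liminf_le_of_le (by isBoundedDefault) fun b hb' => ?_
        obtain ⟨n, hn⟩ := hb'.exists
        refine hn.trans ?_
        rw [← ofReal_integral_eq_lintegral_ofReal]
        · refine ENNReal.ofReal_le_ofReal ?_
          rw [← intervalIntegral.integral_of_le hT.le]
          exact (hb n k 2).2
        · exact ((hφc n).integrableOn_Icc).mono_set hsub
        · exact .of_forall fun t => h.form_self_nonneg _

end IsEvolution

end Abstract

/-! ### From a coercive variational problem to the abstract evolution equation. -/

section Abstract

variable {H : Type*} [NormedAddCommGroup H] [InnerProductSpace ℝ H] [CompleteSpace H]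
variable {V : Type*} [NormedAddCommGroup V] [InnerProductSpace ℝ V] [CompleteSpace V]

/-- The solution operator of the elliptic problem for a coercive form. -/
theorem exists_solutionOperator (ι : V →L[ℝ] H) (b : V →L[ℝ] V →L[ℝ] ℝ) {c lam : ℝ} (hc : 0 < c)
    (coer : ∀ x, c * ‖x‖ ^ 2 ≤ b x x + lam * ‖ι x‖ ^ 2) :
    ∃ Θ : H →L[ℝ] V, ∀ w U, b (Θ w) U + lam * ⟪ι (Θ w), ι U⟫ = ⟪w, ι U⟫ := by
  let I : H →L[ℝ] H →L[ℝ] ℝ := innerSL ℝ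
  let B : V →L[ℝ] V →L[ℝ] ℝ := b + lam • I.bilinearComp ι ι
  have hBa : ∀ x y, B x y = b x y + lam * ⟪ι x, ι y⟫ := fun x y => rfl
  have hB : IsCoercive B := ⟨c, hc, fun x => by
    rw [hBa, real_inner_self_eq_norm_sq]
    linarith [coer x]⟩
  let e := hB.continuousLinearEquivOfBilin
  -- The adjoint of ι represents the functional U ↦ ⟪w, ι U⟫ in V, to which the Lax-Milgram
  -- isomorphism is then applied.
  refine ⟨(e.symm : V →L[ℝ] V).comp (ContinuousLinearMap.adjoint ι), fun w U => ?_⟩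
  rw [← hBa, ← hB.continuousLinearEquivOfBilin_apply]
  change ⟪e (e.symm (ContinuousLinearMap.adjoint ι w)), U⟫ = _
  rw [e.apply_symm_apply, ContinuousLinearMap.adjoint_inner_left]

/-- A variational evolution equation, tested against a dense set of vectors, is solved by a
function which is smooth for positive times, with analytic bounds. -/
theorem variational_smoothing (ι : V →L[ℝ] H) (b : V →L[ℝ] V →L[ℝ] ℝ)
    (symm : ∀ x y, b x y = b y x) (nonneg : ∀ x, 0 ≤ b x x) {c lam : ℝ} (hc : 0 < c)
    (hlam : 0 < lam) (coer : ∀ x, c * ‖x‖ ^ 2 ≤ b x x + lam * ‖ι x‖ ^ 2) (hι : DenseRange ι)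
    {T C : ℝ} (hT : 0 < T) (hC : 0 < C) {f : ℝ → H} (hf : ContinuousOn f (Icc 0 T))
    {G : ℕ → ℝ → H}
    (hG : ∀ k, ∀ t ∈ Icc 0 T, HasDerivWithinAt (G k) (G (k + 1) t) (Icc 0 T) t)
    (hGb : ∀ k, ∀ t ∈ Icc 0 T, ‖G k t‖ ≤ C ^ (k + 1) * k.factorial)
    {U : ℝ → V} (hU : IntegrableOn U (Ioc 0 T))
    (hUf : ∀ᵐ s ∂volume.restrict (Ioc 0 T), ι (U s) = f s) {D : Set V} (hD : Dense D)
    (heq : ∀ Φ ∈ D, ∀ t ∈ Icc 0 T, ⟪f t, ι Φ⟫ - ⟪f 0, ι Φ⟫ + ∫ s in (0 : ℝ)..t, b (U s) Φ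
      = ∫ s in (0 : ℝ)..t, ⟪G 0 s, ι Φ⟫) :
    ∃ (F : ℕ → ℝ → H) (W : ℕ → ℝ → V), (∀ t ∈ Ioc 0 T, F 0 t = f t) ∧
      (∀ k, ∀ t ∈ Ioc 0 T, HasDerivWithinAt (F k) (F (k + 1) t) (Ioc 0 T) t) ∧
      (∀ k, ∀ t ∈ Ioc 0 T, ι (W k t) = F k t) ∧
      ∃ B : ℝ, 0 < B ∧ ∀ k : ℕ, (∀ t ∈ Ioc 0 T, ‖t ^ k • F k t‖ ≤ B ^ (k + 1) * k.factorial) ∧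
        ∫⁻ t in Ioc 0 T, ENNReal.ofReal (b (t ^ k • W k t) (t ^ k • W k t))
          ≤ ENNReal.ofReal ((B ^ (k + 1) * k.factorial) ^ 2) := by
  obtain ⟨Θ, hΘ⟩ := exists_solutionOperator ι b hc coer
  set R : H →L[ℝ] H := ι.comp Θ with hR
  have hRa : ∀ x, R x = ι (Θ x) := fun _ => rfl
  have hform : ∀ x y, ⟪x, R y⟫ = b (Θ x) (Θ y) + lam * ⟪R x, R y⟫ := fun x y => (hΘ x (Θ y)).symm
  -- Symmetry of R comes from the expression of ⟪x, R y⟫ through b at Θx, Θy, where b is symmetric.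
  have hRsymm : ∀ x y, ⟪R x, y⟫ = ⟪x, R y⟫ := fun x y => by
    rw [real_inner_comm, hform y x, hform x y, symm, real_inner_comm]
  have hrf : ∀ x, resolventForm R lam x x = b (Θ x) (Θ x) := fun x => by
    rw [resolventForm, hform]; ring
  -- R is symmetric, so it suffices that its kernel is trivial. If R y = 0, then b vanishes at Θy,
  -- coercivity gives Θy = 0, and y is orthogonal to the dense range of ι.
  have hRdense : DenseRange R := by
    have : (LinearMap.range (R : H →ₗ[ℝ] H)).topologicalClosure = ⊤ := by
      rw [Submodule.topologicalClosure_eq_top_iff, Submodule.eq_bot_iff]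
      intro y hy
      have h1 : R y = 0 := by
        refine ext_inner_left ℝ fun x => ?_
        rw [← hRsymm, inner_zero_right]
        exact hy _ ⟨x, rfl⟩
      have h2 : Θ y = 0 := by
        have e1 := hform y y
        rw [h1, inner_zero_right, inner_zero_right, mul_zero, add_zero] at e1
        have e2 := coer (Θ y)
        rw [← e1, ← hRa, h1, norm_zero] at e2
        have : ‖Θ y‖ ^ 2 = 0 := by nlinarith [sq_nonneg ‖Θ y‖]
        simpa using this
      have h3 : ∀ z, ⟪y, z⟫ = 0 := by
        intro z
        have hcont : Continuous fun z : H => ⟪y, z⟫ := continuous_const.inner continuous_id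
        refine congrFun (hι.equalizer hcont (continuous_const (y := (0 : ℝ))) ?_) z
        ext U
        have := hΘ y U
        rw [← hRa, h1, h2] at this
        simpa using this.symm
      exact inner_self_eq_zero.1 (h3 y)
    exact Submodule.dense_iff_topologicalClosure_eq_top.2 this
  have hGc := fun t ht => (hG 0 t ht).continuousWithinAt
  have hsub : ∀ t ∈ Icc 0 T, uIcc 0 t ⊆ Icc 0 T := fun t ht => by
    rw [uIcc_of_le ht.1]; exact Icc_subset_Icc_right ht.2
  have hUi : ∀ t ∈ Icc 0 T, IntervalIntegrable U volume 0 t := fun t ht => by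
    rw [intervalIntegrable_iff_integrableOn_Ioc_of_le ht.1]
    exact hU.mono_set (Ioc_subset_Ioc_right ht.2)
  have hfi : ∀ t ∈ Icc 0 T, IntervalIntegrable f volume 0 t := fun t ht =>
    (hf.mono (hsub t ht)).intervalIntegrable
  have hGi : ∀ t ∈ Icc 0 T, IntervalIntegrable (G 0) volume 0 t := fun t ht =>
    (ContinuousOn.mono hGc (hsub t ht)).intervalIntegrable
  -- The time integrals are moved inside b and the inner product. Both sides are then continuous in
  -- Φ, and the equation extends from the dense set to all of V.
  have heq' : ∀ Φ, ∀ t ∈ Icc 0 T, ⟪f t, ι Φ⟫ - ⟪f 0, ι Φ⟫ + ∫ s in (0 : ℝ)..t, b (U s) Φ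
      = ∫ s in (0 : ℝ)..t, ⟪G 0 s, ι Φ⟫ := by
    intro Φ t ht
    have e1 : ∀ Φ, ∫ s in (0 : ℝ)..t, b (U s) Φ = b (∫ s in (0 : ℝ)..t, U s) Φ := fun Φ =>
      (b.flip Φ).intervalIntegral_comp_comm (hUi t ht)
    have e2 : ∀ Φ, ∫ s in (0 : ℝ)..t, ⟪G 0 s, ι Φ⟫ = ⟪ι Φ, ∫ s in (0 : ℝ)..t, G 0 s⟫ := fun Φ => by
      rw [← innerSL_apply_apply ℝ, ← ContinuousLinearMap.intervalIntegral_comp_comm _ (hGi t ht)]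
      simp only [innerSL_apply_apply, real_inner_comm]
    rw [e1, e2]
    refine congrFun (Continuous.ext_on hD
      (f := fun Φ => ⟪f t, ι Φ⟫ - ⟪f 0, ι Φ⟫ + b (∫ s in (0 : ℝ)..t, U s) Φ)
      (g := fun Φ => ⟪ι Φ, ∫ s in (0 : ℝ)..t, G 0 s⟫) ?_ ?_ fun Φ hΦ => ?_) Φ
    · exact ((continuous_const.inner ι.continuous).sub (continuous_const.inner ι.continuous)).add
        (b _).continuous
    · exact ι.continuous.inner continuous_const
    · have := heq Φ hΦ t ht
      rw [e1, e2] at this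
      exact this
  have hRf : ∀ t ∈ Icc 0 T, R (f t) = R (f 0) + ∫ s in (0 : ℝ)..t,
      (-f s + lam • R (f s) + R (G 0 s)) := by
    intro t ht
    have i1 : IntervalIntegrable (fun s => R (f s)) volume 0 t :=
      ((R.continuous.comp_continuousOn hf).mono (hsub t ht)).intervalIntegrable
    have i2 : IntervalIntegrable (fun s => R (G 0 s)) volume 0 t :=
      ((R.continuous.comp_continuousOn hGc).mono (hsub t ht)).intervalIntegrable
    have i3 : IntervalIntegrable (fun s => -f s + lam • R (f s) + R (G 0 s)) volume 0 t :=
      ((hfi t ht).neg.add (i1.smul lam)).add i2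
    refine ext_inner_right ℝ fun w => ?_
    have h1 := heq' (Θ w) t ht
    -- Testing with Θw makes the equation bounded: by the defining relation of Θ, the form at (U s,
    -- Θw) involves only f s and R (f s).
    have e1 : ∫ s in (0 : ℝ)..t, b (U s) (Θ w)
        = ∫ s in (0 : ℝ)..t, (⟪f s, w⟫ - lam * ⟪R (f s), w⟫) := by
      refine intervalIntegral.integral_congr_ae_restrict ?_
      rw [uIoc_of_le ht.1]
      refine ae_restrict_of_ae_restrict_of_subset (Ioc_subset_Ioc_right ht.2) ?_
      filter_upwards [hUf] with s hs
      have := hΘ w (U s)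
      rw [hs, symm, ← hRa] at this
      rw [hRsymm, real_inner_comm w (f s), ← this, real_inner_comm (f s)]
      ring
    have e2 : ⟪∫ s in (0 : ℝ)..t, (-f s + lam • R (f s) + R (G 0 s)), w⟫
        = ∫ s in (0 : ℝ)..t, ⟪-f s + lam • R (f s) + R (G 0 s), w⟫ := by
      rw [real_inner_comm, ← innerSL_apply_apply ℝ,
        ← ContinuousLinearMap.intervalIntegral_comp_comm _ i3]
      simp only [innerSL_apply_apply, real_inner_comm]
    have hin : ∀ {g : ℝ → H}, IntervalIntegrable g volume 0 t →
        IntervalIntegrable (fun s => ⟪g s, w⟫) volume 0 t := fun {g} hg => by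
      refine (intervalIntegrable_iff.2 ?_)
      have := (innerSL ℝ w).integrable_comp (intervalIntegrable_iff.1 hg)
      simpa only [innerSL_apply_apply, real_inner_comm] using! this
    rw [inner_add_left, e2]
    have e3 : ∫ s in (0 : ℝ)..t, ⟪-f s + lam • R (f s) + R (G 0 s), w⟫
        = -(∫ s in (0 : ℝ)..t, (⟪f s, w⟫ - lam * ⟪R (f s), w⟫))
          + ∫ s in (0 : ℝ)..t, ⟪R (G 0 s), w⟫ := by
      rw [← intervalIntegral.integral_neg, ← intervalIntegral.integral_add]
      · refine intervalIntegral.integral_congr fun s _ => ?_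
        simp only [inner_add_left, inner_neg_left, real_inner_smul_left]
        ring
      · exact ((hin (hfi t ht)).sub ((hin i1).const_mul lam)).neg
      · exact hin i2
    have e4 : ∀ x, ⟪x, ι (Θ w)⟫ = ⟪R x, w⟫ := fun x => by rw [← hRa, hRsymm]
    simp only [e4] at h1
    rw [e3]
    rw [e1] at h1
    linarith
  have hev : IsEvolution R lam T C f G :=
    { symm := hRsymm
      lam_pos := hlam
      lower := fun x => by
        have := nonneg (Θ x)
        rw [← hrf, resolventForm, real_inner_self_eq_norm_sq, real_inner_comm] at this
        linarith
      pos := hT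
      C_pos := hC
      cont := hf
      source_deriv := hG
      source_bound := hGb
      deriv := fun t ht => by
        have hcont : ContinuousOn (fun s => -f s + lam • R (f s) + R (G 0 s)) (Icc 0 T) :=
          (hf.neg.add ((R.continuous.comp_continuousOn hf).const_smul lam)).add
            (R.continuous.comp_continuousOn hGc)
        have : Fact (t ∈ Icc 0 T) := ⟨ht⟩
        have hd := intervalIntegral.integral_hasDerivWithinAt_right (s := Icc 0 T) (t := Icc 0 T)
          ((hcont.mono (hsub t ht)).intervalIntegrable)
          (hcont.stronglyMeasurableAtFilter_nhdsWithin measurableSet_Icc t) (hcont t ht)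
        exact (hd.const_add (R (f 0))).congr_of_mem hRf ht }
  obtain ⟨F, hF0, hFd, hFR, B, hB, hFB⟩ := hev.smoothing hRdense
  -- The lift to V is Θ applied to the vector whose image under R = ιΘ is the k-th derivative.
  refine ⟨F, fun k t => Θ (-F (k + 1) t + lam • F k t + G k t), hF0, hFd,
    fun k t ht => (hFR k t ht).symm, B, hB, fun k => ⟨(hFB k).1, ?_⟩⟩
  simp only [← map_smul, ← hrf]
  exact (hFB k).2

end Abstract

/-! ### Gaussian integrals -/

theorem integrable_exp_neg_mul_sq {c : ℝ} (hc : 0 < c) :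
    Integrable (fun w : Vel => Real.exp (-c * ‖w‖ ^ 2)) := by
  refine .of_integral_ne_zero ?_
  rw [GaussianFourier.integral_rexp_neg_mul_sq_norm hc]
  positivity

/-- From (1 + r)^N ≤ e^{Nr} and completing the square against half of the Gaussian exponent. -/
theorem one_add_pow_mul_exp_le {c : ℝ} (hc : 0 < c) (N : ℕ) (r : ℝ) (hr : 0 ≤ r) :
    (1 + r) ^ N * Real.exp (-c * r ^ 2)
      ≤ Real.exp (N ^ 2 / (2 * c)) * Real.exp (-(c / 2) * r ^ 2) := by
  have h1 : (1 + r) ^ N ≤ Real.exp (N * r) := by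
    rw [Real.exp_nat_mul]
    have := Real.add_one_le_exp r
    gcongr
    linarith
  calc (1 + r) ^ N * Real.exp (-c * r ^ 2) ≤ Real.exp (N * r) * Real.exp (-c * r ^ 2) := by gcongr
    _ = Real.exp (N * r - c * r ^ 2) := by rw [← Real.exp_add]; ring_nf
    _ ≤ Real.exp (N ^ 2 / (2 * c) + -(c / 2) * r ^ 2) := by
      apply Real.exp_le_exp.2
      have : (N : ℝ) ^ 2 / (2 * c) + -(c / 2) * r ^ 2 - (N * r - c * r ^ 2)
        = (N - c * r) ^ 2 / (2 * c) := by field_simp; ring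
      have h2 : 0 ≤ ((N : ℝ) - c * r) ^ 2 / (2 * c) := by positivity
      linarith
    _ = _ := Real.exp_add _ _

theorem integrable_pow_mul_exp {c : ℝ} (hc : 0 < c) (N : ℕ) :
    Integrable (fun w : Vel => (1 + ‖w‖) ^ N * Real.exp (-c * ‖w‖ ^ 2)) := by
  refine ((integrable_exp_neg_mul_sq (half_pos hc)).const_mul (Real.exp (N ^ 2 / (2 * c)))).mono'
    (by fun_prop) (.of_forall fun w => ?_)
  rw [Real.norm_of_nonneg (by positivity)]
  exact one_add_pow_mul_exp_le hc N _ (norm_nonneg _)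

theorem norm_sub_le_mul (v w : Vel) : ‖v - w‖ ≤ (1 + ‖v‖) * (1 + ‖w‖) := by
  have := norm_sub_le v w
  nlinarith [norm_nonneg v, norm_nonneg w]

/-- Splits the kernel at |v - w| = 1. Outside the ball the exponent may be raised to max(s, 0) and
the submultiplicative bound on |v - w| separates the variables; inside, only local integrability is
needed. -/
theorem norm_rpow_le (s : ℝ) (v w : Vel) :
    ‖v - w‖ ^ s ≤ (1 + ‖v‖) ^ (max s 0) * (1 + ‖w‖) ^ (max s 0)
      + (Metric.ball (0 : Vel) 1).indicator (fun z => ‖z‖ ^ s) (v - w) := by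
  by_cases h : v - w ∈ Metric.ball (0 : Vel) 1
  · rw [indicator_of_mem h]
    have : 0 ≤ (1 + ‖v‖) ^ (max s 0) * (1 + ‖w‖) ^ (max s 0) := by positivity
    linarith
  · rw [indicator_of_notMem h, add_zero, ← Real.mul_rpow (by positivity) (by positivity)]
    rw [mem_ball_zero_iff, not_lt] at h
    calc ‖v - w‖ ^ s ≤ ‖v - w‖ ^ (max s 0) := Real.rpow_le_rpow_of_exponent_le h (le_max_left _ _)
      _ ≤ _ := Real.rpow_le_rpow (norm_nonneg _) (norm_sub_le_mul v w) (le_max_right _ _)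

theorem finrank_vel : Module.finrank ℝ Vel = 3 := by simp

theorem integrable_indicator_rpow {s : ℝ} (hs : -3 < s) :
    Integrable ((Metric.ball (0 : Vel) 1).indicator (fun z => ‖z‖ ^ s)) := by
  rw [integrable_indicator_iff Metric.isOpen_ball.measurableSet]
  refine integrableOn_ball_of_norm_le_rpow (C := 1) (α := -s) (by rw [finrank_vel]; norm_num)
    (by rw [finrank_vel]; push_cast; linarith) (.of_forall fun z => ?_)
    (measurable_norm.pow_const s).aestronglyMeasurable
  rw [neg_neg, one_mul, Real.norm_of_nonneg (by positivity)]

/-- Convolutions of powers `|z| ^ s`, `s > -3`, with polynomial multiples of Gaussians. -/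
theorem exists_kernel_bound {s c : ℝ} (hs : -3 < s) (hc : 0 < c) (N : ℕ) :
    ∃ C, 0 < C ∧ ∀ v : Vel,
      Integrable (fun w : Vel => ‖v - w‖ ^ s * ((1 + ‖w‖) ^ N * Real.exp (-c * ‖w‖ ^ 2))) ∧
      ∫ w : Vel, ‖v - w‖ ^ s * ((1 + ‖w‖) ^ N * Real.exp (-c * ‖w‖ ^ 2))
        ≤ C * (1 + ‖v‖) ^ (max s 0) := by
  set m := max s 0 with hm
  have hm0 : 0 ≤ m := le_max_right _ _
  set I : Vel → ℝ := (Metric.ball (0 : Vel) 1).indicator (fun z => ‖z‖ ^ s) with hI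
  have hI0 : ∀ z, 0 ≤ I z := fun z => indicator_nonneg (fun z _ => by positivity) z
  set E := Real.exp (N ^ 2 / (2 * c)) with hE
  have hEb : ∀ w : Vel, (1 + ‖w‖) ^ N * Real.exp (-c * ‖w‖ ^ 2) ≤ E := fun w => by
    refine (one_add_pow_mul_exp_le hc N _ (norm_nonneg w)).trans ?_
    have : Real.exp (-(c / 2) * ‖w‖ ^ 2) ≤ 1 := by
      rw [Real.exp_le_one_iff]
      have : 0 ≤ c / 2 * ‖w‖ ^ 2 := by positivity
      linarith
    have h2 := Real.exp_pos (N ^ 2 / (2 * c))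
    nlinarith
  set P : Vel → ℝ := fun w => (1 + ‖w‖) ^ (⌈m⌉₊ + N) * Real.exp (-c * ‖w‖ ^ 2) with hP
  have hPi : Integrable P := integrable_pow_mul_exp hc _
  have hP0 : ∀ w, 0 ≤ P w := fun w => by positivity
  have hIi : Integrable I := integrable_indicator_rpow hs
  have hle : ∀ v w : Vel, ‖v - w‖ ^ s * ((1 + ‖w‖) ^ N * Real.exp (-c * ‖w‖ ^ 2))
      ≤ (1 + ‖v‖) ^ m * P w + E * I (v - w) := fun v w => by
    have h1 := norm_rpow_le s v w
    have h2 : (1 + ‖w‖) ^ m ≤ (1 + ‖w‖) ^ ⌈m⌉₊ := by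
      rw [← Real.rpow_natCast]
      exact Real.rpow_le_rpow_of_exponent_le (by linarith [norm_nonneg w]) (Nat.le_ceil m)
    calc _ ≤ ((1 + ‖v‖) ^ m * (1 + ‖w‖) ^ ⌈m⌉₊ + I (v - w))
          * ((1 + ‖w‖) ^ N * Real.exp (-c * ‖w‖ ^ 2)) := by
          gcongr
          exact h1.trans (by gcongr)
      _ = (1 + ‖v‖) ^ m * P w + ((1 + ‖w‖) ^ N * Real.exp (-c * ‖w‖ ^ 2)) * I (v - w) := by
          rw [hP]; simp only [pow_add]; ring
      _ ≤ _ := by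
          have := mul_le_mul_of_nonneg_right (hEb w) (hI0 (v - w))
          linarith
  have hbi : ∀ v : Vel, Integrable (fun w => (1 + ‖v‖) ^ m * P w + E * I (v - w)) := fun v =>
    (hPi.const_mul _).add ((hIi.comp_sub_left v).const_mul E)
  refine ⟨(∫ w, P w) + E * (∫ z, I z) + 1, ?_, fun v => ⟨?_, ?_⟩⟩
  · have h1 : 0 ≤ ∫ w, P w := integral_nonneg hP0
    have h2 : 0 ≤ ∫ w, I w := integral_nonneg hI0
    positivity
  · refine (hbi v).mono' (by fun_prop) (.of_forall fun w => ?_)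
    rw [Real.norm_of_nonneg (by positivity)]
    exact hle v w
  · have h1 : (1 : ℝ) ≤ (1 + ‖v‖) ^ m := Real.one_le_rpow (by linarith [norm_nonneg v]) hm0
    calc _ ≤ ∫ w, ((1 + ‖v‖) ^ m * P w + E * I (v - w)) :=
          integral_mono_of_nonneg (.of_forall fun w => by positivity) (hbi v) (.of_forall (hle v))
      _ = (1 + ‖v‖) ^ m * (∫ w, P w) + E * ∫ z, I z := by
          rw [integral_add (hPi.const_mul _) ((hIi.comp_sub_left v).const_mul E),
            integral_const_mul, integral_const_mul, integral_sub_left_eq_self I volume v]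
      _ ≤ _ := by
          have h2 : 0 ≤ ∫ w, I w := integral_nonneg hI0
          have h3 : 0 ≤ E * ∫ w, I w := by positivity
          nlinarith

/-! ### The Maxwellian -/

theorem maxwellian_pos (v : Vel) : 0 < maxwellian v := by unfold maxwellian; positivity

theorem sqrtMaxwellian_pos (v : Vel) : 0 < sqrtMaxwellian v := Real.sqrt_pos.2 (maxwellian_pos v)

theorem sqrtMaxwellian_mul_self (v : Vel) : sqrtMaxwellian v * sqrtMaxwellian v = maxwellian v :=
  Real.mul_self_sqrt (maxwellian_pos v).le

theorem maxwellian_eq (v : Vel) :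
    maxwellian v = (2 * Real.pi) ^ (-(3 / 2) : ℝ) * Real.exp (-(1 / 2) * ‖v‖ ^ 2) := by
  unfold maxwellian; congr 2; ring

theorem sqrtMaxwellian_eq (v : Vel) : sqrtMaxwellian v =
    Real.sqrt ((2 * Real.pi) ^ (-(3 / 2) : ℝ)) * Real.exp (-(1 / 4) * ‖v‖ ^ 2) := by
  rw [sqrtMaxwellian, maxwellian_eq, Real.sqrt_mul (by positivity)]
  congr 1
  rw [show -(1 / 2) * ‖v‖ ^ 2 = (-(1 / 4) * ‖v‖ ^ 2) + (-(1 / 4) * ‖v‖ ^ 2) by ring, Real.exp_add,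
    Real.sqrt_mul_self (Real.exp_pos _).le]

theorem contDiff_maxwellian : ContDiff ℝ ∞ maxwellian := by
  have : maxwellian = fun v : Vel =>
    (2 * Real.pi) ^ (-(3 / 2) : ℝ) * Real.exp (-(1 / 2) * ‖v‖ ^ 2) := funext maxwellian_eq
  rw [this]
  exact contDiff_const.mul (contDiff_const.mul (contDiff_norm_sq ℝ)).exp

theorem contDiff_sqrtMaxwellian : ContDiff ℝ ∞ sqrtMaxwellian := by
  have : sqrtMaxwellian = _ := funext sqrtMaxwellian_eq
  rw [this]
  exact contDiff_const.mul (contDiff_const.mul (contDiff_norm_sq ℝ)).exp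

@[fun_prop]
theorem continuous_maxwellian : Continuous maxwellian := contDiff_maxwellian.continuous

@[fun_prop]
theorem continuous_sqrtMaxwellian : Continuous sqrtMaxwellian := contDiff_sqrtMaxwellian.continuous

@[fun_prop]
theorem measurable_maxwellian : Measurable maxwellian := continuous_maxwellian.measurable

@[fun_prop]
theorem measurable_sqrtMaxwellian : Measurable sqrtMaxwellian := continuous_sqrtMaxwellian.measurable

theorem fderiv_exp_sq (a c : ℝ) (v e : Vel) :
    fderiv ℝ (fun v : Vel => a * Real.exp (c * ‖v‖ ^ 2)) v e
      = 2 * c * ⟪v, e⟫ * (a * Real.exp (c * ‖v‖ ^ 2)) := by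
  have h1 : HasFDerivAt (fun v : Vel => a * Real.exp (c * ‖v‖ ^ 2)) _ v :=
    (((hasStrictFDerivAt_norm_sq v).hasFDerivAt.const_mul c).exp).const_mul a
  rw [h1.fderiv]
  simp
  ring

theorem fderiv_maxwellian (v e : Vel) : fderiv ℝ maxwellian v e = -⟪v, e⟫ * maxwellian v := by
  have : maxwellian = _ := funext maxwellian_eq
  rw [this, fderiv_exp_sq]
  ring

theorem fderiv_sqrtMaxwellian (v e : Vel) :
    fderiv ℝ sqrtMaxwellian v e = -(1 / 2) * ⟪v, e⟫ * sqrtMaxwellian v := by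
  have : sqrtMaxwellian = _ := funext sqrtMaxwellian_eq
  rw [this, fderiv_exp_sq]
  ring

theorem integrable_mul_maxwellian {h : Vel → ℝ} (hm : AEStronglyMeasurable h) {C : ℝ} {N : ℕ}
    (hb : ∀ w, |h w| ≤ C * (1 + ‖w‖) ^ N) : Integrable (fun w => h w * maxwellian w) := by
  refine ((integrable_pow_mul_exp (c := 1 / 2) (by norm_num) N).const_mul
    (C * (2 * Real.pi) ^ (-(3 / 2) : ℝ))).mono'
    (hm.mul continuous_maxwellian.aestronglyMeasurable) (.of_forall fun w => ?_)
  rw [norm_mul, Real.norm_eq_abs, Real.norm_of_nonneg (maxwellian_pos w).le, maxwellian_eq]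
  have := mul_le_mul_of_nonneg_right (hb w) (maxwellian_pos w).le
  rw [maxwellian_eq] at this
  linarith

theorem integrable_maxwellian : Integrable maxwellian := by
  simpa using integrable_mul_maxwellian (h := fun _ => 1) (C := 1) (N := 0) (by fun_prop) (by simp)

theorem integral_maxwellian : ∫ w, maxwellian w = 1 := by
  have : maxwellian = _ := funext maxwellian_eq
  rw [this, integral_const_mul, GaussianFourier.integral_rexp_neg_mul_sq_norm (by norm_num),
    finrank_vel, show Real.pi / (1 / 2) = 2 * Real.pi by ring, ← Real.rpow_add (by positivity)]
  norm_num

theorem abs_inner_le_pow (v w : Vel) : |⟪v, w⟫| ≤ ‖v‖ * (1 + ‖w‖) ^ 1 := by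
  refine (abs_real_inner_le_norm v w).trans ?_
  rw [pow_one]
  nlinarith [norm_nonneg v, norm_nonneg w]

theorem integral_inner_mul_maxwellian (v : Vel) : ∫ w, ⟪v, w⟫ * maxwellian w = 0 := by
  have h : ∫ w, ⟪v, -w⟫ * maxwellian (-w) = ∫ w, ⟪v, w⟫ * maxwellian w :=
    integral_neg_eq_self (fun w => ⟪v, w⟫ * maxwellian w) volume
  have h2 : ∀ w, ⟪v, -w⟫ * maxwellian (-w) = -(⟪v, w⟫ * maxwellian w) := fun w => by
    simp [maxwellian]
  simp only [h2, integral_neg] at h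
  linarith

theorem integrable_inner_mul_maxwellian (v : Vel) :
    Integrable fun w => ⟪v, w⟫ * maxwellian w :=
  integrable_mul_maxwellian (by fun_prop) (abs_inner_le_pow v)

theorem integrable_inner_sq_mul_maxwellian (v : Vel) :
    Integrable fun w => ⟪v, w⟫ ^ 2 * maxwellian w := by
  refine integrable_mul_maxwellian (C := ‖v‖ ^ 2) (N := 2) (by fun_prop) fun w => ?_
  rw [abs_pow, ← mul_pow]
  have := abs_inner_le_pow v w
  rw [pow_one] at this
  gcongr

/-- Since ∇μ = -wμ, an integration by parts in the direction v reduces the second moment to the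
total mass. -/
theorem integral_inner_sq_mul_maxwellian (v : Vel) :
    ∫ w, ⟪v, w⟫ ^ 2 * maxwellian w = ‖v‖ ^ 2 := by
  have hf : ∀ w, fderiv ℝ (fun w : Vel => ⟪v, w⟫) w v = ‖v‖ ^ 2 := fun w => by
    have : HasFDerivAt (fun w : Vel => ⟪v, w⟫) (innerSL ℝ v) w := (innerSL ℝ v).hasFDerivAt
    rw [this.fderiv]
    simp
  have e1 : ∀ w : Vel, ⟪v, w⟫ * fderiv ℝ maxwellian w v = -(⟪v, w⟫ ^ 2 * maxwellian w) := fun w => by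
    rw [fderiv_maxwellian, real_inner_comm]; ring
  have key := integral_mul_fderiv_eq_neg_fderiv_mul_of_integrable (μ := volume)
    (f := fun w : Vel => ⟪v, w⟫) (g := maxwellian) (v := v) ?_ ?_
    (integrable_inner_mul_maxwellian v) ?_ ?_
  · simp only [hf, e1, integral_neg, integral_const_mul, integral_maxwellian] at key
    linarith
  · simp only [hf]; exact integrable_maxwellian.const_mul _
  · simp only [e1]; exact (integrable_inner_sq_mul_maxwellian v).neg
  · intro x _; exact (innerSL ℝ v).differentiableAt
  · intro x _; exact contDiff_maxwellian.differentiable (by simp) x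

theorem norm_sq_eq_sum_inner (w : Vel) : ‖w‖ ^ 2 = ∑ j, ⟪basisVec j, w⟫ ^ 2 := by
  rw [EuclideanSpace.norm_sq_eq]
  simp [basisVec, EuclideanSpace.inner_single_left]

theorem norm_basisVec (j : Fin 3) : ‖basisVec j‖ = 1 := by simp [basisVec]

theorem inner_basisVec (j : Fin 3) (w : Vel) : ⟪basisVec j, w⟫ = w j := by
  simp [basisVec, EuclideanSpace.inner_single_left]

theorem integral_norm_sq_mul_maxwellian : ∫ w, ‖w‖ ^ 2 * maxwellian w = 3 := by
  simp only [norm_sq_eq_sum_inner, Finset.sum_mul]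
  rw [integral_finsetSum _ fun j _ => integrable_inner_sq_mul_maxwellian _]
  simp [integral_inner_sq_mul_maxwellian, norm_basisVec]

theorem integrable_norm_pow_mul_maxwellian (N : ℕ) :
    Integrable fun w : Vel => ‖w‖ ^ N * maxwellian w := by
  refine integrable_mul_maxwellian (C := 1) (N := N) (by fun_prop) fun w => ?_
  rw [abs_of_nonneg (by positivity), one_mul]
  gcongr
  linarith

/-! ### The collision form -/

/-- The bilinear form of the matrix `a(z)`. -/
def collisionForm (γ : ℝ) (z ξ η : Vel) : ℝ :=
  ‖z‖ ^ γ * (‖z‖ ^ 2 * ⟪ξ, η⟫ - ⟪z, ξ⟫ * ⟪z, η⟫)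

/-- The square root of the matrix `a(z)`. -/
def collisionRoot (γ : ℝ) (z ξ : Vel) : Vel :=
  ‖z‖ ^ (γ / 2) • (‖z‖ • ξ - (⟪z, ξ⟫ / ‖z‖) • z)

/-- a(z) is |z|^{γ+2} times the orthogonal projection onto the complement of z. A projection is its
own square, so halving the exponent gives a square root. -/
theorem inner_collisionRoot (γ : ℝ) (z ξ η : Vel) :
    ⟪collisionRoot γ z ξ, collisionRoot γ z η⟫ = collisionForm γ z ξ η := by
  have h1 : ‖z‖ ^ (γ / 2) * ‖z‖ ^ (γ / 2) = ‖z‖ ^ γ := by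
    rw [← sq, ← Real.rpow_mul_natCast (norm_nonneg z)]; congr 1; push_cast; ring
  rw [collisionForm, ← h1]
  -- At z = 0 both sides vanish, whatever value the power 0^γ takes.
  rcases eq_or_ne z 0 with rfl | hz
  · simp [collisionRoot]
  · have hz' : ‖z‖ ≠ 0 := norm_ne_zero_iff.2 hz
    simp only [collisionRoot, real_inner_smul_left, real_inner_smul_right, inner_sub_left,
      inner_sub_right, real_inner_self_eq_norm_sq]
    rw [real_inner_comm z ξ]
    field_simp
    ring

theorem collisionRoot_neg (γ : ℝ) (z ξ : Vel) : collisionRoot γ (-z) ξ = collisionRoot γ z ξ := by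
  simp [collisionRoot, neg_div]

theorem collisionRoot_add (γ : ℝ) (z ξ η : Vel) :
    collisionRoot γ z (ξ + η) = collisionRoot γ z ξ + collisionRoot γ z η := by
  simp only [collisionRoot, inner_add_right]; module

theorem collisionRoot_smul (γ : ℝ) (z ξ : Vel) (c : ℝ) :
    collisionRoot γ z (c • ξ) = c • collisionRoot γ z ξ := by
  simp only [collisionRoot, real_inner_smul_right, mul_div_assoc]; module

theorem collisionRoot_sub (γ : ℝ) (z ξ η : Vel) :
    collisionRoot γ z (ξ - η) = collisionRoot γ z ξ - collisionRoot γ z η := by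
  simp only [collisionRoot, inner_sub_right]; module

theorem continuous_collisionRoot (γ : ℝ) (z : Vel) : Continuous (collisionRoot γ z) := by
  unfold collisionRoot; fun_prop

theorem measurable_collisionForm (γ : ℝ) :
    Measurable (fun x : Vel × Vel × Vel => collisionForm γ x.1 x.2.1 x.2.2) := by
  unfold collisionForm; fun_prop

theorem collisionForm_self_nonneg (γ : ℝ) (z ξ : Vel) : 0 ≤ collisionForm γ z ξ ξ := by
  rw [← inner_collisionRoot]; exact real_inner_self_nonneg

theorem collisionForm_comm (γ : ℝ) (z ξ η : Vel) :
    collisionForm γ z ξ η = collisionForm γ z η ξ := by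
  rw [← inner_collisionRoot, real_inner_comm, inner_collisionRoot]

theorem collisionForm_self_left (γ : ℝ) (z η : Vel) : collisionForm γ z z η = 0 := by
  rw [collisionForm, real_inner_self_eq_norm_sq]; ring

/-- `a(v - w) w = a(v - w) v`. -/
theorem collisionForm_sub_left (γ : ℝ) (v w η : Vel) :
    collisionForm γ (v - w) w η = collisionForm γ (v - w) v η := by
  have := collisionForm_self_left γ (v - w) η
  simp only [collisionForm, inner_sub_left (x := v) (y := w) (z := η)] at this ⊢
  rw [inner_sub_right] at this
  linarith

theorem collisionForm_eq_sum (γ : ℝ) (z ξ η : Vel) :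
    collisionForm γ z ξ η = ∑ j, ∑ k, collisionMatrix γ j k z * ξ j * η k := by
  have h : ∀ x y : Vel, ⟪x, y⟫ = x 0 * y 0 + x 1 * y 1 + x 2 * y 2 := fun x y => by
    simp only [PiLp.inner_apply, RCLike.inner_apply, Fin.sum_univ_three, conj_trivial]
    ring
  simp only [collisionForm, collisionMatrix, h, Fin.sum_univ_three]
  simp
  ring

/-- Equality holds away from the origin. At z = 0 with γ = -2 the right side is 0⁰ = 1 and the left
side is 0. -/
theorem norm_rpow_mul_sq_le (γ : ℝ) (z : Vel) : ‖z‖ ^ γ * ‖z‖ ^ 2 ≤ ‖z‖ ^ (γ + 2) := by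
  rcases eq_or_ne z 0 with rfl | hz
  · simp; positivity
  · have : 0 < ‖z‖ := norm_pos_iff.2 hz
    rw [← Real.rpow_natCast, ← Real.rpow_add this]; norm_num

theorem norm_collisionRoot_sq_le (γ : ℝ) (z ξ : Vel) :
    ‖collisionRoot γ z ξ‖ ^ 2 ≤ ‖z‖ ^ (γ + 2) * ‖ξ‖ ^ 2 := by
  rw [← real_inner_self_eq_norm_sq, inner_collisionRoot, collisionForm, real_inner_self_eq_norm_sq]
  calc _ ≤ ‖z‖ ^ γ * (‖z‖ ^ 2 * ‖ξ‖ ^ 2) := by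
        gcongr; nlinarith [mul_self_nonneg ⟪z, ξ⟫]
    _ = ‖z‖ ^ γ * ‖z‖ ^ 2 * ‖ξ‖ ^ 2 := by ring
    _ ≤ _ := by gcongr; exact norm_rpow_mul_sq_le γ z

theorem abs_collisionForm_le (γ : ℝ) (z ξ η : Vel) :
    |collisionForm γ z ξ η| ≤ ‖z‖ ^ (γ + 2) * (‖ξ‖ * ‖η‖) := by
  rw [← inner_collisionRoot]
  refine (abs_real_inner_le_norm _ _).trans ?_
  refine abs_le_of_sq_le_sq' ?_ (by positivity) |>.2
  calc _ = ‖collisionRoot γ z ξ‖ ^ 2 * ‖collisionRoot γ z η‖ ^ 2 := by ring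
    _ ≤ (‖z‖ ^ (γ + 2) * ‖ξ‖ ^ 2) * (‖z‖ ^ (γ + 2) * ‖η‖ ^ 2) := by
      gcongr <;> exact norm_collisionRoot_sq_le ..
    _ = _ := by ring

theorem integrable_kernel_mul {s c C : ℝ} (hs : -3 < s) (hc : 0 < c) {N : ℕ} {h : Vel → ℝ}
    (hm : AEStronglyMeasurable h) (hb : ∀ w, |h w| ≤ C * ((1 + ‖w‖) ^ N * Real.exp (-c * ‖w‖ ^ 2)))
    (v : Vel) : Integrable fun w => ‖v - w‖ ^ s * h w := by
  obtain ⟨D, -, hD⟩ := exists_kernel_bound hs hc N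
  refine ((hD v).1.const_mul C).mono' (AEStronglyMeasurable.mul (by
    exact (by fun_prop : Measurable fun w : Vel => ‖v - w‖ ^ s).aestronglyMeasurable) hm)
    (.of_forall fun w => ?_)
  rw [norm_mul, Real.norm_of_nonneg (by positivity), Real.norm_eq_abs]
  calc _ ≤ ‖v - w‖ ^ s * (C * ((1 + ‖w‖) ^ N * Real.exp (-c * ‖w‖ ^ 2))) := by
        gcongr; exact hb w
    _ = _ := by ring

theorem integrable_kernel_mul_maxwellian {s : ℝ} (hs : -3 < s) {N : ℕ} {C : ℝ} {h : Vel → ℝ}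
    (hm : AEStronglyMeasurable h) (hb : ∀ w, |h w| ≤ C * (1 + ‖w‖) ^ N) (v : Vel) :
    Integrable fun w => ‖v - w‖ ^ s * (h w * maxwellian w) := by
  refine integrable_kernel_mul (C := C * (2 * Real.pi) ^ (-(3 / 2) : ℝ)) (c := 1 / 2) hs
    (h := fun w => h w * maxwellian w)
    (by norm_num) (N := N) (AEStronglyMeasurable.mul hm (by fun_prop)) (fun w => ?_) v
  rw [abs_mul, abs_of_pos (maxwellian_pos w), maxwellian_eq]
  calc _ ≤ C * (1 + ‖w‖) ^ N * ((2 * Real.pi) ^ (-(3 / 2) : ℝ) * Real.exp (-(1 / 2) * ‖w‖ ^ 2)) := by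
        gcongr; exact hb w
    _ = _ := by ring

theorem integrable_collisionForm_mul {γ : ℝ} (hγ : -3 < γ) {N : ℕ} {C : ℝ} {h : Vel → ℝ}
    (hm : AEStronglyMeasurable h) (hb : ∀ w, |h w| ≤ C * (1 + ‖w‖) ^ N) (v ξ η : Vel) :
    Integrable fun w => collisionForm γ (v - w) ξ η * (h w * maxwellian w) := by
  have h1 := (integrable_kernel_mul_maxwellian (s := γ + 2) (by linarith) hm hb v).norm.const_mul
    (‖ξ‖ * ‖η‖)
  refine h1.mono' (AEStronglyMeasurable.mul ?_ (AEStronglyMeasurable.mul hm (by fun_prop)))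
    (.of_forall fun w => ?_)
  · exact ((measurable_collisionForm γ).comp (by fun_prop :
      Measurable fun w : Vel => (v - w, ξ, η))).aestronglyMeasurable
  · rw [norm_mul, norm_mul (‖v - w‖ ^ (γ + 2)), Real.norm_of_nonneg (r := ‖v - w‖ ^ (γ + 2)) (by positivity)]
    calc _ ≤ (‖v - w‖ ^ (γ + 2) * (‖ξ‖ * ‖η‖)) * ‖h w * maxwellian w‖ := by
          gcongr; exact abs_collisionForm_le ..
      _ = _ := by ring

theorem integrable_collisionForm {γ : ℝ} (hγ : -3 < γ) (v ξ η : Vel) :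
    Integrable fun w => collisionForm γ (v - w) ξ η * maxwellian w := by
  simpa using integrable_collisionForm_mul (C := 1) (N := 0) (h := fun _ => 1) hγ (by fun_prop)
    (by simp) v ξ η

/-! ### The averaged form -/

/-- The bilinear form of the averaged matrix `ā(v)`. -/
def meanForm (γ : ℝ) (v ξ η : Vel) : ℝ := ∫ w, collisionForm γ (v - w) ξ η * maxwellian w

theorem collisionMatrix_eq_form (γ : ℝ) (j k : Fin 3) (z : Vel) :
    collisionMatrix γ j k z = collisionForm γ z (basisVec j) (basisVec k) := by
  rw [collisionForm_eq_sum, Finset.sum_eq_single j, Finset.sum_eq_single k]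
  · simp [basisVec]
  · intro b _ hb; simp [basisVec, hb]
  · simp
  · intro b _ hb; simp [basisVec, hb]
  · simp

theorem meanForm_eq_sum {γ : ℝ} (hγ : -3 < γ) (v ξ η : Vel) :
    meanForm γ v ξ η = ∑ j, ∑ k, meanMatrix γ j k v * ξ j * η k := by
  have hi : ∀ j k, Integrable fun w => collisionMatrix γ j k (v - w) * maxwellian w := fun j k => by
    simp only [collisionMatrix_eq_form]; exact integrable_collisionForm hγ _ _ _
  have : ∀ w, collisionForm γ (v - w) ξ η * maxwellian w
      = ∑ j, ∑ k, collisionMatrix γ j k (v - w) * maxwellian w * (ξ j * η k) := fun w => by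
    rw [collisionForm_eq_sum, Finset.sum_mul]
    refine Finset.sum_congr rfl fun j _ => ?_
    rw [Finset.sum_mul]
    exact Finset.sum_congr rfl fun k _ => by ring
  simp only [meanForm, this]
  rw [integral_finsetSum _ fun j _ => integrable_finsetSum _ fun k _ => (hi j k).mul_const _]
  refine Finset.sum_congr rfl fun j _ => ?_
  rw [integral_finsetSum _ fun k _ => (hi j k).mul_const _]
  refine Finset.sum_congr rfl fun k _ => ?_
  rw [integral_mul_const, meanMatrix]; ring

theorem meanForm_self_nonneg (γ : ℝ) (v ξ : Vel) : 0 ≤ meanForm γ v ξ ξ :=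
  integral_nonneg fun w => mul_nonneg (collisionForm_self_nonneg _ _ _) (maxwellian_pos w).le

theorem energyDensity_eq {γ : ℝ} (hγ : -3 < γ) (f : Vel → ℝ) (v : Vel) :
    energyDensity γ f v = meanForm γ v (weakGrad f v) (weakGrad f v)
      + 1 / 4 * meanForm γ v v v * f v ^ 2 := by
  rw [meanForm_eq_sum hγ, meanForm_eq_sum hγ, energyDensity]
  simp only [Fin.sum_univ_three]
  ring

theorem exists_meanForm_le {γ : ℝ} (hγ : -3 < γ) (hγ₀ : γ < 0) :
    ∃ C, 0 < C ∧ ∀ v ξ, meanForm γ v ξ ξ ≤ C * (1 + ‖v‖) ^ 2 * ‖ξ‖ ^ 2 := by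
  obtain ⟨C, hC, h⟩ := exists_kernel_bound (s := γ + 2) (c := 1 / 2) (by linarith) (by norm_num) 0
  refine ⟨C * (2 * Real.pi) ^ (-(3 / 2) : ℝ), by positivity, fun v ξ => ?_⟩
  have hv := (h v).1.const_mul ((2 * Real.pi) ^ (-(3 / 2) : ℝ) * ‖ξ‖ ^ 2)
  calc meanForm γ v ξ ξ ≤ ∫ w, ((2 * Real.pi) ^ (-(3 / 2) : ℝ) * ‖ξ‖ ^ 2) * (‖v - w‖ ^ (γ + 2)
        * ((1 + ‖w‖) ^ 0 * Real.exp (-(1 / 2) * ‖w‖ ^ 2))) := by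
        refine integral_mono (integrable_collisionForm hγ v ξ ξ) hv fun w => ?_
        have h1 := (le_abs_self _).trans (abs_collisionForm_le γ (v - w) ξ ξ)
        have h2 := mul_le_mul_of_nonneg_right h1 (maxwellian_pos w).le
        simp only
        rw [maxwellian_eq] at h2
        rw [maxwellian_eq]
        refine h2.trans (le_of_eq (by ring))
    _ ≤ ((2 * Real.pi) ^ (-(3 / 2) : ℝ) * ‖ξ‖ ^ 2) * (C * (1 + ‖v‖) ^ (max (γ + 2) 0)) := by
        rw [integral_const_mul]
        gcongr
        exact (h v).2
    _ ≤ ((2 * Real.pi) ^ (-(3 / 2) : ℝ) * ‖ξ‖ ^ 2) * (C * (1 + ‖v‖) ^ (2 : ℝ)) := by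
        gcongr
        · linarith [norm_nonneg v]
        · exact max_le (by linarith) (by norm_num)
    _ = _ := by rw [Real.rpow_two]; ring

/-- The reflection exchanging two vectors of equal length preserves both Lebesgue measure and the
radial weight. -/
theorem integral_radial_inner_sq_eq (ρ : ℝ → ℝ) {ξ η : Vel} (h : ‖ξ‖ = ‖η‖) :
    ∫ w : Vel, ρ ‖w‖ * (‖w‖ ^ 2 * ‖ξ‖ ^ 2 - ⟪w, ξ⟫ ^ 2)
      = ∫ w : Vel, ρ ‖w‖ * (‖w‖ ^ 2 * ‖η‖ ^ 2 - ⟪w, η⟫ ^ 2) := by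
  set L := Submodule.reflection (ℝ ∙ (ξ - η))ᗮ with hL
  have hLξ : L ξ = η := Submodule.reflection_sub h
  rw [← L.measurePreserving.integral_comp L.toHomeomorph.measurableEmbedding
    (fun w => ρ ‖w‖ * (‖w‖ ^ 2 * ‖η‖ ^ 2 - ⟪w, η⟫ ^ 2))]
  refine integral_congr_ae (.of_forall fun w => ?_)
  simp only [L.norm_map, ← hLξ, L.inner_map_map]

theorem one_add_norm_rpow_le_one {γ : ℝ} (hγ₀ : γ < 0) (v : Vel) : (1 + ‖v‖) ^ γ ≤ 1 :=
  Real.rpow_le_one_of_one_le_of_nonpos (by linarith [norm_nonneg v]) hγ₀.le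

theorem sq_inner_le (w ξ : Vel) : ⟪w, ξ⟫ ^ 2 ≤ ‖w‖ ^ 2 * ‖ξ‖ ^ 2 := by
  have h := abs_real_inner_le_norm w ξ
  rw [← sq_abs, ← mul_pow]
  gcongr

/-- Since γ < 0, |v - w|^γ ≥ (1+|v|)^γ (1+|w|)^γ, which replaces the singular kernel by a weight
even in w. Symmetrizing in w removes the shift by v, and the remaining integral is isotropic, hence
a positive multiple of |ξ|². -/
theorem exists_le_meanForm {γ : ℝ} (hγ : -3 < γ) (hγ₀ : γ < 0) :
    ∃ c, 0 < c ∧ ∀ v ξ, c * (1 + ‖v‖) ^ γ * ‖ξ‖ ^ 2 ≤ meanForm γ v ξ ξ := by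
  set q : Vel → Vel → ℝ := fun z ξ => ‖z‖ ^ 2 * ‖ξ‖ ^ 2 - ⟪z, ξ⟫ ^ 2 with hq
  have hq0 : ∀ z ξ, 0 ≤ q z ξ := fun z ξ => sub_nonneg.2 (sq_inner_le z ξ)
  have hqc : ∀ ξ, Continuous fun z => q z ξ := fun ξ => by simp only [hq]; fun_prop
  set m : Vel → ℝ := fun w => (1 + ‖w‖) ^ γ * maxwellian w with hm
  have hm0 : ∀ w, 0 < m w := fun w => mul_pos (by positivity) (maxwellian_pos w)
  have hmc : Continuous m := by
    refine Continuous.mul ?_ continuous_maxwellian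
    exact (by fun_prop : Continuous fun w : Vel => 1 + ‖w‖).rpow_const
      fun w => Or.inl (by positivity)
  have hint : ∀ v ξ, Integrable fun w => m w * q (v - w) ξ := fun v ξ => by
    have : Integrable fun w => ((1 + ‖w‖) ^ γ * q (v - w) ξ) * maxwellian w := by
      refine integrable_mul_maxwellian (C := (1 + ‖v‖) ^ 2 * ‖ξ‖ ^ 2) (N := 2) ?_ fun w => ?_
      · exact AEStronglyMeasurable.mul
          (by fun_prop : Measurable fun w : Vel => (1 + ‖w‖) ^ γ).aestronglyMeasurable
          ((hqc ξ).comp (continuous_const.sub continuous_id)).aestronglyMeasurable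
      · rw [abs_of_nonneg (mul_nonneg (by positivity) (hq0 _ _))]
        have h1 := one_add_norm_rpow_le_one hγ₀ w
        have h2 : q (v - w) ξ ≤ ((1 + ‖v‖) * (1 + ‖w‖)) ^ 2 * ‖ξ‖ ^ 2 := by
          have := norm_sub_le_mul v w
          have h3 : ‖v - w‖ ^ 2 * ‖ξ‖ ^ 2 ≤ ((1 + ‖v‖) * (1 + ‖w‖)) ^ 2 * ‖ξ‖ ^ 2 := by gcongr
          have h4 := sq_nonneg ⟪v - w, ξ⟫
          simp only [hq]; linarith
        calc _ ≤ 1 * (((1 + ‖v‖) * (1 + ‖w‖)) ^ 2 * ‖ξ‖ ^ 2) := by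
              gcongr
              exact hq0 _ _
          _ = _ := by ring
    refine this.congr (.of_forall fun w => ?_)
    simp only [hm]; ring
  set e := basisVec 0
  have hint0 : ∀ ξ, Integrable fun w => m w * q w ξ := fun ξ => by
    refine (hint 0 ξ).congr (.of_forall fun w => ?_)
    simp [hq]
  set c := ∫ w, m w * q w e with hc
  have hcpos : 0 < c := by
    rw [hc, integral_pos_iff_support_of_nonneg
      (fun w => mul_nonneg (hm0 w).le (hq0 _ _)) (hint0 e)]
    -- The integrand is positive at a unit vector orthogonal to e, so its support is a nonempty open
    -- set.
    refine IsOpen.measure_pos _ ((hmc.mul (hqc e)).isOpen_support) ⟨basisVec 1, ?_⟩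
    have : q (basisVec 1) e = 1 := by
      simp only [hq, norm_basisVec, e, inner_basisVec]; simp [basisVec]
    rw [Function.mem_support, this]
    exact (mul_pos (hm0 _) one_pos).ne'
  have hc' : ∀ ξ, ∫ w, m w * q w ξ = c * ‖ξ‖ ^ 2 := fun ξ => by
    have h1 : ‖ξ‖ = ‖‖ξ‖ • e‖ := by simp [norm_smul, e, norm_basisVec]
    have h2 := integral_radial_inner_sq_eq
      (fun r => (1 + r) ^ γ * ((2 * Real.pi) ^ (-(3 / 2) : ℝ) * Real.exp (-(1 / 2) * r ^ 2))) h1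
    simp only [hm, hq, maxwellian_eq, hc]
    rw [h2, ← integral_mul_const]
    refine integral_congr_ae (.of_forall fun w => ?_)
    simp only [norm_smul, real_inner_smul_right, Real.norm_of_nonneg (norm_nonneg ξ)]
    ring
  refine ⟨c, hcpos, fun v ξ => ?_⟩
  have h1 : (1 + ‖v‖) ^ γ * ∫ w, m w * q (v - w) ξ ≤ meanForm γ v ξ ξ := by
    rw [← integral_const_mul]
    refine integral_mono ((hint v ξ).const_mul _) (integrable_collisionForm hγ v ξ ξ) fun w => ?_
    have e1 : collisionForm γ (v - w) ξ ξ = ‖v - w‖ ^ γ * q (v - w) ξ := by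
      simp only [collisionForm, hq, real_inner_self_eq_norm_sq]; ring
    simp only [e1]
    rcases eq_or_ne (v - w) 0 with h0 | h0
    · simp [h0, hq]
    · have h3 : ((1 + ‖v‖) * (1 + ‖w‖)) ^ γ ≤ ‖v - w‖ ^ γ :=
        Real.rpow_le_rpow_of_nonpos (norm_pos_iff.2 h0) (norm_sub_le_mul v w) hγ₀.le
      rw [Real.mul_rpow (by positivity) (by positivity)] at h3
      calc _ = ((1 + ‖v‖) ^ γ * (1 + ‖w‖) ^ γ) * q (v - w) ξ * maxwellian w := by
            simp only [hm]; ring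
        _ ≤ _ := by
            have := hq0 (v - w) ξ
            have := (maxwellian_pos w).le
            gcongr
  have h2 : ∫ w, m w * q (v - w) ξ = ∫ w, m w * q (v + w) ξ := by
    rw [← integral_neg_eq_self]
    refine integral_congr_ae (.of_forall fun w => ?_)
    simp [hm, maxwellian]
  have hint' : Integrable fun w => m w * q (v + w) ξ := by
    refine ((hint v ξ).comp_neg).congr (.of_forall fun w => ?_)
    simp [hm, maxwellian]
  have h3 : 2 * ∫ w, m w * q w ξ ≤ 2 * ∫ w, m w * q (v - w) ξ := by
    have : 2 * ∫ w, m w * q (v - w) ξ = ∫ w, (m w * q (v - w) ξ + m w * q (v + w) ξ) := by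
      rw [integral_add (hint v ξ) hint', ← h2]; ring
    rw [this, ← integral_const_mul]
    refine integral_mono ((hint0 ξ).const_mul 2) ((hint v ξ).add hint') fun w => ?_
    -- Parallelogram law for the quadratic form q(·, ξ); the term 2 q(v, ξ) is nonnegative and is
    -- dropped.
    have h4 : q (v - w) ξ + q (v + w) ξ = 2 * q v ξ + 2 * q w ξ := by
      simp only [hq, norm_sub_sq_real, norm_add_sq_real, inner_sub_left, inner_add_left]; ring
    have h5 := hq0 v ξ
    have h6 := hm0 w
    simp only
    rw [← mul_add, h4]
    nlinarith
  rw [hc'] at h3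
  have h4 : 0 ≤ (1 + ‖v‖) ^ γ := by positivity
  calc _ = (1 + ‖v‖) ^ γ * (c * ‖ξ‖ ^ 2) := by ring
    _ ≤ (1 + ‖v‖) ^ γ * ∫ w, m w * q (v - w) ξ := by gcongr; linarith
    _ ≤ _ := h1

/-! ### Comparison of the trace of ā(v) with ā(v)v·v. -/

/-- Half of the trace of the averaged matrix `ā(v)`. -/
def meanHalfTrace (γ : ℝ) (v : Vel) : ℝ := ∫ w, ‖v - w‖ ^ γ * ‖v - w‖ ^ 2 * maxwellian w

theorem integrable_halfTrace {γ : ℝ} (hγ : -3 < γ) (v : Vel) :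
    Integrable fun w => ‖v - w‖ ^ γ * ‖v - w‖ ^ 2 * maxwellian w := by
  have h := integrable_kernel_mul_maxwellian (s := γ + 2) (h := fun _ => 1) (C := 1) (N := 0)
    (by linarith) (by fun_prop) (by simp) v
  refine h.mono' (by
    exact (by fun_prop : Measurable fun w : Vel =>
      ‖v - w‖ ^ γ * ‖v - w‖ ^ 2 * maxwellian w).aestronglyMeasurable) (.of_forall fun w => ?_)
  have := (maxwellian_pos w).le
  rw [Real.norm_of_nonneg (by positivity), one_mul]
  gcongr
  exact norm_rpow_mul_sq_le γ _

theorem collisionForm_sub_self (γ : ℝ) (v w : Vel) :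
    collisionForm γ (v - w) v v = ‖v - w‖ ^ γ * (‖w‖ ^ 2 * ‖v‖ ^ 2 - ⟪v, w⟫ ^ 2) := by
  simp only [collisionForm, norm_sub_sq_real, inner_sub_left, real_inner_self_eq_norm_sq,
    real_inner_comm v w]
  ring

/-- A convex power lies above its tangent at A; this reduces to log y ≤ y - 1 and 1 + x ≤ e^x. -/
theorem rpow_ge_tangent {x A κ : ℝ} (hx : 0 < x) (hA : 0 < A) (hκ : 0 ≤ κ) :
    A ^ (-κ) * (1 - κ * (x / A - 1)) ≤ x ^ (-κ) := by
  have h1 : x ^ (-κ) = A ^ (-κ) * (x / A) ^ (-κ) := by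
    rw [← Real.mul_rpow hA.le (by positivity), mul_div_cancel₀ _ hA.ne']
  have h2 : 1 - κ * (x / A - 1) ≤ (x / A) ^ (-κ) := by
    have hpos : 0 < x / A := by positivity
    rw [Real.rpow_def_of_pos hpos]
    have h3 := Real.add_one_le_exp (Real.log (x / A) * (-κ))
    have h4 := Real.log_le_sub_one_of_pos hpos
    nlinarith
  rw [h1]
  gcongr

/-- A concave power lies below its tangent at A, by Bernoulli's inequality. -/
theorem rpow_le_tangent {x A θ : ℝ} (hx : 0 ≤ x) (hA : 0 < A) (hθ : 0 ≤ θ) (hθ' : θ ≤ 1) :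
    x ^ θ ≤ A ^ θ * (1 + θ * (x / A - 1)) := by
  have h1 : x ^ θ = A ^ θ * (x / A) ^ θ := by
    rw [← Real.mul_rpow hA.le (by positivity), mul_div_cancel₀ _ hA.ne']
  have h0 : 0 ≤ x / A := by positivity
  have h2 := rpow_one_add_le_one_add_mul_self (s := x / A - 1) (by linarith) hθ hθ'
  rw [add_sub_cancel] at h2
  rw [h1]
  gcongr

theorem integral_norm_sub_sq (v : Vel) :
    Integrable (fun w => ‖v - w‖ ^ 2 * maxwellian w) ∧
      ∫ w, ‖v - w‖ ^ 2 * maxwellian w = ‖v‖ ^ 2 + 3 := by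
  have e : ∀ w, ‖v - w‖ ^ 2 * maxwellian w = ‖v‖ ^ 2 * maxwellian w
      - 2 * (⟪v, w⟫ * maxwellian w) + ‖w‖ ^ 2 * maxwellian w := fun w => by
    rw [norm_sub_sq_real]; ring
  have i1 := integrable_maxwellian.const_mul (‖v‖ ^ 2)
  have i2 := (integrable_inner_mul_maxwellian v).const_mul 2
  have i3 := integrable_norm_pow_mul_maxwellian 2
  have i4 : Integrable fun w => ‖v‖ ^ 2 * maxwellian w - 2 * (⟪v, w⟫ * maxwellian w) := i1.sub i2
  simp only [e]
  refine ⟨i4.add i3, ?_⟩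
  rw [integral_add i4 i3, integral_sub i1 i2, integral_const_mul, integral_const_mul,
    integral_maxwellian, integral_inner_mul_maxwellian, integral_norm_sq_mul_maxwellian]
  ring

/-- Jensen's inequality in tangent form: |v|² + 3 is the mean of |v - w|² under μ, and the power
(γ+2)/2 is concave. -/
theorem exists_halfTrace_le_rpow {γ : ℝ} (hγ₀ : γ < 0) (hγ : -2 < γ) (v : Vel) :
    meanHalfTrace γ v ≤ (‖v‖ ^ 2 + 3) ^ ((γ + 2) / 2) := by
  set A := ‖v‖ ^ 2 + 3
  have hA : 0 < A := by positivity
  set θ := (γ + 2) / 2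
  obtain ⟨i1, e1⟩ := integral_norm_sub_sq v
  have hi : Integrable fun w => A ^ θ * (1 - θ) * maxwellian w
      + A ^ θ * θ / A * (‖v - w‖ ^ 2 * maxwellian w) :=
    (integrable_maxwellian.const_mul _).add (i1.const_mul _)
  calc meanHalfTrace γ v ≤ ∫ w, (A ^ θ * (1 - θ) * maxwellian w
        + A ^ θ * θ / A * (‖v - w‖ ^ 2 * maxwellian w)) := by
        refine integral_mono (integrable_halfTrace (by linarith) v) hi fun w => ?_
        have h1 := norm_rpow_mul_sq_le γ (v - w)
        have h2 : ‖v - w‖ ^ (γ + 2) = (‖v - w‖ ^ 2) ^ θ := by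
          rw [← Real.rpow_natCast_mul (norm_nonneg _)]; congr 1; simp only [θ]; push_cast; ring
        have h3 := rpow_le_tangent (x := ‖v - w‖ ^ 2) (by positivity) hA
          (by simp only [θ]; linarith : 0 ≤ θ) (by simp only [θ]; linarith)
        rw [← h2] at h3
        have h4 := mul_le_mul_of_nonneg_right (h1.trans h3) (maxwellian_pos w).le
        refine h4.trans (le_of_eq ?_)
        field_simp
        ring
    _ = A ^ θ := by
        rw [integral_add (integrable_maxwellian.const_mul _) (i1.const_mul _), integral_const_mul,
          integral_const_mul, e1, integral_maxwellian]
        field_simp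
        ring

/-- Here |v - w|^γ is a convex power of |v - w|², bounded below by its tangent at the same point A =
|v|² + 3. The leading term 2A^{(γ+2)/2} is then exactly the one in the upper bound for twice the
half trace. -/
theorem le_meanForm_self {γ : ℝ} (hγ₀ : γ < 0) (hγ : -2 < γ) (v : Vel) :
    2 * (‖v‖ ^ 2 + 3) ^ ((γ + 2) / 2) - (6 + ∫ w, ‖w‖ ^ 4 * maxwellian w) ≤ meanForm γ v v v := by
  set A := ‖v‖ ^ 2 + 3 with hAdef
  have hA : 0 < A := by positivity
  have hA1 : 1 ≤ A := by nlinarith [sq_nonneg ‖v‖]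
  set κ := -γ / 2 with hκdef
  have hκ0 : 0 ≤ κ := by simp only [κ]; linarith
  have hκ1 : κ ≤ 1 := by simp only [κ]; linarith
  set q : Vel → ℝ := fun w => ‖w‖ ^ 2 * ‖v‖ ^ 2 - ⟪v, w⟫ ^ 2 with hq
  have hq0 : ∀ w, 0 ≤ q w := fun w => by
    have := sq_inner_le v w; simp only [hq]; linarith
  have hqle : ∀ w, q w ≤ ‖w‖ ^ 2 * ‖v‖ ^ 2 := fun w => by
    have := sq_nonneg ⟪v, w⟫; simp only [hq]; linarith
  set m4 := ∫ w : Vel, ‖w‖ ^ 4 * maxwellian w with hm4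
  have hm40 : 0 ≤ m4 := integral_nonneg fun w => mul_nonneg (by positivity) (maxwellian_pos w).le
  have iq : Integrable fun w => q w * maxwellian w := by
    have := ((integrable_norm_pow_mul_maxwellian 2).const_mul (‖v‖ ^ 2)).sub
      (integrable_inner_sq_mul_maxwellian v)
    refine this.congr (.of_forall fun w => ?_)
    simp only [Pi.sub_apply, hq]; ring
  have eq : ∫ w, q w * maxwellian w = 2 * ‖v‖ ^ 2 := by
    have : ∀ w, q w * maxwellian w = ‖v‖ ^ 2 * (‖w‖ ^ 2 * maxwellian w)
        - ⟪v, w⟫ ^ 2 * maxwellian w := fun w => by simp only [hq]; ring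
    simp only [this]
    rw [integral_sub ((integrable_norm_pow_mul_maxwellian 2).const_mul (‖v‖ ^ 2))
      (integrable_inner_sq_mul_maxwellian v), integral_const_mul, integral_norm_sq_mul_maxwellian,
      integral_inner_sq_mul_maxwellian]
    ring
  have ib : Integrable fun w => ⟪v, w⟫ * q w * maxwellian w := by
    refine integrable_mul_maxwellian (C := ‖v‖ * ‖v‖ ^ 2) (N := 3) (by simp only [hq]; fun_prop)
      fun w => ?_
    rw [abs_mul, abs_of_nonneg (hq0 w)]
    have h1 := abs_real_inner_le_norm v w
    have h2 := hqle w
    have h3 : ‖w‖ ≤ 1 + ‖w‖ := by linarith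
    calc _ ≤ (‖v‖ * ‖w‖) * (‖w‖ ^ 2 * ‖v‖ ^ 2) := by
          have := hq0 w
          gcongr
      _ = ‖v‖ * ‖v‖ ^ 2 * ‖w‖ ^ 3 := by ring
      _ ≤ _ := by gcongr
  have eb : ∫ w, ⟪v, w⟫ * q w * maxwellian w = 0 := by
    have h : ∫ w, ⟪v, -w⟫ * q (-w) * maxwellian (-w) = ∫ w, ⟪v, w⟫ * q w * maxwellian w :=
      integral_neg_eq_self (fun w => ⟪v, w⟫ * q w * maxwellian w) volume
    have h2 : ∀ w, ⟪v, -w⟫ * q (-w) * maxwellian (-w) = -(⟪v, w⟫ * q w * maxwellian w) := fun w => by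
      simp [maxwellian, hq]
    simp only [h2, integral_neg] at h
    linarith
  have ic : Integrable fun w => ‖w‖ ^ 2 * q w * maxwellian w := by
    refine integrable_mul_maxwellian (C := ‖v‖ ^ 2) (N := 4) (by simp only [hq]; fun_prop)
      fun w => ?_
    rw [abs_of_nonneg (mul_nonneg (by positivity) (hq0 w))]
    have h2 := hqle w
    have h3 : ‖w‖ ≤ 1 + ‖w‖ := by linarith
    calc _ ≤ ‖w‖ ^ 2 * (‖w‖ ^ 2 * ‖v‖ ^ 2) := by gcongr
      _ = ‖v‖ ^ 2 * ‖w‖ ^ 4 := by ring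
      _ ≤ _ := by gcongr
  have ec : ∫ w, ‖w‖ ^ 2 * q w * maxwellian w ≤ ‖v‖ ^ 2 * m4 := by
    rw [hm4, ← integral_const_mul]
    refine integral_mono ic ((integrable_norm_pow_mul_maxwellian 4).const_mul _) fun w => ?_
    have h2 := hqle w
    have h3 := (maxwellian_pos w).le
    calc _ ≤ ‖w‖ ^ 2 * (‖w‖ ^ 2 * ‖v‖ ^ 2) * maxwellian w := by gcongr
      _ = _ := by ring
  set a := A ^ (-κ) with ha
  have ha0 : 0 < a := by positivity
  -- After the tangent bound the integrand is a polynomial times μ: one moment is explicit, the odd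
  -- one vanishes, and the last is bounded by the fourth moment.
  have hlow : ∀ w, a * (1 + κ) * (q w * maxwellian w) - a * κ / A * (‖v‖ ^ 2 * (q w * maxwellian w)
      - 2 * (⟪v, w⟫ * q w * maxwellian w) + ‖w‖ ^ 2 * q w * maxwellian w)
      ≤ collisionForm γ (v - w) v v * maxwellian w := fun w => by
    have e1 : a * (1 + κ) * (q w * maxwellian w) - a * κ / A * (‖v‖ ^ 2 * (q w * maxwellian w)
      - 2 * (⟪v, w⟫ * q w * maxwellian w) + ‖w‖ ^ 2 * q w * maxwellian w)
        = (a * (1 - κ * (‖v - w‖ ^ 2 / A - 1)) * q w) * maxwellian w := by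
      rw [norm_sub_sq_real]
      field_simp
      ring
    rw [e1, collisionForm_sub_self]
    refine mul_le_mul_of_nonneg_right ?_ (maxwellian_pos w).le
    rcases eq_or_ne (v - w) 0 with h0 | h0
    · have : q w = 0 := by
        have : v = w := sub_eq_zero.1 h0
        simp only [hq, this, real_inner_self_eq_norm_sq]; ring
      simp only [hq] at this
      simp [hq, this]
    · refine mul_le_mul_of_nonneg_right ?_ (hq0 w)
      have hpos : 0 < ‖v - w‖ := norm_pos_iff.2 h0
      have h2 : ‖v - w‖ ^ γ = (‖v - w‖ ^ 2) ^ (-κ) := by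
        rw [← Real.rpow_natCast_mul (norm_nonneg _)]; congr 1; simp only [κ]; push_cast; ring
      rw [h2]
      exact rpow_ge_tangent (by positivity) hA hκ0
  have hi1 := iq.const_mul (a * (1 + κ))
  have hi2 := (((iq.const_mul (‖v‖ ^ 2)).sub (ib.const_mul 2)).add ic).const_mul (a * κ / A)
  have key := integral_mono (hi1.sub hi2) (integrable_collisionForm (by linarith) v v v) hlow
  simp only [Pi.sub_apply, Pi.add_apply] at key
  have hi3 : Integrable fun w => ‖v‖ ^ 2 * (q w * maxwellian w)
      - 2 * (⟪v, w⟫ * q w * maxwellian w) := (iq.const_mul _).sub (ib.const_mul _)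
  rw [integral_sub hi1 (by simpa using hi2), integral_const_mul, integral_const_mul,
    integral_add hi3 ic, integral_sub (iq.const_mul _) (ib.const_mul _), integral_const_mul,
    integral_const_mul, eq, eb] at key
  refine le_trans ?_ key
  have hθ : A ^ ((γ + 2) / 2) = a * A := by
    rw [ha, ← Real.rpow_add_one hA.ne']; congr 1; simp only [κ]; ring
  rw [hθ]
  have ha1 : a ≤ 1 := Real.rpow_le_one_of_one_le_of_nonpos hA1 (by linarith)
  have hvA : ‖v‖ ^ 2 ≤ A := by linarith
  set v2 := ‖v‖ ^ 2 with hv2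
  have hv20 : 0 ≤ v2 := by positivity
  -- Using |v|² ≤ A, the tangent correction is at most aκ(2|v|² + m4), so the contributions of κ to
  -- the leading term cancel and 2a|v|² = 2aA - 6a remains; a ≤ 1 bounds the rest.
  have h5 : a * κ / A * (v2 * (2 * v2) - 2 * 0 + ∫ w, ‖w‖ ^ 2 * q w * maxwellian w)
      ≤ a * κ * (2 * v2 + m4) := by
    rw [div_mul_eq_mul_div, div_le_iff₀ hA]
    have : v2 * (2 * v2) - 2 * 0 + ∫ w, ‖w‖ ^ 2 * q w * maxwellian w ≤ (2 * v2 + m4) * A := by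
      nlinarith
    calc _ ≤ a * κ * ((2 * v2 + m4) * A) := by gcongr
      _ = _ := by ring
  have h6 : a * κ * m4 ≤ m4 := by
    have : a * κ ≤ 1 := by nlinarith
    nlinarith
  have h7 : v2 = A - 3 := by rw [hAdef]; ring
  rw [h7] at h5 ⊢
  nlinarith

/-- The averaged matrix controls its trace in the direction of `v`, up to a constant. -/
theorem exists_halfTrace_le {γ : ℝ} (hγ : -3 < γ) (hγ₀ : γ < 0) :
    ∃ C, 0 < C ∧ ∀ v, 2 * meanHalfTrace γ v - meanForm γ v v v ≤ C := by
  -- For γ ≤ -2 the exponent γ + 2 is nonpositive and the trace is itself bounded. For γ > -2 it may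
  -- grow, and the cancellation between the two tangent bounds is needed.
  rcases le_or_gt γ (-2) with h | h
  · obtain ⟨C, hC, hb⟩ := exists_kernel_bound (s := γ + 2) (c := 1 / 2) (by linarith) (by norm_num) 0
    refine ⟨2 * ((2 * Real.pi) ^ (-(3 / 2) : ℝ) * C), by positivity, fun v => ?_⟩
    have h1 : meanHalfTrace γ v ≤ (2 * Real.pi) ^ (-(3 / 2) : ℝ) * C := by
      have h2 := (hb v).2
      rw [max_eq_right (by linarith), Real.rpow_zero, mul_one] at h2
      refine le_trans ?_ (mul_le_mul_of_nonneg_left h2 (by positivity))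
      rw [← integral_const_mul]
      refine integral_mono (integrable_halfTrace hγ v) ((hb v).1.const_mul _) fun w => ?_
      have h3 := mul_le_mul_of_nonneg_right (norm_rpow_mul_sq_le γ (v - w)) (maxwellian_pos w).le
      refine h3.trans (le_of_eq ?_)
      rw [maxwellian_eq]; ring
    linarith [meanForm_self_nonneg γ v v]
  · have hm40 : 0 ≤ ∫ w : Vel, ‖w‖ ^ 4 * maxwellian w :=
      integral_nonneg fun w => mul_nonneg (by positivity) (maxwellian_pos w).le
    refine ⟨6 + ∫ w : Vel, ‖w‖ ^ 4 * maxwellian w, by positivity, fun v => ?_⟩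
    linarith [le_meanForm_self hγ₀ h v, exists_halfTrace_le_rpow hγ₀ h v]

/-! ### Measurability and integrability of the averaged form -/

theorem measurable_meanForm (γ : ℝ) :
    Measurable fun x : Vel × Vel × Vel => meanForm γ x.1 x.2.1 x.2.2 := by
  have : StronglyMeasurable fun y : (Vel × Vel × Vel) × Vel =>
      collisionForm γ (y.1.1 - y.2) y.1.2.1 y.1.2.2 * maxwellian y.2 := by
    refine Measurable.stronglyMeasurable ?_
    exact ((measurable_collisionForm γ).comp (by fun_prop : Measurable
      fun y : (Vel × Vel × Vel) × Vel => (y.1.1 - y.2, y.1.2.1, y.1.2.2))).mul (by fun_prop)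
  exact this.integral_prod_right'.measurable

theorem AEStronglyMeasurable.meanForm {γ : ℝ} {ξ η : Vel → Vel} (hξ : AEStronglyMeasurable ξ)
    (hη : AEStronglyMeasurable η) :
    AEStronglyMeasurable fun v => Landau.meanForm γ v (ξ v) (η v) :=
  ((measurable_meanForm γ).comp_aemeasurable
    (aemeasurable_id.prodMk (hξ.aemeasurable.prodMk hη.aemeasurable))).aestronglyMeasurable

theorem meanForm_comm (γ : ℝ) (v ξ η : Vel) : meanForm γ v ξ η = meanForm γ v η ξ := by
  simp only [meanForm, collisionForm_comm γ _ ξ η]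

theorem meanForm_add_smul {γ : ℝ} (hγ : -3 < γ) (v ξ η : Vel) (c : ℝ) :
    meanForm γ v (ξ + c • η) (ξ + c • η) = meanForm γ v ξ ξ + 2 * c * meanForm γ v ξ η
      + c ^ 2 * meanForm γ v η η := by
  simp only [meanForm_eq_sum hγ v (ξ + c • η)]
  have h2 : 2 * c * meanForm γ v ξ η = c * meanForm γ v ξ η + c * meanForm γ v η ξ := by
    rw [meanForm_comm γ v η ξ]; ring
  rw [h2]
  simp only [meanForm_eq_sum hγ, Fin.sum_univ_three, PiLp.add_apply, PiLp.smul_apply, smul_eq_mul]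
  ring

theorem abs_meanForm_le {γ : ℝ} (hγ : -3 < γ) (v ξ η : Vel) :
    2 * |meanForm γ v ξ η| ≤ meanForm γ v ξ ξ + meanForm γ v η η := by
  have h1 := meanForm_self_nonneg γ v (ξ + (1 : ℝ) • η)
  have h2 := meanForm_self_nonneg γ v (ξ + (-1 : ℝ) • η)
  rw [meanForm_add_smul hγ] at h1 h2
  have : |meanForm γ v ξ η| ≤ (meanForm γ v ξ ξ + meanForm γ v η η) / 2 :=
    abs_le.2 ⟨by linarith, by linarith⟩
  linarith

/-- The second version uses z = v - w as integration variable. It justifies freezing z, so that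
derivatives in v fall only on smooth factors. -/
theorem integrable_prod_kernel {s c : ℝ} (hs : -3 < s) (hc : 0 < c) (N : ℕ) {h : Vel → ℝ}
    (hm : AEStronglyMeasurable h) (hi : Integrable fun v => |h v| * (1 + ‖v‖) ^ (max s 0)) :
    Integrable (fun x : Vel × Vel =>
      h x.1 * (‖x.1 - x.2‖ ^ s * ((1 + ‖x.2‖) ^ N * Real.exp (-c * ‖x.2‖ ^ 2)))) ∧
    Integrable (fun x : Vel × Vel =>
      h x.1 * (‖x.2‖ ^ s * ((1 + ‖x.1 - x.2‖) ^ N * Real.exp (-c * ‖x.1 - x.2‖ ^ 2)))) := by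
  obtain ⟨C, hC, hb⟩ := exists_kernel_bound hs hc N
  have hm' : AEStronglyMeasurable (fun x : Vel × Vel => h x.1) (volume.prod volume) := hm.comp_fst
  have hsw : ∀ v z : Vel, ‖z‖ ^ s * ((1 + ‖v - z‖) ^ N * Real.exp (-c * ‖v - z‖ ^ 2)) =
      (fun w => ‖v - w‖ ^ s * ((1 + ‖w‖) ^ N * Real.exp (-c * ‖w‖ ^ 2))) (v - z) := fun v z => by
    simp
  have hmono : ∀ g : Vel → Vel → ℝ, (∀ v w, 0 ≤ g v w) →
      (∀ v, ∫ w, g v w ≤ C * (1 + ‖v‖) ^ (max s 0)) →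
      AEStronglyMeasurable (fun v => ∫ w, ‖h v * g v w‖) → Integrable fun v => ∫ w, ‖h v * g v w‖ := by
    intro g hg hgb hgm
    refine (hi.const_mul C).mono' hgm (.of_forall fun v => ?_)
    rw [Real.norm_of_nonneg (integral_nonneg fun _ => norm_nonneg _)]
    simp only [norm_mul, Real.norm_eq_abs, abs_of_nonneg (hg _ _)]
    rw [integral_const_mul]
    calc _ ≤ |h v| * (C * (1 + ‖v‖) ^ (max s 0)) := by gcongr; exact hgb v
      _ = _ := by ring
  constructor
  · have hmeas : AEStronglyMeasurable (fun x : Vel × Vel =>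
        h x.1 * (‖x.1 - x.2‖ ^ s * ((1 + ‖x.2‖) ^ N * Real.exp (-c * ‖x.2‖ ^ 2))))
        (volume.prod volume) :=
      hm'.mul (by fun_prop : Measurable fun x : Vel × Vel =>
        ‖x.1 - x.2‖ ^ s * ((1 + ‖x.2‖) ^ N * Real.exp (-c * ‖x.2‖ ^ 2))).aestronglyMeasurable
    refine (integrable_prod_iff hmeas).2 ⟨.of_forall fun v => (hb v).1.const_mul (h v), ?_⟩
    exact hmono _ (fun _ _ => by positivity) (fun v => (hb v).2) hmeas.norm.integral_prod_right'
  · have hmeas : AEStronglyMeasurable (fun x : Vel × Vel =>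
        h x.1 * (‖x.2‖ ^ s * ((1 + ‖x.1 - x.2‖) ^ N * Real.exp (-c * ‖x.1 - x.2‖ ^ 2))))
        (volume.prod volume) :=
      hm'.mul (by fun_prop : Measurable fun x : Vel × Vel =>
        ‖x.2‖ ^ s * ((1 + ‖x.1 - x.2‖) ^ N * Real.exp (-c * ‖x.1 - x.2‖ ^ 2))).aestronglyMeasurable
    refine (integrable_prod_iff hmeas).2 ⟨.of_forall fun v => ?_, ?_⟩
    · simp only [hsw]
      exact ((hb v).1.comp_sub_left v).const_mul (h v)
    · refine hmono _ (fun _ _ => by positivity) (fun v => ?_) hmeas.norm.integral_prod_right'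
      simp only [hsw]
      exact (integral_sub_left_eq_self (fun w => ‖v - w‖ ^ s * ((1 + ‖w‖) ^ N *
        Real.exp (-c * ‖w‖ ^ 2))) volume v).trans_le (hb v).2

/-! ### Test functions -/

theorem gradient_apply (φ : Vel → ℝ) (v : Vel) (j : Fin 3) :
    gradient φ v j = dirDeriv (basisVec j) φ v := by
  rw [← inner_basisVec, real_inner_comm, gradient, InnerProductSpace.toDual_symm_apply]
  rfl

theorem inner_gradient (φ : Vel → ℝ) (v e : Vel) : ⟪gradient φ v, e⟫ = fderiv ℝ φ v e := by
  rw [gradient, InnerProductSpace.toDual_symm_apply]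

theorem continuous_gradient {φ : Vel → ℝ} (hφ : ContDiff ℝ ∞ φ) : Continuous (gradient φ) :=
  (InnerProductSpace.toDual ℝ Vel).symm.continuous.comp (hφ.continuous_fderiv (by simp))

theorem hasCompactSupport_gradient {φ : Vel → ℝ} (hφ : HasCompactSupport φ) :
    HasCompactSupport (gradient φ) :=
  (hφ.fderiv ℝ).comp_left (g := (InnerProductSpace.toDual ℝ Vel).symm) (map_zero _)

theorem IsTestFunction.continuous {φ : Vel → ℝ} (hφ : IsTestFunction φ) : Continuous φ :=
  hφ.1.continuous

theorem IsTestFunction.integrable_mul {φ : Vel → ℝ} (hφ : IsTestFunction φ) {g : Vel → ℝ}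
    (hg : Continuous g) : Integrable fun v => φ v * g v :=
  (hφ.continuous.mul hg).integrable_of_hasCompactSupport hφ.2.mul_right

theorem sum_collisionForm_basisVec (γ : ℝ) (z η : Vel) (c : Fin 3 → ℝ) (ξ : Vel)
    (hc : ∀ j, c j = ξ j) : ∑ j, c j * collisionForm γ z (basisVec j) η = collisionForm γ z ξ η := by
  simp only [collisionForm, inner_basisVec, real_inner_comm (basisVec _) z, hc]
  have h : ∀ x y : Vel, ⟪x, y⟫ = x 0 * y 0 + x 1 * y 1 + x 2 * y 2 := fun x y => by
    simp only [PiLp.inner_apply, RCLike.inner_apply, Fin.sum_univ_three, conj_trivial]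
    ring
  rw [h ξ η, h z ξ, Fin.sum_univ_three]
  ring

theorem sum_collisionForm_diag (γ : ℝ) (z : Vel) :
    ∑ j, collisionForm γ z (basisVec j) (basisVec j) = 2 * (‖z‖ ^ γ * ‖z‖ ^ 2) := by
  simp only [collisionForm, inner_basisVec, real_inner_comm (basisVec _) z]
  have h : ‖z‖ ^ 2 = z 0 * z 0 + z 1 * z 1 + z 2 * z 2 := by
    rw [EuclideanSpace.norm_sq_eq]; simp [Fin.sum_univ_three]; ring
  rw [Fin.sum_univ_three, h]
  simp [basisVec]
  ring

theorem collisionForm_add_right (γ : ℝ) (z ξ η η' : Vel) :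
    collisionForm γ z ξ (η + η') = collisionForm γ z ξ η + collisionForm γ z ξ η' := by
  simp only [collisionForm, inner_add_right]; ring

theorem hasFDerivAt_collisionForm (γ : ℝ) (z ξ v : Vel) :
    HasFDerivAt (fun v => collisionForm γ z ξ (v - z))
      (‖z‖ ^ γ • (‖z‖ ^ 2 • innerSL ℝ ξ - ⟪z, ξ⟫ • innerSL ℝ z)) v := by
  have h : (fun v => collisionForm γ z ξ (v - z)) = fun v =>
      (‖z‖ ^ γ • (‖z‖ ^ 2 • innerSL ℝ ξ - ⟪z, ξ⟫ • innerSL ℝ z)) v - collisionForm γ z ξ z := by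
    ext v
    simp [collisionForm, inner_sub_right]
    ring
  rw [h]
  exact (ContinuousLinearMap.hasFDerivAt _).sub_const _

theorem hasFDerivAt_maxwellian_sub (z v : Vel) :
    HasFDerivAt (fun v => maxwellian (v - z)) (fderiv ℝ maxwellian (v - z)) v := by
  have h1 : HasFDerivAt maxwellian (fderiv ℝ maxwellian (v - z)) (v - z) :=
    ((contDiff_maxwellian.differentiable (by simp)) (v - z)).hasFDerivAt
  exact h1.comp v ((hasFDerivAt_id v).sub_const z)

/-- With z fixed the singular factor |z|^γ is constant. Writing φ∇φ = ½∇(φ²), the derivative falls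
on a(z)(v - z) μ(v - z), whose divergence produces the trace minus the quadratic term. -/
theorem integral_test_collision (γ : ℝ) {φ : Vel → ℝ} (hφ : IsTestFunction φ) (z : Vel) :
    ∫ v, φ v * (collisionForm γ z (gradient φ v) (v - z) * maxwellian (v - z))
      = -(1 / 2) * ∫ v, φ v ^ 2 * ((2 * (‖z‖ ^ γ * ‖z‖ ^ 2)
        - collisionForm γ z (v - z) (v - z)) * maxwellian (v - z)) := by
  set m : Fin 3 → Vel → ℝ := fun j v => collisionForm γ z (basisVec j) (v - z) * maxwellian (v - z)
    with hm
  have hcf : ∀ ξ, Continuous fun v => collisionForm γ z ξ (v - z) := fun ξ => by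
    unfold collisionForm; fun_prop
  have hmc : ∀ j, Continuous (m j) := fun j => (hcf _).mul (by fun_prop)
  have hmd : ∀ j v, HasFDerivAt (m j) _ v := fun j v =>
    (hasFDerivAt_collisionForm γ z (basisVec j) v).mul
      (hasFDerivAt_maxwellian_sub z v)
  have hm' : ∀ j v, fderiv ℝ (m j) v (basisVec j) = (collisionForm γ z (basisVec j) (basisVec j)
      - (v - z) j * collisionForm γ z (basisVec j) (v - z)) * maxwellian (v - z) := fun j v => by
    rw [(hmd j v).fderiv]
    have e1 : (‖z‖ ^ γ • (‖z‖ ^ 2 • innerSL ℝ (basisVec j) - ⟪z, basisVec j⟫ • innerSL ℝ z))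
        (basisVec j) = collisionForm γ z (basisVec j) (basisVec j) := by
      simp [collisionForm]
    simp only [add_apply, smul_apply, e1, smul_eq_mul, fderiv_maxwellian]
    rw [real_inner_comm, inner_basisVec]
    ring
  have hφd : Differentiable ℝ φ := hφ.1.differentiable (by simp)
  have hφ2 : ∀ v e, fderiv ℝ (fun v => φ v ^ 2) v e = 2 * (φ v * fderiv ℝ φ v e) := fun v e => by
    rw [((hφd v).hasFDerivAt.pow 2).fderiv]
    simp
    ring
  have hfdc : ∀ e, Continuous fun v => fderiv ℝ φ v e := fun e =>
    (hφ.1.continuous_fderiv (by simp)).clm_apply continuous_const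
  have hmfc : ∀ j, Continuous fun v => fderiv ℝ (m j) v (basisVec j) := fun j => by
    simp only [hm']
    exact ((continuous_const.sub (Continuous.mul (by fun_prop) (hcf _))).mul (by fun_prop))
  have key : ∀ j, ∫ v, φ v * (fderiv ℝ φ v (basisVec j) * m j v)
      = -(1 / 2) * ∫ v, φ v ^ 2 * fderiv ℝ (m j) v (basisVec j) := by
    intro j
    have h1 := integral_mul_fderiv_eq_neg_fderiv_mul_of_integrable (μ := volume) (f := m j)
      (g := fun v => φ v ^ 2) (v := basisVec j) ?_ ?_ ?_ (fun v _ => (hmd j v).differentiableAt)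
      (fun v _ => ((hφd v).pow 2))
    · simp only [hφ2] at h1
      have e1 : ∀ v, m j v * (2 * (φ v * fderiv ℝ φ v (basisVec j)))
        = 2 * (φ v * (fderiv ℝ φ v (basisVec j) * m j v)) := fun v => by ring
      have e2 : ∀ v, fderiv ℝ (m j) v (basisVec j) * φ v ^ 2
        = φ v ^ 2 * fderiv ℝ (m j) v (basisVec j) := fun v => by ring
      simp only [e1, e2, integral_const_mul] at h1
      linarith
    · refine (hφ.integrable_mul (hφ.continuous.mul (hmfc j))).congr (.of_forall fun v => ?_)
      simp only [Pi.mul_apply]; ring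
    · refine (hφ.integrable_mul (((hfdc (basisVec j)).mul (hmc j)).const_mul 2)).congr
        (.of_forall fun v => ?_)
      simp only [hφ2, Pi.mul_apply]; ring
    · refine (hφ.integrable_mul (hφ.continuous.mul (hmc j))).congr (.of_forall fun v => ?_)
      simp only [Pi.mul_apply]; ring
  have e1 : ∀ v, φ v * (collisionForm γ z (gradient φ v) (v - z) * maxwellian (v - z))
      = ∑ j, φ v * (fderiv ℝ φ v (basisVec j) * m j v) := fun v => by
    rw [← sum_collisionForm_basisVec γ z (v - z) (fun j => fderiv ℝ φ v (basisVec j)) (gradient φ v)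
      (fun j => (gradient_apply φ v j).symm)]
    rw [Finset.sum_mul, Finset.mul_sum]
    exact Finset.sum_congr rfl fun j _ => by simp only [hm]; ring
  have e2 : ∀ v, φ v ^ 2 * ((2 * (‖z‖ ^ γ * ‖z‖ ^ 2)
      - collisionForm γ z (v - z) (v - z)) * maxwellian (v - z))
      = ∑ j, φ v ^ 2 * fderiv ℝ (m j) v (basisVec j) := fun v => by
    rw [← sum_collisionForm_diag, ← sum_collisionForm_basisVec γ z (v - z) (fun j => (v - z) j)
      (v - z) (fun j => rfl), ← Finset.sum_sub_distrib, Finset.sum_mul, Finset.mul_sum]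
    exact Finset.sum_congr rfl fun j _ => by rw [hm']
  have hI : ∀ j, Integrable fun v => φ v * (fderiv ℝ φ v (basisVec j) * m j v) := fun j =>
    hφ.integrable_mul ((hfdc _).mul (hmc j))
  have hI' : ∀ j, Integrable fun v => φ v ^ 2 * fderiv ℝ (m j) v (basisVec j) := fun j => by
    refine (hφ.integrable_mul (hφ.continuous.mul (hmfc j))).congr (.of_forall fun v => ?_)
    simp only [Pi.mul_apply]; ring
  simp only [e1, e2]
  rw [integral_finsetSum _ fun j _ => hI j, integral_finsetSum _ fun j _ => hI' j, Finset.mul_sum]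
  exact Finset.sum_congr rfl fun j _ => key j

theorem Measurable.collisionForm {α : Type*} [MeasurableSpace α] (γ : ℝ) {z ξ η : α → Vel}
    (hz : Measurable z) (hξ : Measurable ξ) (hη : Measurable η) :
    Measurable fun x => Landau.collisionForm γ (z x) (ξ x) (η x) := by
  unfold Landau.collisionForm; fun_prop

theorem integrable_mul_weight {h : Vel → ℝ} (hc : Continuous h) (hs : HasCompactSupport h) (m : ℝ) :
    Integrable fun v => |h v| * (1 + ‖v‖) ^ m := by
  have h1 : Continuous fun v : Vel => (1 + ‖v‖) ^ m :=
    (by fun_prop : Continuous fun v : Vel => 1 + ‖v‖).rpow_const fun v => Or.inl (by positivity)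
  exact (hc.abs.mul h1).integrable_of_hasCompactSupport ((hs.norm).mul_right)

/-- The integral of the convection term `φ ā v · ∇φ`, by parts. -/
theorem integral_mul_meanForm_gradient {γ : ℝ} (hγ : -3 < γ) {φ : Vel → ℝ} (hφ : IsTestFunction φ) :
    Integrable (fun v => φ v ^ 2 * (2 * meanHalfTrace γ v - meanForm γ v v v)) ∧
    ∫ v, φ v * meanForm γ v (gradient φ v) v
      = -(1 / 2) * ∫ v, φ v ^ 2 * (2 * meanHalfTrace γ v - meanForm γ v v v) := by
  have hgc := continuous_gradient hφ.1
  have hφc := hφ.continuous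
  set c₀ : ℝ := (2 * Real.pi) ^ (-(3 / 2) : ℝ)
  have hc₀ : 0 ≤ c₀ := by positivity
  have hmx : ∀ u : Vel, maxwellian u = c₀ * Real.exp (-(1 / 2) * ‖u‖ ^ 2) := maxwellian_eq
  have i1 : Integrable fun x : Vel × Vel =>
      φ x.1 * (collisionForm γ x.2 (gradient φ x.1) (x.1 - x.2) * maxwellian (x.1 - x.2)) := by
    have h1 := (integrable_prod_kernel (s := γ + 2) (c := 1 / 2) (by linarith) (by norm_num) 1
      (h := fun v => c₀ * |φ v| * ‖gradient φ v‖) (by fun_prop)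
      (integrable_mul_weight (by fun_prop) (hφ.2.norm.mul_left.mul_right) _)).2
    refine h1.mono' ?_ (.of_forall fun x => ?_)
    · have h2 : Measurable fun x : Vel × Vel => collisionForm γ x.2 (gradient φ x.1) (x.1 - x.2) :=
        Measurable.collisionForm γ measurable_snd (hgc.measurable.comp measurable_fst)
          (measurable_fst.sub measurable_snd)
      have h3 : Measurable fun x : Vel × Vel => maxwellian (x.1 - x.2) :=
        measurable_maxwellian.comp (measurable_fst.sub measurable_snd)
      exact ((hφc.measurable.comp measurable_fst).mul (h2.mul h3)).aestronglyMeasurable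
    · rw [norm_mul, norm_mul, Real.norm_eq_abs, Real.norm_eq_abs,
        Real.norm_of_nonneg (maxwellian_pos _).le, hmx]
      calc _ ≤ |φ x.1| * ((‖x.2‖ ^ (γ + 2) * (‖gradient φ x.1‖ * ‖x.1 - x.2‖))
          * (c₀ * Real.exp (-(1 / 2) * ‖x.1 - x.2‖ ^ 2))) := by
            gcongr; exact abs_collisionForm_le _ _ _ _
        _ ≤ |φ x.1| * ((‖x.2‖ ^ (γ + 2) * (‖gradient φ x.1‖ * (1 + ‖x.1 - x.2‖) ^ 1))
          * (c₀ * Real.exp (-(1 / 2) * ‖x.1 - x.2‖ ^ 2))) := by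
            gcongr; rw [pow_one]; linarith
        _ = _ := by ring
  have i2 : Integrable fun x : Vel × Vel =>
      φ x.1 ^ 2 * ((2 * (‖x.2‖ ^ γ * ‖x.2‖ ^ 2)
        - collisionForm γ x.2 (x.1 - x.2) (x.1 - x.2)) * maxwellian (x.1 - x.2)) := by
    have h1 := (integrable_prod_kernel (s := γ + 2) (c := 1 / 2) (by linarith) (by norm_num) 2
      (h := fun v => 3 * c₀ * φ v ^ 2) (by fun_prop)
      (integrable_mul_weight (by fun_prop) ((hφ.2.comp_left (g := fun x => x ^ 2)
        (by simp)).mul_left) _)).2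
    refine h1.mono' ?_ (.of_forall fun x => ?_)
    · have h2 : Measurable fun x : Vel × Vel => collisionForm γ x.2 (x.1 - x.2) (x.1 - x.2) := by
        unfold collisionForm; fun_prop
      have h3 : Measurable fun x : Vel × Vel => maxwellian (x.1 - x.2) :=
        measurable_maxwellian.comp (measurable_fst.sub measurable_snd)
      have h4 : Measurable fun x : Vel × Vel => 2 * (‖x.2‖ ^ γ * ‖x.2‖ ^ 2) := by fun_prop
      exact (((hφc.measurable.comp measurable_fst).pow_const 2).mul
        ((h4.sub h2).mul h3)).aestronglyMeasurable
    · rw [norm_mul, norm_mul, Real.norm_of_nonneg (sq_nonneg _),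
        Real.norm_of_nonneg (maxwellian_pos _).le, hmx, Real.norm_eq_abs]
      have h3 := abs_collisionForm_le γ x.2 (x.1 - x.2) (x.1 - x.2)
      have h4 := norm_rpow_mul_sq_le γ x.2
      have h5 : 0 ≤ ‖x.2‖ ^ γ * ‖x.2‖ ^ 2 := by positivity
      have h6 : 0 ≤ ‖x.2‖ ^ (γ + 2) := by positivity
      have h7 : |2 * (‖x.2‖ ^ γ * ‖x.2‖ ^ 2) - collisionForm γ x.2 (x.1 - x.2) (x.1 - x.2)|
          ≤ 3 * (‖x.2‖ ^ (γ + 2) * (1 + ‖x.1 - x.2‖) ^ 2) := by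
        refine (abs_sub _ _).trans ?_
        rw [abs_of_nonneg (by positivity : (0 : ℝ) ≤ 2 * (‖x.2‖ ^ γ * ‖x.2‖ ^ 2))]
        have h8 : 1 ≤ (1 + ‖x.1 - x.2‖) ^ 2 := one_le_pow₀ (by linarith [norm_nonneg (x.1 - x.2)])
        have h9 : ‖x.1 - x.2‖ * ‖x.1 - x.2‖ ≤ (1 + ‖x.1 - x.2‖) ^ 2 := by
          nlinarith [norm_nonneg (x.1 - x.2)]
        nlinarith [mul_le_mul_of_nonneg_left h8 h6, mul_le_mul_of_nonneg_left h9 h6]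
      calc _ ≤ φ x.1 ^ 2 * ((3 * (‖x.2‖ ^ (γ + 2) * (1 + ‖x.1 - x.2‖) ^ 2))
          * (c₀ * Real.exp (-(1 / 2) * ‖x.1 - x.2‖ ^ 2))) := by gcongr
        _ = _ := by ring
  -- Substitute w = v - z and replace v by v - z in the form, which is allowed because a(z)z = 0.
  have e1 : ∀ v, φ v * meanForm γ v (gradient φ v) v = ∫ z, φ v * (collisionForm γ z (gradient φ v)
      (v - z) * maxwellian (v - z)) := fun v => by
    rw [integral_const_mul, meanForm]
    congr 1
    rw [← integral_sub_left_eq_self (fun w => collisionForm γ (v - w) (gradient φ v) v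
      * maxwellian w) volume v]
    refine integral_congr_ae (.of_forall fun z => ?_)
    simp only [sub_sub_cancel]
    have := collisionForm_sub_left γ v (v - z) (gradient φ v)
    rw [sub_sub_cancel] at this
    rw [collisionForm_comm γ z _ v, collisionForm_comm γ z _ (v - z), this]
  have e2 : ∀ v, ∫ z, φ v ^ 2 * ((2 * (‖z‖ ^ γ * ‖z‖ ^ 2) - collisionForm γ z (v - z) (v - z))
      * maxwellian (v - z)) = φ v ^ 2 * (2 * meanHalfTrace γ v - meanForm γ v v v) := fun v => by
    rw [integral_const_mul]
    congr 1
    rw [meanHalfTrace, meanForm, ← integral_const_mul, ← integral_sub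
      ((integrable_halfTrace hγ v).const_mul 2) (integrable_collisionForm hγ v v v),
      ← integral_sub_left_eq_self (fun w => 2 * (‖v - w‖ ^ γ * ‖v - w‖ ^ 2 * maxwellian w)
        - collisionForm γ (v - w) v v * maxwellian w) volume v]
    refine integral_congr_ae (.of_forall fun z => ?_)
    simp only [sub_sub_cancel]
    have h1 := collisionForm_sub_left γ v (v - z) v
    have h2 := collisionForm_sub_left γ v (v - z) (v - z)
    rw [sub_sub_cancel] at h1 h2
    rw [h2, collisionForm_comm, h1]
    ring
  constructor
  · simp only [← e2]
    exact i2.integral_prod_left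
  · simp only [e1, ← e2]
    -- Fubini's theorem puts the v-integral inside, where the integration by parts at fixed z
    -- applies.
    have s1 := integral_integral_swap (f := fun v z => φ v * (collisionForm γ z (gradient φ v) (v - z)
      * maxwellian (v - z))) i1
    have s2 := integral_integral_swap (f := fun v z => φ v ^ 2 * ((2 * (‖z‖ ^ γ * ‖z‖ ^ 2)
      - collisionForm γ z (v - z) (v - z)) * maxwellian (v - z))) i2
    rw [s1, s2, ← integral_const_mul]
    exact integral_congr_ae (.of_forall fun z => integral_test_collision γ hφ z)

/-! ### The energy of the twisted gradient. -/

/-- The gradient twisted by the Maxwellian, `√μ ∇(u / √μ)`, for `∇u = p`. -/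
def twist (u : Vel → ℝ) (p : Vel → Vel) (v : Vel) : Vel := p v + (u v / 2) • v

theorem meanForm_twist {γ : ℝ} (hγ : -3 < γ) (u : Vel → ℝ) (p : Vel → Vel) (v : Vel) :
    meanForm γ v (twist u p v) (twist u p v) = meanForm γ v (p v) (p v)
      + 1 / 4 * meanForm γ v v v * u v ^ 2 + u v * meanForm γ v (p v) v := by
  rw [twist, meanForm_add_smul hγ]; ring

theorem continuous_twist_gradient {φ : Vel → ℝ} (hφ : IsTestFunction φ) :
    Continuous (twist φ (gradient φ)) := by
  have := hφ.continuous
  have := continuous_gradient hφ.1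
  unfold twist; fun_prop

theorem hasCompactSupport_twist_gradient {φ : Vel → ℝ} (hφ : IsTestFunction φ) :
    HasCompactSupport (twist φ (gradient φ)) := by
  refine (hasCompactSupport_gradient hφ.2).add (HasCompactSupport.smul_right (f := fun v => φ v / 2)
    (hφ.2.comp_left (g := fun x => x / 2) (by simp)))

theorem integrable_meanForm_of_hasCompactSupport {γ : ℝ} (hγ : -3 < γ) (hγ₀ : γ < 0) {p : Vel → Vel}
    (hp : Continuous p) (hs : HasCompactSupport p) : Integrable fun v => meanForm γ v (p v) (p v) := by
  obtain ⟨C, hC, h⟩ := exists_meanForm_le hγ hγ₀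
  refine Integrable.mono' (g := fun v => C * (1 + ‖v‖) ^ 2 * ‖p v‖ ^ 2) ?_
    (AEStronglyMeasurable.meanForm hp.aestronglyMeasurable hp.aestronglyMeasurable) (.of_forall fun v => ?_)
  · exact Continuous.integrable_of_hasCompactSupport (by fun_prop)
      (HasCompactSupport.mul_left (f := fun v => C * (1 + ‖v‖) ^ 2)
        (hs.comp_left (g := fun x => ‖x‖ ^ 2) (by simp)))
  · rw [Real.norm_of_nonneg (meanForm_self_nonneg _ _ _)]; exact h v _

theorem integrable_energy {γ : ℝ} (hγ : -3 < γ) (hγ₀ : γ < 0) {φ : Vel → ℝ} (hφ : IsTestFunction φ) :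
    Integrable fun v => meanForm γ v (gradient φ v) (gradient φ v)
      + 1 / 4 * meanForm γ v v v * φ v ^ 2 := by
  refine (integrable_meanForm_of_hasCompactSupport hγ hγ₀ (continuous_gradient hφ.1)
    (hasCompactSupport_gradient hφ.2)).add ?_
  have h1 := hφ.continuous
  have h2 := (integrable_meanForm_of_hasCompactSupport hγ hγ₀ (p := fun v => φ v • v)
    (by fun_prop) (HasCompactSupport.smul_right (f := φ) (f' := fun v => v) hφ.2)).const_mul (1 / 4)
  refine h2.congr (.of_forall fun v => ?_)
  have h3 := meanForm_add_smul hγ v 0 v (φ v)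
  have h4 : meanForm γ v 0 0 = 0 := by simp [meanForm, collisionForm]
  have h5 : meanForm γ v 0 v = 0 := by simp [meanForm, collisionForm]
  rw [zero_add, h4, h5] at h3
  simp only [h3]
  ring

/-- The two energies differ by the convection cross term, which by parts is a potential multiplying
φ². That potential is bounded from the side needed, because the trace of ā minus āv·v is bounded
above. -/
theorem exists_energy_le {γ : ℝ} (hγ : -3 < γ) (hγ₀ : γ < 0) :
    ∃ C, 0 < C ∧ ∀ φ, IsTestFunction φ →
      ∫ v, (meanForm γ v (gradient φ v) (gradient φ v) + 1 / 4 * meanForm γ v v v * φ v ^ 2)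
        ≤ (∫ v, meanForm γ v (twist φ (gradient φ) v) (twist φ (gradient φ) v))
          + C * ∫ v, φ v ^ 2 := by
  obtain ⟨C, hC, h⟩ := exists_halfTrace_le hγ hγ₀
  refine ⟨C, hC, fun φ hφ => ?_⟩
  have i0 := integrable_meanForm_of_hasCompactSupport hγ hγ₀ (continuous_twist_gradient hφ)
    (hasCompactSupport_twist_gradient hφ)
  obtain ⟨i3, e⟩ := integral_mul_meanForm_gradient hγ hφ
  have i12 := integrable_energy hγ hγ₀ hφ
  have i4 : Integrable fun v => φ v * meanForm γ v (gradient φ v) v := by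
    refine (i0.sub i12).congr (.of_forall fun v => ?_)
    simp only [Pi.sub_apply, meanForm_twist hγ]
    ring
  have i5 : Integrable fun v => φ v ^ 2 := by
    simpa [sq] using hφ.integrable_mul hφ.continuous
  simp only [meanForm_twist hγ]
  rw [integral_add i12 i4, e]
  have : ∫ v, φ v ^ 2 * (2 * meanHalfTrace γ v - meanForm γ v v v) ≤ C * ∫ v, φ v ^ 2 := by
    rw [← integral_const_mul]
    refine integral_mono i3 (i5.const_mul C) fun v => ?_
    simp only
    nlinarith [h v, sq_nonneg (φ v)]
  have h0 : 0 ≤ ∫ v, φ v ^ 2 := integral_nonneg fun v => sq_nonneg _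
  nlinarith

/-! ### Square-integrable kernels -/

section Kernel

variable {α β : Type*} [MeasurableSpace α] [MeasurableSpace β] {μ : Measure α} {ν : Measure β}

theorem sq_integral_mul_le {f g : α → ℝ} (hf : MemLp f 2 μ) (hg : MemLp g 2 μ) :
    (∫ x, f x * g x ∂μ) ^ 2 ≤ (∫ x, f x ^ 2 ∂μ) * ∫ x, g x ^ 2 ∂μ := by
  have key : ∀ {a b : α → ℝ} (ha : MemLp a 2 μ) (hb : MemLp b 2 μ),
      ⟪ha.toLp a, hb.toLp b⟫ = ∫ x, a x * b x ∂μ := fun {a b} ha hb => by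
    rw [L2.inner_def]
    refine integral_congr_ae ?_
    filter_upwards [ha.coeFn_toLp, hb.coeFn_toLp] with x h1 h2
    rw [h1, h2]
    simp [mul_comm]
  have h := real_inner_mul_inner_self_le (hf.toLp f) (hg.toLp g)
  rw [key hf hg, key hf hf, key hg hg] at h
  simpa only [sq] using h

theorem MemLp.tensor {f : α → ℝ} {g : β → ℝ} (hf : MemLp f 2 μ) (hg : MemLp g 2 ν) :
    MemLp (fun x : α × β => f x.1 * g x.2) 2 (μ.prod ν) := by
  refine (memLp_two_iff_integrable_sq
    (hf.aestronglyMeasurable.comp_fst.mul hg.aestronglyMeasurable.comp_snd)).2 ?_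
  refine (((memLp_two_iff_integrable_sq hf.aestronglyMeasurable).1 hf).mul_prod
    ((memLp_two_iff_integrable_sq hg.aestronglyMeasurable).1 hg)).congr (.of_forall fun x => ?_)
  simp only [Pi.mul_apply]; ring

theorem integrable_kernel_tensor {N : α × β → ℝ} (hN : MemLp N 2 (μ.prod ν)) {f : α → ℝ} {g : β → ℝ}
    (hf : MemLp f 2 μ) (hg : MemLp g 2 ν) :
    Integrable (fun x : α × β => N x * (f x.1 * g x.2)) (μ.prod ν) :=
  hN.integrable_mul (MemLp.tensor hf hg)

/-- The Hilbert-Schmidt bound for the bilinear form of a square-integrable kernel. -/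
theorem sq_integral_kernel_le [SFinite μ] [SFinite ν] {N : α × β → ℝ} (hN : MemLp N 2 (μ.prod ν)) {f : α → ℝ} {g : β → ℝ}
    (hf : MemLp f 2 μ) (hg : MemLp g 2 ν) :
    (∫ x, N x * (f x.1 * g x.2) ∂μ.prod ν) ^ 2
      ≤ (∫ x, N x ^ 2 ∂μ.prod ν) * ((∫ x, f x ^ 2 ∂μ) * ∫ y, g y ^ 2 ∂ν) := by
  refine (sq_integral_mul_le hN (MemLp.tensor hf hg)).trans_eq ?_
  congr 1
  simp only [mul_pow]
  exact integral_prod_mul (fun x => f x ^ 2) (fun y => g y ^ 2)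

end Kernel

/-- The Gaussian weight `exp (-|v|²/8)`. -/
def gaussWeight (v : Vel) : ℝ := Real.exp (-(1 / 8) * ‖v‖ ^ 2)

theorem gaussWeight_pos (v : Vel) : 0 < gaussWeight v := Real.exp_pos _

theorem gaussWeight_sq (v : Vel) : gaussWeight v ^ 2 = Real.exp (-(1 / 4) * ‖v‖ ^ 2) := by
  rw [gaussWeight, ← Real.exp_nat_mul]; congr 1; push_cast; ring

theorem contDiff_gaussWeight : ContDiff ℝ ∞ gaussWeight :=
  (contDiff_const.mul (contDiff_norm_sq ℝ)).exp

@[fun_prop]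
theorem continuous_gaussWeight : Continuous gaussWeight := contDiff_gaussWeight.continuous

theorem exists_sqrtMaxwellian_eq :
    ∃ c, 0 < c ∧ ∀ v, sqrtMaxwellian v = c * gaussWeight v ^ 2 :=
  ⟨Real.sqrt ((2 * Real.pi) ^ (-(3 / 2) : ℝ)), by positivity, fun v => by
    rw [sqrtMaxwellian_eq, gaussWeight_sq]⟩

/-- The coercivity of ā degenerates only like (1+|v|)^γ, and -γ < 3, so a Gaussian times a cubic
polynomial absorbs it. -/
theorem exists_gaussWeight_sq_le {γ : ℝ} (hγ : -3 < γ) (hγ₀ : γ < 0) :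
    ∃ C, 0 < C ∧ ∀ v ξ, gaussWeight v ^ 2 * ‖ξ‖ ^ 2 ≤ C * meanForm γ v ξ ξ := by
  obtain ⟨c, hc, h⟩ := exists_le_meanForm hγ hγ₀
  refine ⟨Real.exp ((3 : ℕ) ^ 2 / (2 * (1 / 4))) / c, by positivity, fun v ξ => ?_⟩
  have h1 := one_add_pow_mul_exp_le (c := 1 / 4) (by norm_num) 3 ‖v‖ (norm_nonneg v)
  set K := Real.exp (((3 : ℕ) : ℝ) ^ 2 / (2 * (1 / 4)))
  have hv : 0 < 1 + ‖v‖ := by positivity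
  have h2 : Real.exp (-(1 / 4 / 2) * ‖v‖ ^ 2) ≤ 1 := Real.exp_le_one_iff.2 (by nlinarith [sq_nonneg ‖v‖])
  have h3 : (1 + ‖v‖) ^ (-γ) ≤ (1 + ‖v‖) ^ 3 := by
    rw [← Real.rpow_natCast]
    exact Real.rpow_le_rpow_of_exponent_le (by linarith [norm_nonneg v]) (by push_cast; linarith)
  have hK : 0 < K := Real.exp_pos _
  have h4 : gaussWeight v ^ 2 ≤ K * (1 + ‖v‖) ^ γ := by
    have h5 : (1 + ‖v‖) ^ (-γ) * gaussWeight v ^ 2 ≤ K := by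
      rw [gaussWeight_sq]
      calc _ ≤ (1 + ‖v‖) ^ 3 * Real.exp (-(1 / 4) * ‖v‖ ^ 2) := by gcongr
        _ ≤ _ := h1
        _ ≤ K * 1 := by gcongr
        _ = K := mul_one K
    rw [Real.rpow_neg hv.le] at h5
    have h6 : 0 < (1 + ‖v‖) ^ γ := by positivity
    rwa [inv_mul_le_iff₀ h6, mul_comm] at h5
  calc _ ≤ K * (1 + ‖v‖) ^ γ * ‖ξ‖ ^ 2 := by gcongr
    _ = K / c * (c * (1 + ‖v‖) ^ γ * ‖ξ‖ ^ 2) := by field_simp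
    _ ≤ _ := by gcongr; exact h v ξ

/-- The components of the collision matrix, damped by Gaussian weights. -/
def dampedKernel (γ : ℝ) (j k : Fin 3) (x : Vel × Vel) : ℝ :=
  collisionForm γ (x.1 - x.2) (basisVec j) (basisVec k) * (gaussWeight x.1 * gaussWeight x.2)

/-- The square of the kernel has the singularity |z|^{2(γ+2)}, and γ > -3 gives 2(γ+2) > -2, well
inside the integrable range in dimension three. -/
theorem memLp_dampedKernel {γ : ℝ} (hγ : -3 < γ) (j k : Fin 3) :
    MemLp (dampedKernel γ j k) 2 (volume : Measure (Vel × Vel)) := by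
  have hm : Measurable (dampedKernel γ j k) :=
    (Measurable.collisionForm γ (measurable_fst.sub measurable_snd) measurable_const
      measurable_const).mul ((continuous_gaussWeight.measurable.comp measurable_fst).mul
        (continuous_gaussWeight.measurable.comp measurable_snd))
  refine (memLp_two_iff_integrable_sq hm.aestronglyMeasurable).2 ?_
  have h1 := (integrable_prod_kernel (s := 2 * (γ + 2)) (c := 1 / 4) (by linarith) (by norm_num) 0
      (h := fun v => gaussWeight v ^ 2) (by fun_prop) ?_).1
  · refine h1.mono' (hm.pow_const 2).aestronglyMeasurable (.of_forall fun x => ?_)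
    rw [Real.norm_of_nonneg (sq_nonneg _), dampedKernel, mul_pow, mul_pow, gaussWeight_sq x.2]
    have h2 := abs_collisionForm_le γ (x.1 - x.2) (basisVec j) (basisVec k)
    rw [norm_basisVec, norm_basisVec, mul_one, mul_one] at h2
    have h3 : (‖x.1 - x.2‖ ^ (γ + 2)) ^ 2 = ‖x.1 - x.2‖ ^ (2 * (γ + 2)) := by
      rw [← Real.rpow_mul_natCast (norm_nonneg _)]; congr 1; push_cast; ring
    rw [← h3, ← sq_abs (collisionForm _ _ _ _), pow_zero, one_mul]
    calc _ ≤ (‖x.1 - x.2‖ ^ (γ + 2)) ^ 2 *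
        (gaussWeight x.1 ^ 2 * Real.exp (-(1 / 4) * ‖x.2‖ ^ 2)) := by gcongr
      _ = _ := by ring
  · obtain ⟨n, hn⟩ := exists_nat_ge (max (2 * (γ + 2)) 0)
    refine (integrable_pow_mul_exp (c := 1 / 4) (by norm_num) n).mono'
      (Measurable.aestronglyMeasurable (by fun_prop)) (.of_forall fun v => ?_)
    rw [gaussWeight_sq, Real.norm_of_nonneg (by positivity), abs_of_pos (Real.exp_pos _), mul_comm]
    gcongr
    rw [← Real.rpow_natCast]
    exact Real.rpow_le_rpow_of_exponent_le (by linarith [norm_nonneg v]) hn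

theorem hasFDerivAt_comp_prodMk_right {E F : Type*} [NormedAddCommGroup E] [NormedSpace ℝ E]
    [NormedAddCommGroup F] [NormedSpace ℝ F] {h : E × F → ℝ} {v : E} {w : F}
    (hh : DifferentiableAt ℝ h (v, w)) : HasFDerivAt (fun w => h (v, w))
      ((fderiv ℝ h (v, w)).comp (ContinuousLinearMap.inr ℝ E F)) w :=
  hh.hasFDerivAt.comp w (hasFDerivAt_prodMk_right v w)

/-- Against a smooth compactly supported kernel the gradient in the twist is moved onto the kernel,
so only the L² norms of f and φ remain. -/
theorem exists_smoothKernel_bound {G : Vel × Vel → ℝ} (hG : ContDiff ℝ ∞ G) (hs : HasCompactSupport G)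
    (k : Fin 3) : ∃ C, 0 ≤ C ∧ ∀ φ, IsTestFunction φ → ∀ f : Vel → ℝ, MemLp f 2 volume →
      (∫ x : Vel × Vel, G x * (f x.1 * (gaussWeight x.2 * twist φ (gradient φ) x.2 k))) ^ 2
        ≤ C * ((∫ v, f v ^ 2) * ∫ v, φ v ^ 2) := by
  set H : Vel × Vel → ℝ := fun x => G x * gaussWeight x.2 with hH
  have hHc : ContDiff ℝ ∞ H := hG.mul (contDiff_gaussWeight.comp contDiff_snd)
  have hHs : HasCompactSupport H := hs.mul_right
  set R : Vel × Vel → ℝ := fun x => H x * (x.2 k / 2) - fderiv ℝ H x (0, basisVec k) with hR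
  have hRc : Continuous R := (hHc.continuous.mul (by fun_prop)).sub
    ((hHc.continuous_fderiv (by simp)).clm_apply continuous_const)
  have hRs : HasCompactSupport R := by
    refine HasCompactSupport.sub (f := fun x => H x * (x.2 k / 2)) hHs.mul_right
      ((hHs.fderiv ℝ).comp_left (g := fun L : Vel × Vel →L[ℝ] ℝ => L (0, basisVec k)) (by simp))
  have hRm : MemLp R 2 ((volume : Measure Vel).prod (volume : Measure Vel)) :=
    hRc.memLp_of_hasCompactSupport (μ := (volume : Measure (Vel × Vel))) hRs
  have hGm : MemLp G 2 ((volume : Measure Vel).prod (volume : Measure Vel)) :=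
    hG.continuous.memLp_of_hasCompactSupport (μ := (volume : Measure (Vel × Vel))) hs
  refine ⟨∫ x, R x ^ 2 ∂(volume : Measure Vel).prod volume, integral_nonneg fun _ => sq_nonneg _,
    fun φ hφ f hf => ?_⟩
  have hφm : MemLp φ 2 volume := hφ.continuous.memLp_of_hasCompactSupport hφ.2
  have htc := continuous_twist_gradient hφ
  have hts := hasCompactSupport_twist_gradient hφ
  have hqm : MemLp (fun w => gaussWeight w * twist φ (gradient φ) w k) 2 volume :=
    Continuous.memLp_of_hasCompactSupport (by fun_prop)
      (HasCompactSupport.mul_left (hts.comp_left (g := fun x : Vel => x k) (by simp)))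
  have i1 := integrable_kernel_tensor hGm hf hqm
  have i2 := integrable_kernel_tensor hRm hf hφm
  refine le_trans (le_of_eq ?_) (sq_integral_kernel_le hRm hf hφm)
  congr 1
  have hφd : Differentiable ℝ φ := hφ.1.differentiable (by simp)
  have hfd : ∀ v w, HasFDerivAt (fun w => H (v, w))
      ((fderiv ℝ H (v, w)).comp (ContinuousLinearMap.inr ℝ Vel Vel)) w := fun v w => by
    exact hasFDerivAt_comp_prodMk_right (hHc.differentiable (by simp) (v, w))
  have hfe : ∀ v w, fderiv ℝ (fun w => H (v, w)) w (basisVec k) = fderiv ℝ H (v, w) (0, basisVec k) :=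
    fun v w => by rw [(hfd v w).fderiv]; simp
  have hfc : ∀ v, Continuous fun w => fderiv ℝ H (v, w) (0, basisVec k) := fun v =>
    ((hHc.continuous_fderiv (by simp)).comp (by fun_prop : Continuous fun w => (v, w))).clm_apply
      continuous_const
  have hHv : ∀ v, Continuous fun w => H (v, w) := fun v =>
    hHc.continuous.comp (by fun_prop : Continuous fun w => (v, w))
  have hdc : Continuous fun w => fderiv ℝ φ w (basisVec k) :=
    (hφ.1.continuous_fderiv (by simp)).clm_apply continuous_const
  have hds : HasCompactSupport fun w => fderiv ℝ φ w (basisVec k) :=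
    (hφ.2.fderiv ℝ).comp_left (g := fun L : Vel →L[ℝ] ℝ => L (basisVec k)) (by simp)
  have hparts : ∀ v, ∫ w, H (v, w) * twist φ (gradient φ) w k = ∫ w, R (v, w) * φ w := fun v => by
    have j1 : Integrable fun w => H (v, w) * fderiv ℝ φ w (basisVec k) :=
      ((hHv v).mul hdc).integrable_of_hasCompactSupport hds.mul_left
    have j2 : Integrable fun w => fderiv ℝ H (v, w) (0, basisVec k) * φ w :=
      ((hfc v).mul hφ.continuous).integrable_of_hasCompactSupport hφ.2.mul_left
    have j3 : Integrable fun w => H (v, w) * φ w :=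
      ((hHv v).mul hφ.continuous).integrable_of_hasCompactSupport hφ.2.mul_left
    have j4 : Integrable fun w => H (v, w) * (w k / 2) * φ w :=
      (((hHv v).mul (by fun_prop)).mul hφ.continuous).integrable_of_hasCompactSupport hφ.2.mul_left
    have h1 := integral_mul_fderiv_eq_neg_fderiv_mul_of_integrable (μ := volume)
      (f := fun w => H (v, w)) (g := φ) (v := basisVec k) (by simpa only [hfe] using j2) j1 j3
      (fun w _ => (hfd v w).differentiableAt) (fun w _ => hφd w)
    simp only [hfe] at h1
    have h2 : ∀ w, H (v, w) * twist φ (gradient φ) w k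
        = H (v, w) * fderiv ℝ φ w (basisVec k) + H (v, w) * (w k / 2) * φ w := fun w => by
      simp only [twist, PiLp.add_apply, PiLp.smul_apply, gradient_apply, dirDeriv, smul_eq_mul]
      ring
    have h3 : ∀ w, R (v, w) * φ w
        = H (v, w) * (w k / 2) * φ w - fderiv ℝ H (v, w) (0, basisVec k) * φ w := fun w => by
      simp only [hR]; ring
    simp only [h2, h3]
    rw [integral_add j1 j4, integral_sub j4 j2, h1]
    ring
  calc _ = ∫ v, ∫ w, G (v, w) * (f v * (gaussWeight w * twist φ (gradient φ) w k)) := integral_prod _ i1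
    _ = ∫ v, ∫ w, R (v, w) * (f v * φ w) := by
        refine integral_congr_ae (.of_forall fun v => ?_)
        have h4 : ∀ w, G (v, w) * (f v * (gaussWeight w * twist φ (gradient φ) w k))
            = f v * (H (v, w) * twist φ (gradient φ) w k) := fun w => by simp only [hH]; ring
        have h5 : ∀ w, R (v, w) * (f v * φ w) = f v * (R (v, w) * φ w) := fun w => by ring
        simp only [h4, h5, integral_const_mul, hparts]
    _ = _ := (integral_prod _ i2).symm

/-- Compactness of the kernel operators, in quantitative form. -/
theorem exists_kernel_small {N : Vel × Vel → ℝ} (hN : MemLp N 2 (volume : Measure (Vel × Vel)))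
    (k : Fin 3) {ε : ℝ} (hε : 0 < ε) : ∃ C, 0 ≤ C ∧ ∀ φ, IsTestFunction φ → ∀ f : Vel → ℝ,
      MemLp f 2 volume →
      |∫ x : Vel × Vel, N x * (f x.1 * (gaussWeight x.2 * twist φ (gradient φ) x.2 k))|
        ≤ ε * ((∫ v, f v ^ 2) + ∫ w, (gaussWeight w * twist φ (gradient φ) w k) ^ 2)
          + C * ∫ v, φ v ^ 2 := by
  -- The kernel is a smooth compactly supported one plus a remainder of L² norm at most ε/2; the
  -- remainder is estimated by the Hilbert-Schmidt bound.
  obtain ⟨G, hGs, hG, hGN⟩ := hN.exist_eLpNorm_sub_le (by simp) (by norm_num) (half_pos hε)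
  obtain ⟨C, hC, hb⟩ := exists_smoothKernel_bound hG hGs k
  have hGm : MemLp G 2 (volume : Measure (Vel × Vel)) := hG.continuous.memLp_of_hasCompactSupport hGs
  have hsub : MemLp (fun x => N x - G x) 2 ((volume : Measure Vel).prod (volume : Measure Vel)) :=
    hN.sub hGm
  have hint : ∫ x, (N x - G x) ^ 2 ∂(volume : Measure Vel).prod volume ≤ (ε / 2) ^ 2 := by
    have h1 : eLpNorm (fun x => N x - G x) 2 ((volume : Measure Vel).prod (volume : Measure Vel))
      ≤ ENNReal.ofReal (ε / 2) := hGN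
    rw [hsub.eLpNorm_eq_integral_rpow_norm (by simp) (by simp)] at h1
    rw [ENNReal.ofReal_le_ofReal_iff (by positivity)] at h1
    have h2 := pow_le_pow_left₀ (by positivity) h1 2
    rw [← Real.rpow_mul_natCast (by positivity)] at h2
    simpa using h2
  -- Weight from the arithmetic-geometric inequality: √(C F P) ≤ (ε/2) F + C/(2ε) P.
  refine ⟨C / (2 * ε), by positivity, fun φ hφ f hf => ?_⟩
  have htc := continuous_twist_gradient hφ
  have hqm : MemLp (fun w => gaussWeight w * twist φ (gradient φ) w k) 2 volume :=
    Continuous.memLp_of_hasCompactSupport (by fun_prop)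
      (HasCompactSupport.mul_left
        ((hasCompactSupport_twist_gradient hφ).comp_left (g := fun x : Vel => x k) (by simp)))
  set q := fun w => gaussWeight w * twist φ (gradient φ) w k with hq
  set F := ∫ v, f v ^ 2
  set Q := ∫ w, q w ^ 2
  set P := ∫ v, φ v ^ 2
  have hF : 0 ≤ F := integral_nonneg fun _ => sq_nonneg _
  have hQ : 0 ≤ Q := integral_nonneg fun _ => sq_nonneg _
  have hP : 0 ≤ P := integral_nonneg fun _ => sq_nonneg _
  have i1 := integrable_kernel_tensor hsub hf hqm
  have i2 := integrable_kernel_tensor (hGm : MemLp G 2 (volume.prod volume)) hf hqm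
  have e : ∫ x : Vel × Vel, N x * (f x.1 * q x.2)
      = (∫ x, (N x - G x) * (f x.1 * q x.2) ∂(volume : Measure Vel).prod volume)
        + ∫ x, G x * (f x.1 * q x.2) ∂(volume : Measure Vel).prod volume := by
    rw [← integral_add i1 i2]
    exact integral_congr_ae (.of_forall fun x => by simp only; ring)
  have b1 := sq_integral_kernel_le hsub hf hqm
  have b2 := hb φ hφ f hf
  have b3 : |∫ x, (N x - G x) * (f x.1 * q x.2) ∂(volume : Measure Vel).prod volume|
      ≤ ε / 2 * (F + Q) := by
    refine abs_le_of_sq_le_sq' ?_ (by positivity) |> abs_le.2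
    refine b1.trans ?_
    calc _ ≤ (ε / 2) ^ 2 * (F * Q) := by gcongr
      _ ≤ (ε / 2) ^ 2 * (F + Q) ^ 2 := by gcongr; nlinarith
      _ = _ := by ring
  have b4 : |∫ x, G x * (f x.1 * q x.2) ∂(volume : Measure Vel).prod volume|
      ≤ ε / 2 * F + C / (2 * ε) * P := by
    refine abs_le_of_sq_le_sq' ?_ (by positivity) |> abs_le.2
    refine le_trans b2 ?_
    have h1 : (ε / 2 * F + C / (2 * ε) * P) ^ 2 - C * (F * P)
        = (ε / 2 * F - C / (2 * ε) * P) ^ 2 := by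
      field_simp; ring
    nlinarith [sq_nonneg (ε / 2 * F - C / (2 * ε) * P)]
  rw [e]
  refine (abs_add_le _ _).trans ((add_le_add b3 b4).trans ?_)
  nlinarith

/-! ### The factorization of the collision form -/

/-- The square root of the collision form, as a field on `ℝ³ × ℝ³`. -/
def lift (γ : ℝ) (p : Vel → Vel) (x : Vel × Vel) : Vel :=
  sqrtMaxwellian x.2 • collisionRoot γ (x.1 - x.2) (p x.1)

theorem inner_lift (γ : ℝ) (p q : Vel → Vel) (x : Vel × Vel) :
    ⟪lift γ p x, lift γ q x⟫ = collisionForm γ (x.1 - x.2) (p x.1) (q x.1) * maxwellian x.2 := by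
  rw [lift, lift, real_inner_smul_left, real_inner_smul_right, inner_collisionRoot,
    ← sqrtMaxwellian_mul_self]
  ring

theorem norm_lift_sq (γ : ℝ) (p : Vel → Vel) (x : Vel × Vel) :
    ‖lift γ p x‖ ^ 2 = collisionForm γ (x.1 - x.2) (p x.1) (p x.1) * maxwellian x.2 := by
  rw [← real_inner_self_eq_norm_sq, inner_lift]

/-- The root is even in z, so exchanging the velocities keeps the matrix and produces the symmetric
damping √μ(v)√μ(w). -/
theorem inner_lift_swap (γ : ℝ) (p q : Vel → Vel) (x : Vel × Vel) :
    ⟪lift γ p x.swap, lift γ q x⟫ = collisionForm γ (x.1 - x.2) (p x.2) (q x.1)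
      * (sqrtMaxwellian x.1 * sqrtMaxwellian x.2) := by
  rw [lift, lift, Prod.fst_swap, Prod.snd_swap, ← neg_sub x.1 x.2, collisionRoot_neg,
    real_inner_smul_left, real_inner_smul_right, inner_collisionRoot]
  ring

theorem lift_add (γ : ℝ) (p q : Vel → Vel) : lift γ (p + q) = lift γ p + lift γ q := by
  ext1 x; simp [lift, collisionRoot_add]

theorem lift_sub (γ : ℝ) (p q : Vel → Vel) : lift γ (p - q) = lift γ p - lift γ q := by
  ext1 x; simp [lift, collisionRoot_sub, smul_sub]

theorem lift_smul (γ : ℝ) (c : ℝ) (p : Vel → Vel) : lift γ (c • p) = c • lift γ p := by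
  ext1 x; simp [lift, collisionRoot_smul, smul_comm c]

theorem Measurable.collisionRoot {α : Type*} [MeasurableSpace α] (γ : ℝ) {z ξ : α → Vel}
    (hz : Measurable z) (hξ : Measurable ξ) : Measurable fun x => Landau.collisionRoot γ (z x) (ξ x) := by
  unfold Landau.collisionRoot; fun_prop

theorem measurable_lift (γ : ℝ) {p : Vel → Vel} (hp : Measurable p) : Measurable (lift γ p) :=
  (measurable_sqrtMaxwellian.comp measurable_snd).smul
    (Measurable.collisionRoot γ (measurable_fst.sub measurable_snd) (hp.comp measurable_fst))

theorem ae_comp_fst {P : Vel → Prop} (h : ∀ᵐ v, P v) : ∀ᵐ x : Vel × Vel, P x.1 :=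
  Measure.quasiMeasurePreserving_fst.ae h

theorem lift_congr (γ : ℝ) {p q : Vel → Vel} (h : p =ᵐ[volume] q) : lift γ p =ᵐ[volume] lift γ q := by
  filter_upwards [ae_comp_fst h] with x hx
  simp only [lift, hx]

theorem aestronglyMeasurable_lift (γ : ℝ) {p : Vel → Vel} (hp : AEStronglyMeasurable p) :
    AEStronglyMeasurable (lift γ p) :=
  (measurable_lift γ hp.stronglyMeasurable_mk.measurable).aestronglyMeasurable.congr
    (lift_congr γ hp.ae_eq_mk.symm)

theorem integral_norm_lift_sq (γ : ℝ) (p : Vel → Vel) (v : Vel) :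
    ∫ w, ‖lift γ p (v, w)‖ ^ 2 = meanForm γ v (p v) (p v) := by
  simp only [norm_lift_sq, meanForm]

theorem lintegral_lift {γ : ℝ} (hγ : -3 < γ) {p : Vel → Vel} (hp : AEStronglyMeasurable p) :
    ∫⁻ x, ‖lift γ p x‖ₑ ^ 2 = ∫⁻ v, ENNReal.ofReal (meanForm γ v (p v) (p v)) := by
  have hm := aestronglyMeasurable_lift γ hp
  calc ∫⁻ x, ‖lift γ p x‖ₑ ^ 2 = ∫⁻ v, ∫⁻ w, ‖lift γ p (v, w)‖ₑ ^ 2 :=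
        lintegral_prod (μ := volume) (ν := volume) _ (hm.enorm.pow_const 2)
    _ = _ := by
        refine lintegral_congr fun v => ?_
        rw [meanForm, ofReal_integral_eq_lintegral_ofReal (integrable_collisionForm hγ _ _ _)
          (.of_forall fun w => mul_nonneg (collisionForm_self_nonneg _ _ _) (maxwellian_pos w).le)]
        refine lintegral_congr fun w => ?_
        rw [← norm_lift_sq γ p (v, w), ENNReal.ofReal_pow (norm_nonneg _), ofReal_norm]

/-- The fields of finite collision energy. -/
def HasFiniteForm (γ : ℝ) (p : Vel → Vel) : Prop :=
  AEStronglyMeasurable p ∧ MemLp (lift γ p) 2 (volume : Measure (Vel × Vel))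

theorem lintegral_enorm_sq_lt_top_iff {α E : Type*} [MeasurableSpace α] [NormedAddCommGroup E]
    {μ : Measure α} {f : α → E} (hf : AEStronglyMeasurable f μ) :
    MemLp f 2 μ ↔ ∫⁻ x, ‖f x‖ₑ ^ 2 ∂μ < ⊤ := by
  have := eLpNorm_lt_top_iff_lintegral_rpow_enorm_lt_top (p := 2) (μ := μ) (f := f) (by simp) (by simp)
  simp only [ENNReal.toReal_ofNat, ENNReal.rpow_ofNat] at this
  rw [← this]
  exact ⟨fun h => h.2, fun h => ⟨hf, h⟩⟩

theorem hasFiniteForm_of_lintegral {γ : ℝ} (hγ : -3 < γ) {p : Vel → Vel} (hp : AEStronglyMeasurable p)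
    (h : ∫⁻ v, ENNReal.ofReal (meanForm γ v (p v) (p v)) < ⊤) : HasFiniteForm γ p := by
  refine ⟨hp, (lintegral_enorm_sq_lt_top_iff (aestronglyMeasurable_lift γ hp)).2 ?_⟩
  rwa [lintegral_lift hγ hp]

theorem hasFiniteForm_of_integrable {γ : ℝ} (hγ : -3 < γ) {p : Vel → Vel} (hp : AEStronglyMeasurable p)
    (h : Integrable fun v => meanForm γ v (p v) (p v)) : HasFiniteForm γ p := by
  refine hasFiniteForm_of_lintegral hγ hp ?_
  rw [← ofReal_integral_eq_lintegral_ofReal h (.of_forall fun v => meanForm_self_nonneg _ _ _)]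
  exact ENNReal.ofReal_lt_top

theorem HasFiniteForm.integrable {γ : ℝ} {p : Vel → Vel} (hp : HasFiniteForm γ p) :
    Integrable fun v => meanForm γ v (p v) (p v) := by
  have h1 := (memLp_two_iff_integrable_sq_norm hp.2.1).1 hp.2
  have h2 := Integrable.integral_prod_left (μ := (volume : Measure Vel)) (ν := (volume : Measure Vel)) h1
  simpa only [integral_norm_lift_sq] using h2

theorem HasFiniteForm.sub {γ : ℝ} {p q : Vel → Vel} (hp : HasFiniteForm γ p) (hq : HasFiniteForm γ q) :
    HasFiniteForm γ (p - q) :=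
  ⟨hp.1.sub hq.1, by rw [lift_sub]; exact hp.2.sub hq.2⟩

theorem hasFiniteForm_of_hasCompactSupport {γ : ℝ} (hγ : -3 < γ) (hγ₀ : γ < 0) {p : Vel → Vel}
    (hp : Continuous p) (hs : HasCompactSupport p) : HasFiniteForm γ p :=
  hasFiniteForm_of_integrable hγ hp.aestronglyMeasurable
    (integrable_meanForm_of_hasCompactSupport hγ hγ₀ hp hs)

theorem IsTestFunction.hasFiniteForm {γ : ℝ} (hγ : -3 < γ) (hγ₀ : γ < 0) {φ : Vel → ℝ}
    (hφ : IsTestFunction φ) : HasFiniteForm γ (twist φ (gradient φ)) :=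
  hasFiniteForm_of_hasCompactSupport hγ hγ₀ (continuous_twist_gradient hφ)
    (hasCompactSupport_twist_gradient hφ)

theorem integral_inner_lift {γ : ℝ} {p q : Vel → Vel} (hp : HasFiniteForm γ p)
    (hq : HasFiniteForm γ q) :
    ∫ x, ⟪lift γ p x, lift γ q x⟫ = ∫ v, meanForm γ v (p v) (q v) := by
  have h : Integrable (fun x : Vel × Vel => ⟪lift γ p x, lift γ q x⟫)
    ((volume : Measure Vel).prod volume) := by
    refine (L2.integrable_inner (𝕜 := ℝ) (hp.2.toLp _) (hq.2.toLp _)).congr ?_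
    filter_upwards [hp.2.coeFn_toLp, hq.2.coeFn_toLp] with x h1 h2
    rw [h1, h2]
  refine (integral_prod _ h).trans ?_
  simp only [inner_lift, meanForm]

/-- The Hilbert space of square-integrable fields on `ℝ³ × ℝ³`. -/
abbrev PairField : Type := Lp Vel 2 (volume : Measure (Vel × Vel))

/-- The isometry exchanging the two velocities. -/
def exchange : PairField →ₗᵢ[ℝ] PairField :=
  Lp.compMeasurePreservingₗᵢ ℝ Prod.swap (Measure.measurePreserving_swap (μ := volume) (ν := volume))

theorem exchange_coeFn (k : PairField) : exchange k =ᵐ[volume] fun x => k x.swap :=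
  Lp.coeFn_compMeasurePreserving k (Measure.measurePreserving_swap (μ := volume) (ν := volume))

theorem ae_swap {P : Vel × Vel → Prop} (h : ∀ᵐ x, P x) : ∀ᵐ x : Vel × Vel, P x.swap :=
  (Measure.measurePreserving_swap (μ := (volume : Measure Vel))
    (ν := (volume : Measure Vel))).quasiMeasurePreserving.ae h

theorem exchange_exchange (k : PairField) : exchange (exchange k) = k := by
  refine Lp.ext ?_
  filter_upwards [exchange_coeFn (exchange k), ae_swap (exchange_coeFn k)] with x h1 h2
  rw [h1, h2, Prod.swap_swap]

/-- The form `⟪k, l⟫ - ⟪σ k, l⟫`, where `σ` exchanges the velocities. -/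
def exchangeForm : PairField →L[ℝ] PairField →L[ℝ] ℝ :=
  innerSL ℝ - (innerSL ℝ).comp exchange.toContinuousLinearMap

theorem exchangeForm_apply (k l : PairField) : exchangeForm k l = ⟪k, l⟫ - ⟪exchange k, l⟫ := rfl

theorem exchangeForm_symm (k l : PairField) : exchangeForm k l = exchangeForm l k := by
  rw [exchangeForm_apply, exchangeForm_apply, real_inner_comm]
  congr 1
  rw [← exchange.inner_map_map (exchange k) l, exchange_exchange, real_inner_comm]

/-- Cauchy-Schwarz with the isometry σ. This is the source of the nonnegativity of 𝓛. -/
theorem exchangeForm_nonneg (k : PairField) : 0 ≤ exchangeForm k k := by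
  rw [exchangeForm_apply, real_inner_self_eq_norm_sq]
  have h := real_inner_le_norm (exchange k) k
  rw [exchange.norm_map] at h
  nlinarith

theorem inner_pairField {k l : PairField} {p q : Vel → Vel} {γ : ℝ} (hp : HasFiniteForm γ p)
    (hq : HasFiniteForm γ q) (hk : k =ᵐ[volume] lift γ p) (hl : l =ᵐ[volume] lift γ q) :
    ⟪k, l⟫ = ∫ v, meanForm γ v (p v) (q v) := by
  rw [← integral_inner_lift hp hq, L2.inner_def]
  refine integral_congr_ae ?_
  filter_upwards [hk, hl] with x h1 h2
  rw [h1, h2]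

theorem inner_exchange {k l : PairField} {p q : Vel → Vel} {γ : ℝ}
    (hk : k =ᵐ[volume] lift γ p) (hl : l =ᵐ[volume] lift γ q) :
    ⟪exchange k, l⟫ = ∫ x : Vel × Vel, collisionForm γ (x.1 - x.2) (p x.2) (q x.1)
      * (sqrtMaxwellian x.1 * sqrtMaxwellian x.2) := by
  rw [L2.inner_def]
  refine integral_congr_ae ?_
  filter_upwards [exchange_coeFn k, ae_swap hk, hl] with x h1 h2 h3
  rw [h1, h2, h3, inner_lift_swap]

theorem HasFiniteForm.exists_weighted {γ : ℝ} (hγ : -3 < γ) (hγ₀ : γ < 0) :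
    ∃ C, 0 < C ∧ ∀ p, HasFiniteForm γ p → ∀ k,
      MemLp (fun v => gaussWeight v * p v k) 2 volume ∧
      ∫ v, (gaussWeight v * p v k) ^ 2 ≤ C * ∫ v, meanForm γ v (p v) (p v) := by
  obtain ⟨C, hC, h⟩ := exists_gaussWeight_sq_le hγ hγ₀
  refine ⟨C, hC, fun p hp k => ?_⟩
  have hb : ∀ v, (gaussWeight v * p v k) ^ 2 ≤ C * meanForm γ v (p v) (p v) := fun v => by
    refine le_trans ?_ (h v (p v))
    rw [mul_pow, ← sq_abs (p v k), ← Real.norm_eq_abs]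
    gcongr
    exact PiLp.norm_apply_le (p v) k
  have hpk : AEStronglyMeasurable fun v => p v k :=
    (by fun_prop : Continuous fun x : Vel => x k).comp_aestronglyMeasurable hp.1
  have hm : AEStronglyMeasurable fun v => gaussWeight v * p v k :=
    AEStronglyMeasurable.mul continuous_gaussWeight.aestronglyMeasurable hpk
  have hi := hp.integrable.const_mul C
  have hsq : Integrable fun v => (gaussWeight v * p v k) ^ 2 := by
    refine hi.mono' (hm.pow 2) (.of_forall fun v => ?_)
    rw [Real.norm_of_nonneg (sq_nonneg _)]
    exact hb v
  refine ⟨(memLp_two_iff_integrable_sq hm).2 hsq, ?_⟩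
  rw [← integral_const_mul]
  exact integral_mono hsq hi hb

/-- The exchange term is a finite sum of square-integrable kernels acting on weighted components of
the twisted gradient; each is small in the energy up to a multiple of ‖φ‖². -/
theorem exists_exchange_le {γ : ℝ} (hγ : -3 < γ) (hγ₀ : γ < 0) :
    ∃ C, 0 ≤ C ∧ ∀ φ, IsTestFunction φ → ∀ k : PairField,
      k =ᵐ[volume] lift γ (twist φ (gradient φ)) →
      |⟪exchange k, k⟫| ≤ 1 / 2 * ‖k‖ ^ 2 + C * ∫ v, φ v ^ 2 := by
  obtain ⟨C₁, hC₁, hw⟩ := HasFiniteForm.exists_weighted hγ hγ₀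
  obtain ⟨c, hc, hsm⟩ := exists_sqrtMaxwellian_eq
  -- There are nine index pairs, each contributing 2 C₁ E ε, times c² from the two factors √μ; the
  -- total is ½E.
  set ε := 1 / (2 * (18 * C₁ * c ^ 2)) with hε
  have hε0 : 0 < ε := by positivity
  choose C₂ hC₂ hb using fun (i : Fin 3 × Fin 3) =>
    exists_kernel_small (memLp_dampedKernel hγ i.1 i.2) i.2 hε0
  refine ⟨c ^ 2 * ∑ i, C₂ i, mul_nonneg (by positivity) (Finset.sum_nonneg fun i _ => hC₂ i),
    fun φ hφ k hk => ?_⟩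
  have hp := hφ.hasFiniteForm hγ hγ₀
  set p := twist φ (gradient φ) with hpdef
  set q : Fin 3 → Vel → ℝ := fun j v => gaussWeight v * p v j with hq
  set E := ∫ v, meanForm γ v (p v) (p v) with hE
  have hkE : ‖k‖ ^ 2 = E := by rw [← real_inner_self_eq_norm_sq, inner_pairField hp hp hk hk]
  have e : ∀ x : Vel × Vel, collisionForm γ (x.1 - x.2) (p x.2) (p x.1)
      * (sqrtMaxwellian x.1 * sqrtMaxwellian x.2)
      = ∑ i : Fin 3 × Fin 3, c ^ 2 * (dampedKernel γ i.1 i.2 x * (q i.1 x.1 * q i.2 x.2)) := fun x => by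
    rw [collisionForm_comm, collisionForm_eq_sum, hsm, hsm, Fintype.sum_prod_type, Finset.sum_mul]
    refine Finset.sum_congr rfl fun i _ => ?_
    rw [Finset.sum_mul]
    refine Finset.sum_congr rfl fun j _ => ?_
    rw [dampedKernel, ← collisionMatrix_eq_form]
    simp only [hq]
    ring
  have hi : ∀ i : Fin 3 × Fin 3, Integrable fun x : Vel × Vel =>
      dampedKernel γ i.1 i.2 x * (q i.1 x.1 * q i.2 x.2) := fun i =>
    integrable_kernel_tensor (μ := volume) (ν := volume) (memLp_dampedKernel hγ i.1 i.2)
      (hw p hp i.1).1 (hw p hp i.2).1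
  rw [inner_exchange hk hk]
  simp only [e]
  rw [integral_finsetSum _ fun i _ => (hi i).const_mul _]
  simp only [integral_const_mul, ← Finset.mul_sum]
  rw [abs_mul, abs_of_pos (by positivity : 0 < c ^ 2)]
  have hle : ∀ i : Fin 3 × Fin 3, |∫ x : Vel × Vel, dampedKernel γ i.1 i.2 x * (q i.1 x.1 * q i.2 x.2)|
      ≤ ε * (C₁ * E + C₁ * E) + C₂ i * ∫ v, φ v ^ 2 := fun i => by
    refine (hb i φ hφ (q i.1) (hw p hp i.1).1).trans ?_
    gcongr
    · exact (hw p hp i.1).2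
    · exact (hw p hp i.2).2
  calc _ ≤ c ^ 2 * ∑ i : Fin 3 × Fin 3, (ε * (C₁ * E + C₁ * E) + C₂ i * ∫ v, φ v ^ 2) := by
        gcongr
        exact (Finset.abs_sum_le_sum_abs _ _).trans (Finset.sum_le_sum fun i _ => hle i)
    _ = _ := by
        have h1 : ∑ i, C₂ i * ∫ v, φ v ^ 2 = (∑ i, C₂ i) * ∫ v, φ v ^ 2 := (Finset.sum_mul ..).symm
        rw [Finset.sum_add_distrib, h1, hkE]
        simp only [Finset.sum_const, Finset.card_univ, Fintype.card_prod, Fintype.card_fin, hε]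
        simp only [nsmul_eq_mul]
        push_cast
        field_simp
        ring

/-! ### Weak gradients -/

theorem integrable_mul_of_hasCompactSupport {u h : Vel → ℝ} (hu : LocallyIntegrable u)
    (hc : Continuous h) (hs : HasCompactSupport h) : Integrable fun v => u v * h v := by
  simpa only [smul_eq_mul, mul_comm] using hu.integrable_smul_left_of_hasCompactSupport hc hs

theorem LocallyIntegrable.coord {p : Vel → Vel} (hp : LocallyIntegrable p) (j : Fin 3) :
    LocallyIntegrable fun v => p v j := by
  intro x
  obtain ⟨s, hs, h⟩ := hp x
  exact ⟨s, hs, (EuclideanSpace.proj j : Vel →L[ℝ] ℝ).integrable_comp h⟩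

theorem IsWeakGradient.unique {u : Vel → ℝ} {p q : Vel → Vel} (hp : IsWeakGradient u p)
    (hq : IsWeakGradient u q) : p =ᵐ[volume] q := by
  have h : ∀ j : Fin 3, ∀ᵐ v, p v j - q v j = 0 := fun j => by
    refine ae_eq_zero_of_integral_contDiff_smul_eq_zero
      ((LocallyIntegrable.coord hp.2.1 j).sub (LocallyIntegrable.coord hq.2.1 j)) fun φ hφ hs => ?_
    have h1 := hp.2.2 φ ⟨hφ, hs⟩ j
    rw [hq.2.2 φ ⟨hφ, hs⟩ j, neg_inj] at h1
    have i1 := integrable_mul_of_hasCompactSupport (LocallyIntegrable.coord hp.2.1 j) hφ.continuous hs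
    have i2 := integrable_mul_of_hasCompactSupport (LocallyIntegrable.coord hq.2.1 j) hφ.continuous hs
    have h2 : ∀ v, φ v • (p v j - q v j) = p v j * φ v - q v j * φ v := fun v => by
      rw [smul_eq_mul]; ring
    simp only [h2]
    rw [integral_sub i1 i2, h1, sub_self]
  filter_upwards [ae_all_iff.2 h] with v hv
  ext j
  exact sub_eq_zero.1 (hv j)

theorem HasWeakGradient.isWeakGradient {u : Vel → ℝ} (h : HasWeakGradient u) :
    IsWeakGradient u (weakGrad u) := by
  rw [weakGrad, dif_pos h]; exact h.choose_spec

theorem IsWeakGradient.weakGrad_ae_eq {u : Vel → ℝ} {p : Vel → Vel} (h : IsWeakGradient u p) :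
    weakGrad u =ᵐ[volume] p :=
  (HasWeakGradient.isWeakGradient ⟨p, h⟩).unique h

theorem locallyIntegrable_congr {E : Type*} [NormedAddCommGroup E] {f g : Vel → E}
    (h : f =ᵐ[volume] g) (hf : LocallyIntegrable f) : LocallyIntegrable g := fun x => by
  obtain ⟨s, hs, hi⟩ := hf x
  exact ⟨s, hs, hi.congr (ae_restrict_of_ae h)⟩

theorem IsWeakGradient.congr {u u' : Vel → ℝ} {p p' : Vel → Vel} (h : IsWeakGradient u p)
    (hu : u =ᵐ[volume] u') (hp : p =ᵐ[volume] p') : IsWeakGradient u' p' := by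
  refine ⟨locallyIntegrable_congr hu h.1, locallyIntegrable_congr hp h.2.1, fun φ hφ j => ?_⟩
  have h1 : ∫ v, u' v * dirDeriv (basisVec j) φ v = ∫ v, u v * dirDeriv (basisVec j) φ v :=
    integral_congr_ae (by filter_upwards [hu] with v hv; rw [hv])
  have h2 : ∫ v, p' v j * φ v = ∫ v, p v j * φ v :=
    integral_congr_ae (by filter_upwards [hp] with v hv; rw [hv])
  rw [h1, h2, h.2.2 φ hφ j]

theorem continuous_dirDeriv {φ : Vel → ℝ} (hφ : ContDiff ℝ ∞ φ) (e : Vel) :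
    Continuous (dirDeriv e φ) :=
  (hφ.continuous_fderiv (by simp)).clm_apply continuous_const

theorem hasCompactSupport_dirDeriv {φ : Vel → ℝ} (hφ : HasCompactSupport φ) (e : Vel) :
    HasCompactSupport (dirDeriv e φ) :=
  (hφ.fderiv ℝ).comp_left (g := fun L : Vel →L[ℝ] ℝ => L e) (by simp)

theorem isWeakGradient_of_contDiff {u : Vel → ℝ} (hu : ContDiff ℝ ∞ u) :
    IsWeakGradient u (gradient u) := by
  refine ⟨hu.continuous.locallyIntegrable, (continuous_gradient hu).locallyIntegrable,
    fun φ hφ j => ?_⟩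
  have hd := continuous_dirDeriv hu (basisVec j)
  simp only [gradient_apply]
  exact integral_mul_fderiv_eq_neg_fderiv_mul_of_integrable
    (integrable_mul_of_hasCompactSupport hd.locallyIntegrable hφ.continuous hφ.2)
    (integrable_mul_of_hasCompactSupport hu.continuous.locallyIntegrable
      (continuous_dirDeriv hφ.1 _) (hasCompactSupport_dirDeriv hφ.2 _))
    (integrable_mul_of_hasCompactSupport hu.continuous.locallyIntegrable hφ.continuous hφ.2)
    (fun v _ => hu.differentiable (by simp) v) (fun v _ => hφ.1.differentiable (by simp) v)

theorem LocallyIntegrable.continuous_smul {E : Type*} [NormedAddCommGroup E] [NormedSpace ℝ E]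
    {χ : Vel → ℝ} {u : Vel → E} (hu : LocallyIntegrable u) (hχ : Continuous χ) :
    LocallyIntegrable fun v => χ v • u v := by
  rw [locallyIntegrable_iff] at hu ⊢
  exact fun K hK => (hu K hK).continuousOn_smul hχ.continuousOn hK

theorem LocallyIntegrable.smul_continuous {E : Type*} [NormedAddCommGroup E] [NormedSpace ℝ E]
    {χ : Vel → E} {u : Vel → ℝ} (hu : LocallyIntegrable u) (hχ : Continuous χ) :
    LocallyIntegrable fun v => u v • χ v := by
  rw [locallyIntegrable_iff] at hu ⊢
  exact fun K hK => (hu K hK).smul_continuousOn hχ.continuousOn hK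

theorem IsWeakGradient.contDiff_mul {u χ : Vel → ℝ} {p : Vel → Vel} (hχ : ContDiff ℝ ∞ χ)
    (h : IsWeakGradient u p) :
    IsWeakGradient (fun v => χ v * u v) (fun v => χ v • p v + u v • gradient χ v) := by
  have hgc := continuous_gradient hχ
  refine ⟨LocallyIntegrable.continuous_smul h.1 hχ.continuous,
    (LocallyIntegrable.continuous_smul h.2.1 hχ.continuous).add
      (LocallyIntegrable.smul_continuous h.1 hgc), fun φ hφ j => ?_⟩
  have hχφ : IsTestFunction fun v => χ v * φ v := ⟨hχ.mul hφ.1, hφ.2.mul_left⟩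
  have hd : ∀ v, dirDeriv (basisVec j) (fun v => χ v * φ v) v
      = χ v * dirDeriv (basisVec j) φ v + φ v * dirDeriv (basisVec j) χ v := fun v => by
    simp only [dirDeriv]
    rw [fderiv_fun_mul (hχ.differentiable (by simp) v) (hφ.1.differentiable (by simp) v)]
    simp
  have h1 := h.2.2 _ hχφ j
  have hdc := continuous_dirDeriv hχ (basisVec j)
  have i1 : Integrable fun v => u v * (χ v * dirDeriv (basisVec j) φ v) :=
    integrable_mul_of_hasCompactSupport h.1 (hχ.continuous.mul (continuous_dirDeriv hφ.1 _))
      (hasCompactSupport_dirDeriv hφ.2 _).mul_left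
  have i2 : Integrable fun v => u v * (φ v * dirDeriv (basisVec j) χ v) :=
    integrable_mul_of_hasCompactSupport h.1 (hφ.continuous.mul hdc) hφ.2.mul_right
  have i3 : Integrable fun v => p v j * (χ v * φ v) :=
    integrable_mul_of_hasCompactSupport (LocallyIntegrable.coord h.2.1 j) hχφ.continuous hχφ.2
  simp only [hd, mul_add] at h1
  rw [integral_add i1 i2] at h1
  have e1 : ∀ v, χ v * u v * dirDeriv (basisVec j) φ v = u v * (χ v * dirDeriv (basisVec j) φ v) :=
    fun v => by ring
  have e2 : ∀ v, (χ v • p v + u v • gradient χ v) j * φ v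
      = p v j * (χ v * φ v) + u v * (φ v * dirDeriv (basisVec j) χ v) := fun v => by
    simp only [PiLp.add_apply, PiLp.smul_apply, smul_eq_mul, gradient_apply]; ring
  simp only [e1, e2]
  rw [integral_add i3 i2]
  linarith

theorem gradient_sqrtMaxwellian (v : Vel) :
    gradient sqrtMaxwellian v = (-(1 / 2) * sqrtMaxwellian v) • v := by
  refine ext_inner_right ℝ fun e => ?_
  rw [inner_gradient, fderiv_sqrtMaxwellian, real_inner_smul_left]
  ring

theorem gradient_maxwellian (v : Vel) : gradient maxwellian v = (-maxwellian v) • v := by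
  refine ext_inner_right ℝ fun e => ?_
  rw [inner_gradient, fderiv_maxwellian, real_inner_smul_left]
  ring

/-- `∇(√μ u) = √μ (p - v u / 2)`. -/
theorem IsWeakGradient.sqrtMaxwellian_mul {u : Vel → ℝ} {p : Vel → Vel} (h : IsWeakGradient u p) :
    weakGrad (fun v => sqrtMaxwellian v * u v)
      =ᵐ[volume] fun v => sqrtMaxwellian v • (p v - (u v / 2) • v) := by
  refine (h.contDiff_mul contDiff_sqrtMaxwellian).weakGrad_ae_eq.trans (.of_forall fun v => ?_)
  simp only [gradient_sqrtMaxwellian]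
  module

theorem weakGrad_maxwellian :
    weakGrad (fun v => sqrtMaxwellian v * sqrtMaxwellian v)
      =ᵐ[volume] fun v => (-maxwellian v) • v := by
  have e : (fun v => sqrtMaxwellian v * sqrtMaxwellian v) = maxwellian :=
    funext sqrtMaxwellian_mul_self
  rw [e]
  exact (isWeakGradient_of_contDiff contDiff_maxwellian).weakGrad_ae_eq.trans
    (.of_forall gradient_maxwellian)

theorem dirDeriv_inv_sqrtMaxwellian_mul {φ : Vel → ℝ} (hφ : IsTestFunction φ) (j : Fin 3) (v : Vel) :
    dirDeriv (basisVec j) (fun v => (sqrtMaxwellian v)⁻¹ * φ v) v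
      = (sqrtMaxwellian v)⁻¹ * twist φ (gradient φ) v j := by
  have h0 := (sqrtMaxwellian_pos v).ne'
  have hd : DifferentiableAt ℝ sqrtMaxwellian v := contDiff_sqrtMaxwellian.differentiable (by simp) v
  have h1 : HasFDerivAt (fun v => (sqrtMaxwellian v)⁻¹) _ v := 
    (hasDerivAt_inv h0).comp_hasFDerivAt v hd.hasFDerivAt
  have h2 := (h1.mul (hφ.1.differentiable (by simp) v).hasFDerivAt).fderiv
  rw [dirDeriv]
  erw [h2]
  simp only [twist, PiLp.add_apply, PiLp.smul_apply, gradient_apply, dirDeriv, smul_eq_mul,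
    add_apply, smul_apply, fderiv_sqrtMaxwellian, real_inner_comm (basisVec j), inner_basisVec]
  field_simp

/-! ### The weak form of the linearized operator -/

theorem collisionForm_smul_right (γ : ℝ) (z ξ η : Vel) (c : ℝ) :
    collisionForm γ z ξ (c • η) = c * collisionForm γ z ξ η := by
  simp only [collisionForm, real_inner_smul_right]; ring

theorem sum_collisionMatrix_mul (γ : ℝ) (j : Fin 3) (z η : Vel) :
    ∑ k, collisionMatrix γ j k z * η k = collisionForm γ z (basisVec j) η := by
  rw [collisionForm_eq_sum]
  symm
  rw [Finset.sum_eq_single j]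
  · exact Finset.sum_congr rfl fun k _ => by simp [basisVec]
  · intro b _ hb; simp [basisVec, hb]
  · simp

theorem abs_coord_le (w : Vel) (k : Fin 3) : |w k| ≤ (1 + ‖w‖) ^ 1 := by
  have h : ‖w k‖ ≤ ‖w‖ := PiLp.norm_apply_le w k
  rw [Real.norm_eq_abs] at h
  rw [pow_one]; linarith

/-- The flux of `Q(μ, √μ u)`. -/
theorem collisionFlux_maxwellian {γ : ℝ} (hγ : -3 < γ) {u : Vel → ℝ} {p : Vel → Vel}
    (h : IsWeakGradient u p) (j : Fin 3) :
    ∀ᵐ v, collisionFlux γ (fun v => sqrtMaxwellian v * sqrtMaxwellian v)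
      (fun v => sqrtMaxwellian v * u v) j v
        = sqrtMaxwellian v * meanForm γ v (twist u p v) (basisVec j) := by
  filter_upwards [h.sqrtMaxwellian_mul] with v hv
  have e : ∀ k, ∫ w, collisionMatrix γ j k (v - w) *
      (sqrtMaxwellian w * sqrtMaxwellian w * weakGrad (fun v => sqrtMaxwellian v * u v) v k
        - weakGrad (fun v => sqrtMaxwellian v * sqrtMaxwellian v) w k * (sqrtMaxwellian v * u v))
      = ∫ w, sqrtMaxwellian v * (collisionMatrix γ j k (v - w) * (p v - (u v / 2) • v) k * maxwellian w
        + u v * (collisionMatrix γ j k (v - w) * (w k * maxwellian w))) := fun k => by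
    refine integral_congr_ae ?_
    filter_upwards [weakGrad_maxwellian] with w hw
    rw [hv, hw, sqrtMaxwellian_mul_self]
    simp only [PiLp.smul_apply, smul_eq_mul]
    ring
  have i1 : ∀ k, Integrable fun w => collisionMatrix γ j k (v - w) * (p v - (u v / 2) • v) k
      * maxwellian w := fun k => by
    refine ((integrable_collisionForm hγ v (basisVec j) (basisVec k)).mul_const
      ((p v - (u v / 2) • v) k)).congr (.of_forall fun w => ?_)
    simp only [collisionMatrix_eq_form]; ring
  have i2 : ∀ k, Integrable fun w => u v * (collisionMatrix γ j k (v - w) * (w k * maxwellian w)) :=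
    fun k => by
      simp only [collisionMatrix_eq_form]
      exact (integrable_collisionForm_mul (C := 1) (N := 1) (h := fun w => w k) hγ
        (Continuous.aestronglyMeasurable (by fun_prop))
        (fun w => by rw [one_mul]; exact abs_coord_le w k) v _ _).const_mul _
  rw [collisionFlux]
  simp only [e, integral_const_mul]
  have i3 : ∀ k, Integrable fun w => collisionMatrix γ j k (v - w) * (p v - (u v / 2) • v) k
      * maxwellian w + u v * (collisionMatrix γ j k (v - w) * (w k * maxwellian w)) :=
    fun k => (i1 k).add (i2 k)
  rw [← Finset.mul_sum, ← integral_finsetSum _ fun k _ => i3 k, meanForm]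
  congr 1
  refine integral_congr_ae (.of_forall fun w => ?_)
  have h1 : ∀ k, collisionMatrix γ j k (v - w) * (p v - (u v / 2) • v) k * maxwellian w
      + u v * (collisionMatrix γ j k (v - w) * (w k * maxwellian w))
      = collisionMatrix γ j k (v - w) * (p v - (u v / 2) • v + u v • w) k * maxwellian w := fun k => by
    simp only [PiLp.add_apply, PiLp.smul_apply, smul_eq_mul]; ring
  simp only [h1]
  -- a(v-w)w = a(v-w)v turns -u v/2 + u w into +u v/2, which is the twisted gradient.
  rw [← Finset.sum_mul, sum_collisionMatrix_mul, collisionForm_add_right, collisionForm_smul_right,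
    collisionForm_comm γ _ (basisVec j) w, collisionForm_sub_left, collisionForm_comm γ _ v,
    ← collisionForm_smul_right, ← collisionForm_add_right, collisionForm_comm]
  congr 2
  rw [twist]; module

theorem exists_weight_le : ∃ C, 0 < C ∧ ∀ w : Vel, gaussWeight w * (1 + ‖w‖) ^ 1 ≤ C := by
  refine ⟨Real.exp ((1 : ℕ) ^ 2 / (2 * (1 / 8))), Real.exp_pos _, fun w => ?_⟩
  have h1 := one_add_pow_mul_exp_le (c := 1 / 8) (by norm_num) 1 ‖w‖ (norm_nonneg w)
  have h2 : Real.exp (-(1 / 8 / 2) * ‖w‖ ^ 2) ≤ 1 :=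
    Real.exp_le_one_iff.2 (by nlinarith [sq_nonneg ‖w‖])
  rw [gaussWeight, mul_comm]
  refine h1.trans ?_
  calc _ ≤ Real.exp (((1 : ℕ) : ℝ) ^ 2 / (2 * (1 / 8))) * 1 := by gcongr
    _ = _ := mul_one _

theorem memLp_weight_mul {u h : Vel → ℝ} (hu : MemLp u 2 volume) (hh : Continuous h)
    (hb : ∀ w, |h w| ≤ (1 + ‖w‖) ^ 1) : MemLp (fun w => gaussWeight w * (h w * u w)) 2 volume := by
  obtain ⟨C, hC, hw⟩ := exists_weight_le
  refine hu.of_le_mul (c := C) ((continuous_gaussWeight.aestronglyMeasurable).mul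
    (hh.aestronglyMeasurable.mul hu.1)) (.of_forall fun w => ?_)
  rw [norm_mul, norm_mul, Real.norm_of_nonneg (gaussWeight_pos w).le, ← mul_assoc]
  gcongr
  refine le_trans ?_ (hw w)
  have := (gaussWeight_pos w).le
  gcongr
  exact hb w

/-- Fubini's theorem for the damped kernel gives integrability for almost every v, which suffices to
split the flux integral. -/
theorem integrable_matrix_mul {γ : ℝ} (hγ : -3 < γ) {g : Vel → ℝ}
    (hg : MemLp (fun w => gaussWeight w * g w) 2 volume) (j k : Fin 3) :
    ∀ᵐ v, Integrable fun w => collisionMatrix γ j k (v - w) * (sqrtMaxwellian w * g w) := by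
  obtain ⟨c, hc, hs⟩ := exists_sqrtMaxwellian_eq
  have hf : MemLp gaussWeight 2 volume := by
    refine (memLp_two_iff_integrable_sq (by fun_prop)).2 ?_
    simp only [gaussWeight_sq]
    exact integrable_exp_neg_mul_sq (by norm_num)
  have h := integrable_kernel_tensor (μ := volume) (ν := volume) (memLp_dampedKernel hγ j k) hf hg
  filter_upwards [h.prod_right_ae] with v hv
  have h0 := (gaussWeight_pos v).ne'
  refine (hv.const_mul (c / gaussWeight v ^ 2)).congr (.of_forall fun w => ?_)
  simp only [dampedKernel, hs, collisionMatrix_eq_form]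
  field_simp

/-- The flux of `Q(√μ u, μ)`. -/
theorem collisionFlux_sqrtMaxwellian {γ : ℝ} (hγ : -3 < γ) (hγ₀ : γ < 0) {u : Vel → ℝ} {p : Vel → Vel}
    (h : IsWeakGradient u p) (hu : MemLp u 2 volume) (hp : HasFiniteForm γ (twist u p)) (j : Fin 3) :
    ∀ᵐ v, collisionFlux γ (fun v => sqrtMaxwellian v * u v)
      (fun v => sqrtMaxwellian v * sqrtMaxwellian v) j v
        = -(maxwellian v * ∫ w, collisionForm γ (v - w) (basisVec j) (twist u p w)
          * sqrtMaxwellian w) := by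
  obtain ⟨C, hC, hw⟩ := HasFiniteForm.exists_weighted hγ hγ₀
  have hu1 := memLp_weight_mul (h := fun _ => 1) hu continuous_const
    (fun w => by rw [abs_one, pow_one]; linarith [norm_nonneg w])
  simp only [one_mul] at hu1
  have hu2 := fun k : Fin 3 => memLp_weight_mul (h := fun w => w k) hu (by fun_prop)
    (fun w => abs_coord_le w k)
  have a1 := ae_all_iff.2 fun k => integrable_matrix_mul hγ (hw _ hp k).1 j k
  have a2 := ae_all_iff.2 fun k => integrable_matrix_mul hγ hu1 j k
  have a3 := ae_all_iff.2 fun k => integrable_matrix_mul hγ (hu2 k) j k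
  filter_upwards [weakGrad_maxwellian, a1, a2, a3] with v hv b1 b2 b3
  have e : ∀ k, ∫ w, collisionMatrix γ j k (v - w) *
      (sqrtMaxwellian w * u w * weakGrad (fun v => sqrtMaxwellian v * sqrtMaxwellian v) v k
        - weakGrad (fun v => sqrtMaxwellian v * u v) w k * (sqrtMaxwellian v * sqrtMaxwellian v))
      = ∫ w, -maxwellian v * (collisionMatrix γ j k (v - w) * (sqrtMaxwellian w * twist u p w k)
        + v k * (collisionMatrix γ j k (v - w) * (sqrtMaxwellian w * u w))
        - collisionMatrix γ j k (v - w) * (sqrtMaxwellian w * (w k * u w))) := fun k => by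
    refine integral_congr_ae ?_
    filter_upwards [h.sqrtMaxwellian_mul] with w hw
    rw [hv, hw, sqrtMaxwellian_mul_self]
    simp only [twist, PiLp.smul_apply, PiLp.add_apply, PiLp.sub_apply, smul_eq_mul]
    ring
  rw [collisionFlux]
  simp only [e, integral_const_mul]
  have b4 : ∀ k, Integrable fun w => collisionMatrix γ j k (v - w) * (sqrtMaxwellian w * twist u p w k)
        + v k * (collisionMatrix γ j k (v - w) * (sqrtMaxwellian w * u w))
        - collisionMatrix γ j k (v - w) * (sqrtMaxwellian w * (w k * u w)) :=
    fun k => ((b1 k).add ((b2 k).const_mul _)).sub (b3 k)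
  rw [← Finset.mul_sum, ← integral_finsetSum _ fun k _ => b4 k, neg_mul]
  congr 2
  refine integral_congr_ae (.of_forall fun w => ?_)
  have h1 : ∀ k, collisionMatrix γ j k (v - w) * (sqrtMaxwellian w * twist u p w k)
        + v k * (collisionMatrix γ j k (v - w) * (sqrtMaxwellian w * u w))
        - collisionMatrix γ j k (v - w) * (sqrtMaxwellian w * (w k * u w))
      = sqrtMaxwellian w * (collisionMatrix γ j k (v - w) * (twist u p w + u w • (v - w)) k) :=
    fun k => by
      simp only [PiLp.add_apply, PiLp.smul_apply, PiLp.sub_apply, smul_eq_mul]; ring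
  simp only [h1]
  -- The surplus u(w)(v - w) lies in the kernel of a(v - w).
  rw [← Finset.mul_sum, sum_collisionMatrix_mul, collisionForm_add_right, collisionForm_smul_right,
    collisionForm_comm γ _ _ (v - w), collisionForm_self_left]
  ring

/-- The weak form of 𝓛 is a sum over flux components; splitting the test field along the basis
allows each component to be identified with one inner product. -/
theorem exists_coordinate_fields {γ : ℝ} (hγ : -3 < γ) (hγ₀ : γ < 0) {P : Vel → Vel}
    (hPc : Continuous P) (hPs : HasCompactSupport P) {l : PairField} (hl : l =ᵐ[volume] lift γ P) :
    ∃ L : Fin 3 → PairField, (∀ j, HasFiniteForm γ (fun v => P v j • basisVec j)) ∧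
      (∀ j, L j =ᵐ[volume] lift γ (fun v => P v j • basisVec j)) ∧ l = ∑ j, L j := by
  have hqf : ∀ j : Fin 3, HasFiniteForm γ (fun v => P v j • basisVec j) := fun j =>
    hasFiniteForm_of_hasCompactSupport hγ hγ₀ (by fun_prop)
      (HasCompactSupport.smul_right (f := fun v => P v j) (f' := fun _ => basisVec j)
        (hPs.comp_left (g := fun x : Vel => x j) (by simp)))
  choose L hL using fun j : Fin 3 => (⟨(hqf j).2.toLp _, (hqf j).2.coeFn_toLp⟩ :
    ∃ L : PairField, L =ᵐ[volume] lift γ (fun v => P v j • basisVec j))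
  refine ⟨L, hqf, hL, Lp.ext ?_⟩
  rw [Fin.sum_univ_three]
  filter_upwards [hl, Lp.coeFn_add (L 0 + L 1) (L 2), Lp.coeFn_add (L 0) (L 1), hL 0, hL 1, hL 2]
    with x h1 h2 h3 h4 h5 h6
  rw [h1, h2, Pi.add_apply, h3, Pi.add_apply, h4, h5, h6]
  simp only [lift, ← smul_add, ← collisionRoot_add]
  congr 2
  ext i
  fin_cases i <;> simp [basisVec]

theorem integral_flux_maxwellian {γ : ℝ} (hγ : -3 < γ) {u : Vel → ℝ} {p P : Vel → Vel}
    (h : IsWeakGradient u p) (hp : HasFiniteForm γ (twist u p)) {j : Fin 3}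
    (hq : HasFiniteForm γ (fun v => P v j • basisVec j)) {k L : PairField}
    (hk : k =ᵐ[volume] lift γ (twist u p)) (hL : L =ᵐ[volume] lift γ (fun v => P v j • basisVec j)) :
    ∫ v, collisionFlux γ (fun v => sqrtMaxwellian v * sqrtMaxwellian v)
      (fun v => sqrtMaxwellian v * u v) j v * ((sqrtMaxwellian v)⁻¹ * P v j) = ⟪k, L⟫ := by
  rw [inner_pairField hp hq hk hL]
  refine integral_congr_ae ?_
  filter_upwards [collisionFlux_maxwellian hγ h j] with v hv
  have h0 := (sqrtMaxwellian_pos v).ne'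
  have h2 : meanForm γ v (twist u p v) (P v j • basisVec j)
      = P v j * meanForm γ v (twist u p v) (basisVec j) := by
    simp only [meanForm, collisionForm_smul_right, mul_assoc, integral_const_mul]
  rw [hv, h2]
  field_simp

theorem integral_flux_sqrtMaxwellian {γ : ℝ} (hγ : -3 < γ) (hγ₀ : γ < 0) {u : Vel → ℝ}
    {p P : Vel → Vel} (h : IsWeakGradient u p) (hu : MemLp u 2 volume)
    (hp : HasFiniteForm γ (twist u p)) {j : Fin 3} {k L : PairField}
    (hk : k =ᵐ[volume] lift γ (twist u p)) (hL : L =ᵐ[volume] lift γ (fun v => P v j • basisVec j)) :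
    ∫ v, collisionFlux γ (fun v => sqrtMaxwellian v * u v)
      (fun v => sqrtMaxwellian v * sqrtMaxwellian v) j v * ((sqrtMaxwellian v)⁻¹ * P v j)
        = -⟪exchange k, L⟫ := by
  have hi : Integrable (fun x : Vel × Vel => collisionForm γ (x.1 - x.2) (twist u p x.2)
      (P x.1 j • basisVec j) * (sqrtMaxwellian x.1 * sqrtMaxwellian x.2))
      ((volume : Measure Vel).prod volume) := by
    refine (L2.integrable_inner (𝕜 := ℝ) (exchange k) L).congr ?_
    filter_upwards [exchange_coeFn k, ae_swap hk, hL] with x h1 h2 h3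
    rw [h1, h2, h3, inner_lift_swap]
  have hI := integral_prod _ hi
  rw [inner_exchange hk hL]
  refine Eq.trans ?_ (congrArg Neg.neg hI).symm
  rw [← integral_neg]
  refine integral_congr_ae ?_
  filter_upwards [collisionFlux_sqrtMaxwellian hγ hγ₀ h hu hp j] with v hv
  have h0 := (sqrtMaxwellian_pos v).ne'
  rw [hv, ← sqrtMaxwellian_mul_self]
  have h1 : ∀ w, collisionForm γ (v - w) (twist u p w) (P v j • basisVec j)
      * (sqrtMaxwellian v * sqrtMaxwellian w) = (P v j * sqrtMaxwellian v) *
      (collisionForm γ (v - w) (basisVec j) (twist u p w) * sqrtMaxwellian w) := fun w => by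
    rw [collisionForm_smul_right, collisionForm_comm]; ring
  simp only [h1, integral_const_mul]
  field_simp

/-- The weak form of `𝓛` is the exchange form of the factorized fields. -/
theorem linearPairing_eq {γ : ℝ} (hγ : -3 < γ) (hγ₀ : γ < 0) {u : Vel → ℝ} {p : Vel → Vel}
    (h : IsWeakGradient u p) (hu : MemLp u 2 volume) (hp : HasFiniteForm γ (twist u p))
    {φ : Vel → ℝ} (hφ : IsTestFunction φ) {k l : PairField} (hk : k =ᵐ[volume] lift γ (twist u p))
    (hl : l =ᵐ[volume] lift γ (twist φ (gradient φ))) :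
    linearPairing γ u φ = exchangeForm k l := by
  obtain ⟨L, hqf, hL, hsum⟩ := exists_coordinate_fields hγ hγ₀ (continuous_twist_gradient hφ)
    (hasCompactSupport_twist_gradient hφ) hl
  have hinner : ∀ k' : PairField, ⟪k', l⟫ = ∑ j, ⟪k', L j⟫ := fun k' => by rw [hsum, inner_sum]
  rw [linearPairing, exchangeForm_apply, sub_eq_add_neg, hinner, hinner, ← Finset.sum_neg_distrib]
  simp only [gammaPairing, collisionPairing, neg_neg, dirDeriv_inv_sqrtMaxwellian_mul hφ,
    integral_flux_maxwellian hγ h hp (hqf _) hk (hL _),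
    integral_flux_sqrtMaxwellian hγ hγ₀ h hu hp hk (hL _)]

/-! ### Mollification -/

theorem eLpNorm_two_sq {α E : Type*} [MeasurableSpace α] [NormedAddCommGroup E] {μ : Measure α}
    (f : α → E) : eLpNorm f 2 μ ^ 2 = ∫⁻ x, ‖f x‖ₑ ^ 2 ∂μ := by
  have h := eLpNorm_nnreal_pow_eq_lintegral (p := 2) (μ := μ) (f := f) (by simp)
  simpa using h

theorem sq_lintegral_le_measure_mul {α : Type*} [MeasurableSpace α] {ν : Measure α}
    {g : α → ℝ≥0∞} (hg : AEMeasurable g ν) : (∫⁻ x, g x ∂ν) ^ 2 ≤ ν univ * ∫⁻ x, g x ^ 2 ∂ν := by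
  have h := ENNReal.lintegral_mul_le_Lp_mul_Lq ν (p := 2) (q := 2)
    (Real.holderConjugate_iff.2 ⟨by norm_num, by norm_num⟩) (aemeasurable_const (b := 1)) hg
  simp only [Pi.mul_apply, one_mul, lintegral_const, ENNReal.rpow_ofNat, one_pow] at h
  calc _ ≤ (ν univ ^ (1 / 2 : ℝ) * (∫⁻ x, g x ^ 2 ∂ν) ^ (1 / 2 : ℝ)) ^ 2 := by gcongr
    _ = _ := by
      rw [mul_pow, ← ENNReal.rpow_natCast, ← ENNReal.rpow_mul, ← ENNReal.rpow_natCast,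
        ← ENNReal.rpow_mul]
      norm_num

section Mollify

variable {E : Type*} [NormedAddCommGroup E]

theorem tendsto_lintegral_translate {f : Vel → E} (hf : MemLp f 2 volume) :
    Tendsto (fun y => ∫⁻ v, ‖f (v - y) - f v‖ₑ ^ 2) (𝓝 0) (𝓝 0) := by
  set g : Vel → C(Vel, Vel) := fun y => ⟨fun v => v - y, by fun_prop⟩ with hg
  have hgc : Continuous g := ContinuousMap.continuous_of_continuous_uncurry _
    (by simp only [hg]; exact (continuous_snd.sub continuous_fst))
  have hgm : ∀ y, MeasurePreserving (g y) volume volume := fun y => measurePreserving_sub_right volume y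
  have h1 := Filter.Tendsto.compMeasurePreservingLp (tendsto_const_nhds (x := hf.toLp f))
    (hgc.tendsto 0) hgm (hgm 0) (by simp)
  have h2 := (tendsto_iff_edist_tendsto_0.1 h1)
  have h3 := ENNReal.Tendsto.pow (n := 2) h2
  simp only [ne_eq, OfNat.ofNat_ne_zero, not_false_eq_true, zero_pow] at h3
  refine h3.congr fun y => ?_
  rw [edist_eq_enorm_sub, Lp.enorm_def, eLpNorm_two_sq]
  refine lintegral_congr_ae ?_
  have e := fun y => (Lp.coeFn_compMeasurePreserving (hf.toLp f) (hgm y)).trans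
    ((hgm y).quasiMeasurePreserving.ae_eq_comp hf.coeFn_toLp)
  filter_upwards [Lp.coeFn_sub (Lp.compMeasurePreserving (g y) (hgm y) (hf.toLp f))
    (Lp.compMeasurePreserving (g 0) (hgm 0) (hf.toLp f)), e y, e 0] with v a b c
  rw [a, Pi.sub_apply, b, c]
  simp [hg]

/-- A nonnegative continuous weight of total mass one, supported in the ball of radius `r`. -/
structure IsMollifier (ρ : Vel → ℝ) (r : ℝ) : Prop where
  contDiff : ContDiff ℝ ∞ ρ
  nonneg : ∀ y, 0 ≤ ρ y
  hasCompactSupport : HasCompactSupport ρ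
  integral_eq : ∫ y, ρ y = 1
  eq_zero : ∀ y, r ≤ ‖y‖ → ρ y = 0

theorem exists_isMollifier {r : ℝ} (hr : 0 < r) : ∃ ρ, IsMollifier ρ r := by
  set b : ContDiffBump (0 : Vel) := ⟨r / 2, r, by positivity, by linarith⟩
  refine ⟨b.normed volume, b.contDiff_normed, b.nonneg_normed, b.hasCompactSupport_normed,
    b.integral_normed, fun y hy => ?_⟩
  have h : y ∉ Function.support (b.normed volume) := by
    rw [b.support_normed_eq]; simpa [b] using hy
  simpa using h

theorem LocallyIntegrable.comp_sub_left {f : Vel → E} (hf : LocallyIntegrable f) (v : Vel) :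
    LocallyIntegrable fun y => f (v - y) := by
  rw [locallyIntegrable_iff] at hf ⊢
  intro K hK
  have hc : Continuous fun y => v - y := by fun_prop
  have h := hf _ (hK.image hc)
  have hmp : MeasurePreserving (fun y => v - y) volume volume :=
    Measure.measurePreserving_sub_left volume v
  have h2 := (hmp.integrableOn_comp_preimage (Homeomorph.subLeft v).measurableEmbedding
    (f := f) (s := (fun y => v - y) '' K)).2 h
  exact h2.mono_set (subset_preimage_image _ K)

variable [NormedSpace ℝ E]

theorem IsMollifier.integrable_smul {ρ : Vel → ℝ} {r : ℝ} (hρ : IsMollifier ρ r) {f : Vel → E}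
    (hf : LocallyIntegrable f) (v : Vel) : Integrable fun y => ρ y • f (v - y) :=
  (LocallyIntegrable.comp_sub_left hf v).integrable_smul_left_of_hasCompactSupport
    hρ.contDiff.continuous hρ.hasCompactSupport

/-- The weight defines a probability measure, so Cauchy-Schwarz bounds the squared average by the
average of squares, and exchanging the integrals leaves only translation differences with |y| < r.
-/
theorem IsMollifier.lintegral_sub_le [CompleteSpace E] {ρ : Vel → ℝ} {r : ℝ} (hρ : IsMollifier ρ r)
    {f : Vel → E} (hfm : StronglyMeasurable f) (hf : LocallyIntegrable f) {ε : ℝ≥0∞}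
    (h : ∀ y, ‖y‖ < r → ∫⁻ v, ‖f (v - y) - f v‖ₑ ^ 2 ≤ ε) :
    ∫⁻ v, ‖(∫ y, ρ y • f (v - y)) - f v‖ₑ ^ 2 ≤ ε := by
  have hρc := hρ.contDiff.continuous
  have hρi : Integrable ρ := hρc.integrable_of_hasCompactSupport hρ.hasCompactSupport
  have hρm : Measurable fun y => ENNReal.ofReal (ρ y) := hρc.measurable.ennreal_ofReal
  set ν : Measure Vel := volume.withDensity fun y => ENNReal.ofReal (ρ y) with hν
  have hνp : IsProbabilityMeasure ν := ⟨by
    rw [hν, withDensity_apply _ MeasurableSet.univ, Measure.restrict_univ,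
      ← ofReal_integral_eq_lintegral_ofReal hρi (.of_forall hρ.nonneg), hρ.integral_eq,
      ENNReal.ofReal_one]⟩
  have hm2 : StronglyMeasurable fun x : Vel × Vel => f (x.1 - x.2) - f x.1 :=
    (hfm.comp_measurable (measurable_fst.sub measurable_snd)).sub (hfm.comp_measurable measurable_fst)
  have hm : ∀ v, Measurable fun y => ‖f (v - y) - f v‖ₑ := fun v =>
    (hm2.comp_measurable measurable_prodMk_left).enorm
  calc ∫⁻ v, ‖(∫ y, ρ y • f (v - y)) - f v‖ₑ ^ 2
      ≤ ∫⁻ v, ∫⁻ y, ‖f (v - y) - f v‖ₑ ^ 2 ∂ν := by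
        refine lintegral_mono fun v => ?_
        have e : (∫ y, ρ y • f (v - y)) - f v = ∫ y, ρ y • (f (v - y) - f v) := by
          simp only [smul_sub]
          rw [integral_sub (hρ.integrable_smul hf v) (hρi.smul_const (f v)), integral_smul_const,
            hρ.integral_eq, one_smul]
        rw [e]
        calc _ ≤ (∫⁻ y, ‖ρ y • (f (v - y) - f v)‖ₑ) ^ 2 := by
              gcongr; exact enorm_integral_le_lintegral_enorm _
          _ = (∫⁻ y, ‖f (v - y) - f v‖ₑ ∂ν) ^ 2 := by
              rw [hν, lintegral_withDensity_eq_lintegral_mul _ hρm (hm v)]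
              congr 1
              refine lintegral_congr fun y => ?_
              rw [enorm_smul, Real.enorm_of_nonneg (hρ.nonneg y), Pi.mul_apply]
          _ ≤ _ := (sq_lintegral_le_measure_mul (hm v).aemeasurable).trans_eq (by rw [measure_univ, one_mul])
    _ = ∫⁻ y, (∫⁻ v, ‖f (v - y) - f v‖ₑ ^ 2) ∂ν := by
        refine lintegral_lintegral_swap (Measurable.aemeasurable ?_)
        exact hm2.enorm.pow_const 2
    _ ≤ ∫⁻ _, ε ∂ν := by
        refine lintegral_mono_ae ?_
        rw [hν, ae_withDensity_iff hρm]
        refine .of_forall fun y hy => h y ?_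
        by_contra hr
        exact hy (by rw [hρ.eq_zero y (not_lt.1 hr), ENNReal.ofReal_zero])
    _ = ε := by simp

end Mollify

theorem IsMollifier.gradient_convolution {ρ : Vel → ℝ} {r : ℝ} (hρ : IsMollifier ρ r) {u : Vel → ℝ}
    {p : Vel → Vel} (h : IsWeakGradient u p) :
    ContDiff ℝ ∞ (fun v => ∫ y, ρ y • u (v - y)) ∧
      ∀ v, gradient (fun v => ∫ y, ρ y • u (v - y)) v = ∫ y, ρ y • p (v - y) := by
  set L : ℝ →L[ℝ] ℝ →L[ℝ] ℝ := ContinuousLinearMap.lsmul ℝ ℝ with hL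
  have hconv : (fun v => ∫ y, ρ y • u (v - y)) = convolution ρ u L volume := rfl
  refine ⟨hconv ▸ hρ.hasCompactSupport.contDiff_convolution_left L hρ.contDiff h.1, fun v => ?_⟩
  have hd := hρ.hasCompactSupport.hasFDerivAt_convolution_left L (hρ.contDiff.of_le (by simp)) h.1 v
  have hρ' : Continuous (fderiv ℝ ρ) := hρ.contDiff.continuous_fderiv (by simp)
  have hex := (hρ.hasCompactSupport.fderiv ℝ).convolutionExists_left (L.precompL Vel) hρ' h.1 v
  ext j
  have e1 : gradient (fun v => ∫ y, ρ y • u (v - y)) v j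
      = ∫ y, dirDeriv (basisVec j) ρ y * u (v - y) := by
    rw [gradient_apply, dirDeriv, hconv, hd.fderiv]
    exact ContinuousLinearMap.integral_apply hex (basisVec j)
  have e2 : (∫ y, ρ y • p (v - y)) j = ∫ y, ρ y * p (v - y) j := by
    have h1 := (EuclideanSpace.proj j : Vel →L[ℝ] ℝ).integral_comp_comm
      (hρ.integrable_smul h.2.1 v)
    simpa using h1.symm
  have hcd : ContDiff ℝ ∞ fun y => ρ (v - y) := hρ.contDiff.comp (contDiff_const.sub contDiff_id)
  have hφ : IsTestFunction fun y => ρ (v - y) :=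
    ⟨hcd, hρ.hasCompactSupport.comp_homeomorph (Homeomorph.subLeft v)⟩
  have hdd : ∀ y, dirDeriv (basisVec j) (fun y => ρ (v - y)) y = -dirDeriv (basisVec j) ρ (v - y) :=
    fun y => by
      have h1 : HasFDerivAt (fun y => ρ (v - y)) _ y := HasFDerivAt.comp (g := ρ) y
        (hρ.contDiff.differentiable (by simp) (v - y)).hasFDerivAt ((hasFDerivAt_id y).const_sub v)
      rw [dirDeriv, dirDeriv, h1.fderiv]
      simp
  have h2 := h.2.2 _ hφ j
  simp only [hdd] at h2
  rw [e1, e2, ← integral_sub_left_eq_self (fun y => dirDeriv (basisVec j) ρ y * u (v - y)) volume v,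
    ← integral_sub_left_eq_self (fun y => ρ y * p (v - y) j) volume v]
  simp only [sub_sub_cancel, mul_neg, integral_neg, neg_inj] at h2 ⊢
  simpa only [mul_comm] using h2

/-! ### The energy space -/

theorem twist_add (u₁ u₂ : Vel → ℝ) (p₁ p₂ : Vel → Vel) :
    twist (u₁ + u₂) (p₁ + p₂) = twist u₁ p₁ + twist u₂ p₂ := by
  ext1 v; simp only [twist, Pi.add_apply]; module

theorem twist_smul (c : ℝ) (u : Vel → ℝ) (p : Vel → Vel) :
    twist (c • u) (c • p) = c • twist u p := by
  ext1 v; simp only [twist, Pi.smul_apply, smul_eq_mul]; module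

theorem gradient_add {φ ψ : Vel → ℝ} (hφ : ContDiff ℝ ∞ φ) (hψ : ContDiff ℝ ∞ ψ) :
    gradient (φ + ψ) = gradient φ + gradient ψ := by
  ext1 v
  refine ext_inner_right ℝ fun e => ?_
  rw [Pi.add_apply, inner_add_left, inner_gradient, inner_gradient, inner_gradient,
    fderiv_add (hφ.differentiable (by simp) v) (hψ.differentiable (by simp) v)]
  rfl

theorem gradient_const_smul {φ : Vel → ℝ} (hφ : ContDiff ℝ ∞ φ) (c : ℝ) :
    gradient (c • φ) = c • gradient φ := by
  ext1 v
  refine ext_inner_right ℝ fun e => ?_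
  rw [Pi.smul_apply, real_inner_smul_left, inner_gradient, inner_gradient,
    fderiv_const_smul (hφ.differentiable (by simp) v)]
  rfl

/-- The Hilbert space containing the pairs `(u, S u)`. -/
abbrev EnergyAmbient : Type := WithLp 2 (L2Vel × PairField)

/-- `Φ = (u, S p)`, where `p` plays the part of the gradient of `u`. -/
def IsPair (γ : ℝ) (Φ : EnergyAmbient) (u : Vel → ℝ) (p : Vel → Vel) : Prop :=
  Φ.fst =ᵐ[volume] u ∧ Φ.snd =ᵐ[volume] lift γ (twist u p)

/-- The pairs `(φ, S φ)` of test functions. -/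
def testPairs (γ : ℝ) : Submodule ℝ EnergyAmbient where
  carrier := {Φ | ∃ φ, IsTestFunction φ ∧ IsPair γ Φ φ (gradient φ)}
  zero_mem' := by
    refine ⟨0, ⟨contDiff_const, HasCompactSupport.zero⟩, Lp.coeFn_zero .., ?_⟩
    refine (Lp.coeFn_zero ..).trans (.of_forall fun x => ?_)
    have h : gradient (0 : Vel → ℝ) x.1 = 0 :=
      ext_inner_right ℝ fun e => by rw [inner_gradient]; simp
    simp [lift, twist, h, collisionRoot]
  add_mem' := by
    rintro Φ Ψ ⟨φ, hφ, h1, h2⟩ ⟨ψ, hψ, h3, h4⟩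
    refine ⟨φ + ψ, ⟨hφ.1.add hψ.1, hφ.2.add hψ.2⟩, (Lp.coeFn_add ..).trans (h1.add h3), ?_⟩
    rw [gradient_add hφ.1 hψ.1, twist_add, lift_add]
    exact (Lp.coeFn_add ..).trans (h2.add h4)
  smul_mem' := by
    rintro c Φ ⟨φ, hφ, h1, h2⟩
    refine ⟨c • φ, ⟨contDiff_const.smul hφ.1, hφ.2.smul_left (f := fun _ => c)⟩,
      (Lp.coeFn_smul ..).trans (h1.const_smul c), ?_⟩
    rw [gradient_const_smul hφ.1, twist_smul, lift_smul]
    exact (Lp.coeFn_smul ..).trans (h2.const_smul c)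

/-- The energy space: the closure of the pairs `(φ, S φ)`. -/
def energySpace (γ : ℝ) : Submodule ℝ EnergyAmbient := (testPairs γ).topologicalClosure

theorem tendsto_of_isPair {γ : ℝ} (hγ : -3 < γ) {Φ : ℕ → EnergyAmbient} {Ψ : EnergyAmbient}
    {u : ℕ → Vel → ℝ} {p : ℕ → Vel → Vel} {u' : Vel → ℝ} {p' : Vel → Vel}
    (hΦ : ∀ n, IsPair γ (Φ n) (u n) (p n)) (hΨ : IsPair γ Ψ u' p')
    (hm : ∀ n, AEStronglyMeasurable (twist (u n) (p n))) (hm' : AEStronglyMeasurable (twist u' p'))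
    (h1 : Tendsto (fun n => ∫⁻ v, ‖u n v - u' v‖ₑ ^ 2) atTop (𝓝 0))
    (h2 : Tendsto (fun n => ∫⁻ v, ENNReal.ofReal (meanForm γ v (twist (u n) (p n) v - twist u' p' v)
      (twist (u n) (p n) v - twist u' p' v))) atTop (𝓝 0)) :
    Tendsto Φ atTop (𝓝 Ψ) := by
  have hsq : ∀ {a : ℕ → ℝ≥0∞}, Tendsto (fun n => a n ^ 2) atTop (𝓝 0) → Tendsto a atTop (𝓝 0) := by
    intro a ha
    have := ((ENNReal.continuous_rpow_const (y := 1 / 2)).tendsto 0).comp ha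
    rw [ENNReal.zero_rpow_of_pos (by norm_num)] at this
    refine this.congr fun n => ?_
    rw [Function.comp_apply, ← ENNReal.rpow_natCast, ← ENNReal.rpow_mul]
    norm_num
  have t1 : Tendsto (fun n => (Φ n).fst) atTop (𝓝 Ψ.fst) := by
    refine tendsto_iff_edist_tendsto_0.2 (hsq (h1.congr fun n => ?_))
    rw [edist_eq_enorm_sub, Lp.enorm_def, eLpNorm_two_sq]
    refine lintegral_congr_ae ?_
    filter_upwards [Lp.coeFn_sub (Φ n).fst Ψ.fst, (hΦ n).1, hΨ.1] with v a b c
    rw [a, Pi.sub_apply, b, c]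
  have t2 : Tendsto (fun n => (Φ n).snd) atTop (𝓝 Ψ.snd) := by
    refine tendsto_iff_edist_tendsto_0.2 (hsq (h2.congr fun n => ?_))
    rw [edist_eq_enorm_sub, Lp.enorm_def, eLpNorm_two_sq]
    refine (lintegral_lift hγ ((hm n).sub hm')).symm.trans (lintegral_congr_ae ?_)
    filter_upwards [Lp.coeFn_sub (Φ n).snd Ψ.snd, (hΦ n).2, hΨ.2] with v a b c
    rw [a, Pi.sub_apply, b, c, lift_sub, Pi.sub_apply]
  exact ((WithLp.prod_continuous_toLp 2 L2Vel PairField).tendsto _).comp (t1.prodMk_nhds t2)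

theorem meanForm_add_le {γ : ℝ} (hγ : -3 < γ) (v ξ η : Vel) :
    meanForm γ v (ξ + η) (ξ + η) ≤ 2 * meanForm γ v ξ ξ + 2 * meanForm γ v η η := by
  have h1 := meanForm_add_smul hγ v ξ η 1
  have h2 := abs_meanForm_le hγ v ξ η
  have h3 := le_abs_self (meanForm γ v ξ η)
  rw [one_smul] at h1
  rw [h1]; linarith

theorem meanForm_smul (γ : ℝ) (v ξ η : Vel) (c : ℝ) :
    meanForm γ v (c • ξ) (c • η) = c ^ 2 * meanForm γ v ξ η := by
  simp only [meanForm, ← integral_const_mul]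
  refine integral_congr_ae (.of_forall fun w => ?_)
  simp only [collisionForm, real_inner_smul_left, real_inner_smul_right]
  ring

theorem tendsto_mollify {E : Type*} [NormedAddCommGroup E] [NormedSpace ℝ E] [CompleteSpace E]
    {ρ : ℕ → Vel → ℝ} (hρ : ∀ n : ℕ, IsMollifier (ρ n) (1 / ((n : ℝ) + 1))) {f : Vel → E}
    (hfm : StronglyMeasurable f) (hf : MemLp f 2 volume) :
    Tendsto (fun n => ∫⁻ v, ‖(∫ y, ρ n y • f (v - y)) - f v‖ₑ ^ 2) atTop (𝓝 0) := by
  refine ENNReal.tendsto_nhds_zero.2 fun ε hε => ?_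
  have h1 := ENNReal.tendsto_nhds_zero.1 (tendsto_lintegral_translate hf) ε hε
  obtain ⟨δ, hδ, h2⟩ := Metric.eventually_nhds_iff.1 h1
  filter_upwards [(tendsto_one_div_add_atTop_nhds_zero_nat (𝕜 := ℝ)).eventually_lt_const hδ] with n hn
  refine (hρ n).lintegral_sub_le hfm (hf.locallyIntegrable (by norm_num)) fun y hy => h2 ?_
  rw [dist_zero_right]; linarith

/-- On a fixed ball ā is bounded, so L² convergence of the mollified function and gradient forces
convergence of the pairs. -/
theorem mem_energySpace_of_compact {γ : ℝ} (hγ : -3 < γ) (hγ₀ : γ < 0) {Φ : EnergyAmbient}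
    {u : Vel → ℝ} {p : Vel → Vel} (h : IsWeakGradient u p) (hum : StronglyMeasurable u)
    (hpm : StronglyMeasurable p) (hu : MemLp u 2 volume) (hp : MemLp p 2 volume) {R : ℝ} (hR : 0 < R)
    (hu0 : ∀ v, R ≤ ‖v‖ → u v = 0) (hp0 : ∀ v, R ≤ ‖v‖ → p v = 0) (hΦ : IsPair γ Φ u p) :
    Φ ∈ energySpace γ := by
  choose ρ hρ using fun n : ℕ => exists_isMollifier (r := 1 / ((n : ℝ) + 1)) (by positivity)
  set φ : ℕ → Vel → ℝ := fun n v => ∫ y, ρ n y • u (v - y) with hφdef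
  have hg := fun n => (hρ n).gradient_convolution h
  have hout : ∀ (n : ℕ) (v y : Vel), R + 1 ≤ ‖v‖ → ‖y‖ < 1 / ((n : ℝ) + 1) → R ≤ ‖v - y‖ := by
    intro n v y hv hy
    have h1 : 1 / ((n : ℝ) + 1) ≤ 1 := by rw [div_le_one (by positivity)]; linarith [n.cast_nonneg (α := ℝ)]
    have := norm_sub_norm_le v y
    linarith
  have hφ0 : ∀ n v, R + 1 ≤ ‖v‖ → φ n v = 0 := fun n v hv => by
    refine integral_eq_zero_of_ae (.of_forall fun y => ?_)
    rcases lt_or_ge ‖y‖ (1 / ((n : ℝ) + 1)) with hy | hy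
    · simp [hu0 _ (hout n v y hv hy)]
    · simp [(hρ n).eq_zero y hy]
  have hgφ0 : ∀ n v, R + 1 ≤ ‖v‖ → gradient (φ n) v = 0 := fun n v hv => by
    rw [(hg n).2 v]
    refine integral_eq_zero_of_ae (.of_forall fun y => ?_)
    rcases lt_or_ge ‖y‖ (1 / ((n : ℝ) + 1)) with hy | hy
    · simp [hp0 _ (hout n v y hv hy)]
    · simp [(hρ n).eq_zero y hy]
  have hφ : ∀ n, IsTestFunction (φ n) := fun n => by
    refine ⟨(hg n).1, HasCompactSupport.intro (isCompact_closedBall 0 (R + 1)) fun v hv => hφ0 n v ?_⟩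
    simp only [Metric.mem_closedBall, dist_zero_right, not_le] at hv
    exact hv.le
  have hT := fun n => (hφ n).hasFiniteForm hγ hγ₀
  have hφL : ∀ n, MemLp (φ n) 2 volume := fun n =>
    (hφ n).continuous.memLp_of_hasCompactSupport (hφ n).2
  set Ψ : ℕ → EnergyAmbient := fun n =>
    WithLp.toLp 2 ((hφL n).toLp _, (hT n).2.toLp _) with hΨ
  have hΨp : ∀ n, IsPair γ (Ψ n) (φ n) (gradient (φ n)) := fun n =>
    ⟨(hφL n).coeFn_toLp, (hT n).2.coeFn_toLp⟩
  have c1 := tendsto_mollify hρ hum hu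
  have c2 := tendsto_mollify hρ hpm hp
  refine (Submodule.isClosed_topologicalClosure _).mem_of_tendsto (f := Ψ) (b := atTop) ?_
    (.of_forall fun n => Submodule.le_topologicalClosure _ ⟨φ n, hφ n, hΨp n⟩)
  have hum' : AEStronglyMeasurable u := hum.aestronglyMeasurable
  have htm : AEStronglyMeasurable (twist u p) :=
    hpm.aestronglyMeasurable.add (AEStronglyMeasurable.smul (f := fun v => u v / 2)
      (hum.measurable.div_const 2).aestronglyMeasurable continuous_id.aestronglyMeasurable)
  refine tendsto_of_isPair hγ hΨp hΦ (fun n => (hT n).1) htm c1 ?_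
  obtain ⟨C, hC, hb⟩ := exists_meanForm_le hγ hγ₀
  -- The mollified functions vanish outside radius R + 1, hence 1 + |v| ≤ R + 2 and the twist term
  -- costs at most a factor (R + 1)/2.
  set K : ℝ := C * (R + 2) ^ 2 * (2 + 2 * ((R + 1) / 2) ^ 2) with hK
  have hK0 : 0 ≤ K := by positivity
  have hle : ∀ n v, ENNReal.ofReal (meanForm γ v (twist (φ n) (gradient (φ n)) v - twist u p v)
      (twist (φ n) (gradient (φ n)) v - twist u p v)) ≤ ENNReal.ofReal K *
        (‖(∫ y, ρ n y • p (v - y)) - p v‖ₑ ^ 2 + ‖φ n v - u v‖ₑ ^ 2) := by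
    intro n v
    have e : twist (φ n) (gradient (φ n)) v - twist u p v
        = (gradient (φ n) v - p v) + ((φ n v - u v) / 2) • v := by
      simp only [twist]; module
    rcases le_or_gt (R + 1) ‖v‖ with hv | hv
    · rw [e, hφ0 n v hv, hgφ0 n v hv, hu0 v (by linarith), hp0 v (by linarith)]
      simp [meanForm, collisionForm]
    · rw [e, ← (hg n).2 v, ← ofReal_norm, ← ofReal_norm, ← ENNReal.ofReal_pow (norm_nonneg _),
        ← ENNReal.ofReal_pow (norm_nonneg _), ← ENNReal.ofReal_add (by positivity) (by positivity),
        ← ENNReal.ofReal_mul hK0]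
      refine ENNReal.ofReal_le_ofReal ((hb v _).trans ?_)
      set a := ‖gradient (φ n) v - p v‖
      set b := ‖φ n v - u v‖ with hbdef
      have n1 : ‖(gradient (φ n) v - p v) + ((φ n v - u v) / 2) • v‖ ≤ a + (R + 1) / 2 * b := by
        refine (norm_add_le _ _).trans ?_
        rw [norm_smul, norm_div, ← hbdef, Real.norm_of_nonneg (zero_le_two (α := ℝ))]
        have : b / 2 * ‖v‖ ≤ b / 2 * (R + 1) := by gcongr
        linarith
      have ha : 0 ≤ a := norm_nonneg _
      have hb0 : 0 ≤ b := norm_nonneg _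
      calc _ ≤ C * (R + 2) ^ 2 * (a + (R + 1) / 2 * b) ^ 2 := by
            have h1 : (1 + ‖v‖) ^ 2 ≤ (R + 2) ^ 2 :=
              pow_le_pow_left₀ (by positivity) (by linarith) 2
            gcongr
        _ ≤ C * (R + 2) ^ 2 * ((2 + 2 * ((R + 1) / 2) ^ 2) * (a ^ 2 + b ^ 2)) := by
            gcongr
            nlinarith [sq_nonneg (a - (R + 1) / 2 * b), sq_nonneg ((R + 1) / 2 * a), sq_nonneg b]
        _ = _ := by rw [hK]; ring
  have c3 := ENNReal.Tendsto.const_mul (a := ENNReal.ofReal K) (c2.add c1) (Or.inr ENNReal.ofReal_ne_top)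
  rw [add_zero, mul_zero] at c3
  refine tendsto_of_tendsto_of_tendsto_of_le_of_le tendsto_const_nhds c3 (fun _ => zero_le) fun n => ?_
  calc _ ≤ ∫⁻ v, ENNReal.ofReal K *
        (‖(∫ y, ρ n y • p (v - y)) - p v‖ₑ ^ 2 + ‖φ n v - u v‖ₑ ^ 2) := lintegral_mono (hle n)
    _ = _ := by
        rw [lintegral_const_mul' _ _ ENNReal.ofReal_ne_top, lintegral_add_right']
        exact ((hφ n).continuous.aestronglyMeasurable.sub hum').enorm.pow_const 2

/-! ### Truncation -/

/-- Dilations of one bump. Their gradients live where |v| is comparable to n and have size 1/n, so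
(1+|v|)|∇χ| stays bounded, which exactly offsets the growth ā ≤ C(1+|v|)². -/
theorem exists_cutoff : ∃ (χ : ℕ → Vel → ℝ) (M : ℝ), 0 < M ∧ ∀ n : ℕ, ContDiff ℝ ∞ (χ n) ∧
    (∀ v, ‖v‖ < n + 1 → χ n v = 1 ∧ gradient (χ n) v = 0) ∧
    (∀ v, 2 * ((n : ℝ) + 2) ≤ ‖v‖ → χ n v = 0 ∧ gradient (χ n) v = 0) ∧
    (∀ v, 0 ≤ χ n v ∧ χ n v ≤ 1) ∧ ∀ v, (1 + ‖v‖) * ‖gradient (χ n) v‖ ≤ M := by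
  set b : ContDiffBump (0 : Vel) := ⟨1, 2, by norm_num, by norm_num⟩ with hb
  obtain ⟨M, hM⟩ := (continuous_gradient b.contDiff).bounded_above_of_compact_support
    (hasCompactSupport_gradient b.hasCompactSupport)
  have hM0 : 0 ≤ M := (norm_nonneg _).trans (hM 0)
  set χ : ℕ → Vel → ℝ := fun n v => b (((n : ℝ) + 1)⁻¹ • v) with hχ
  have hn0 : ∀ n : ℕ, 0 < (n : ℝ) + 1 := fun n => by positivity
  have hgrad : ∀ n v, gradient (χ n) v = ((n : ℝ) + 1)⁻¹ • gradient b (((n : ℝ) + 1)⁻¹ • v) := by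
    intro n v
    refine ext_inner_right ℝ fun e => ?_
    have h1 : HasFDerivAt (χ n) _ v := HasFDerivAt.comp (g := b) v
      (b.contDiff.differentiable (n := ∞) (by simp) (((n : ℝ) + 1)⁻¹ • v)).hasFDerivAt
      ((hasFDerivAt_id v).const_smul ((n : ℝ) + 1)⁻¹)
    rw [inner_gradient, h1.fderiv, real_inner_smul_left, inner_gradient]
    simp
  have hnorm : ∀ (n : ℕ) (v : Vel), ‖((n : ℝ) + 1)⁻¹ • v‖ = ‖v‖ / (n + 1) := fun n v => by
    rw [norm_smul, norm_inv, Real.norm_of_nonneg (hn0 n).le]; ring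
  have hzero : ∀ (n : ℕ) v, 2 * ((n : ℝ) + 1) < ‖v‖ → gradient (χ n) v = 0 := fun n v hv => by
    rw [hgrad]
    have h1 : ((n : ℝ) + 1)⁻¹ • v ∉ tsupport b := by
      rw [b.tsupport_eq, Metric.mem_closedBall, dist_zero_right, hnorm, not_le]
      exact (lt_div_iff₀ (hn0 n)).2 hv
    have h2 : fderiv ℝ b (((n : ℝ) + 1)⁻¹ • v) = 0 := fderiv_of_notMem_tsupport ℝ h1
    rw [gradient, h2, map_zero, smul_zero]
  -- On |v| ≤ 2(n+1) one has 1 + |v| ≤ 3(n+1), whence 3M; the extra 1 makes the constant positive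
  -- even if M = 0.
  refine ⟨χ, 3 * M + 1, by positivity, fun n => ⟨b.contDiff.comp (contDiff_const_smul _), fun v hv => ?_,
    fun v hv => ⟨?_, hzero n v (by linarith)⟩, fun v => ⟨b.nonneg, b.le_one⟩, fun v => ?_⟩⟩
  · have h1 : ((n : ℝ) + 1)⁻¹ • v ∈ Metric.ball (0 : Vel) 1 := by
      rw [Metric.mem_ball, dist_zero_right, hnorm]
      exact (div_lt_one (hn0 n)).2 hv
    refine ⟨b.one_of_mem_closedBall (Metric.ball_subset_closedBall h1), ?_⟩
    have h2 : (b : Vel → ℝ) =ᶠ[𝓝 (((n : ℝ) + 1)⁻¹ • v)] fun _ => 1 := b.eventuallyEq_one_of_mem_ball h1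
    rw [hgrad, gradient, h2.fderiv_eq]
    simp
  · refine b.zero_of_le_dist ?_
    rw [dist_zero_right, hnorm]
    exact (le_div_iff₀ (hn0 n)).2 (by linarith)
  · rcases lt_or_ge (2 * ((n : ℝ) + 1)) ‖v‖ with hv | hv
    · rw [hzero n v hv, norm_zero, mul_zero]; positivity
    · rw [hgrad, norm_smul, norm_inv, Real.norm_of_nonneg (hn0 n).le]
      have h1 : (1 + ‖v‖) * (((n : ℝ) + 1)⁻¹ * M) ≤ 3 * M := by
        have h2 : (1 + ‖v‖) * ((n : ℝ) + 1)⁻¹ ≤ 3 := by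
          rw [← div_eq_mul_inv, div_le_iff₀ (hn0 n)]; linarith [n.cast_nonneg (α := ℝ)]
        nlinarith
      calc _ ≤ (1 + ‖v‖) * (((n : ℝ) + 1)⁻¹ * M) := by gcongr; exact hM _
        _ ≤ 3 * M + 1 := by linarith

theorem MemLp.smul_of_hasCompactSupport {E : Type*} [NormedAddCommGroup E] [NormedSpace ℝ E]
    {h : Vel → ℝ} (hc : Continuous h) (hs : HasCompactSupport h) {f : Vel → E}
    (hf : MemLp f 2 volume) : MemLp (fun v => h v • f v) 2 volume := by
  obtain ⟨C, hC⟩ := hc.bounded_above_of_compact_support hs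
  refine hf.of_le_mul (c := C) (hc.aestronglyMeasurable.smul hf.1) (.of_forall fun v => ?_)
  rw [norm_smul]
  gcongr
  exact hC v

theorem HasFiniteForm.memLp_weight {γ : ℝ} (hγ : -3 < γ) (hγ₀ : γ < 0) {p : Vel → Vel}
    (hp : HasFiniteForm γ p) : MemLp (fun v => gaussWeight v • p v) 2 volume := by
  obtain ⟨C, hC, hb⟩ := exists_gaussWeight_sq_le hγ hγ₀
  have hm : AEStronglyMeasurable fun v => gaussWeight v • p v :=
    continuous_gaussWeight.aestronglyMeasurable.smul hp.1
  refine (memLp_two_iff_integrable_sq_norm hm).2 ((hp.integrable.const_mul C).mono' (hm.norm.pow 2)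
    (.of_forall fun v => ?_))
  rw [Real.norm_of_nonneg (sq_nonneg _), norm_smul, Real.norm_of_nonneg (gaussWeight_pos v).le, mul_pow]
  exact hb v _

theorem MemLp.of_hasFiniteForm {γ : ℝ} (hγ : -3 < γ) (hγ₀ : γ < 0) {p : Vel → Vel}
    (hp : HasFiniteForm γ p) {χ : Vel → ℝ} (hχ : Continuous χ) (hs : HasCompactSupport χ) :
    MemLp (fun v => χ v • p v) 2 volume := by
  have h := MemLp.smul_of_hasCompactSupport (h := fun v => χ v * (gaussWeight v)⁻¹)
    (hχ.mul (continuous_gaussWeight.inv₀ fun v => (gaussWeight_pos v).ne')) hs.mul_right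
    (hp.memLp_weight hγ hγ₀)
  refine h.ae_eq (.of_forall fun v => ?_)
  simp only
  rw [smul_smul, mul_assoc, inv_mul_cancel₀ (gaussWeight_pos v).ne', mul_one]

/-- The pair `(u, S u)` belongs to the energy space. -/
theorem mem_energySpace {γ : ℝ} (hγ : -3 < γ) (hγ₀ : γ < 0) {Φ : EnergyAmbient}
    {u : Vel → ℝ} {p : Vel → Vel} (h : IsWeakGradient u p) (hum : StronglyMeasurable u)
    (hpm : StronglyMeasurable p) (hu : MemLp u 2 volume) (hp : HasFiniteForm γ (twist u p))
    (hΦ : IsPair γ Φ u p) : Φ ∈ energySpace γ := by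
  obtain ⟨χ, M, hM, hχ⟩ := exists_cutoff
  obtain ⟨C, hC, hb⟩ := exists_meanForm_le hγ hγ₀
  set P := twist u p with hP
  have hχd := fun n => (hχ n).1
  have hχc := fun n => (hχd n).continuous
  have hgc := fun n => continuous_gradient (hχd n)
  have hχs : ∀ n, HasCompactSupport (χ n) := fun n =>
    HasCompactSupport.intro (isCompact_closedBall 0 (2 * ((n : ℝ) + 2))) fun v hv => by
      simp only [Metric.mem_closedBall, dist_zero_right, not_le] at hv
      exact ((hχ n).2.2.1 v hv.le).1
  have hgs : ∀ n, HasCompactSupport (gradient (χ n)) := fun n => hasCompactSupport_gradient (hχs n)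
  set un : ℕ → Vel → ℝ := fun n v => χ n v * u v with hun
  set pn : ℕ → Vel → Vel := fun n v => χ n v • p v + u v • gradient (χ n) v with hpn
  have hw : ∀ n, IsWeakGradient (un n) (pn n) := fun n => h.contDiff_mul (hχd n)
  have hunm : ∀ n, StronglyMeasurable (un n) := fun n => (hχc n).stronglyMeasurable.mul hum
  have hpnm : ∀ n, StronglyMeasurable (pn n) := fun n =>
    ((hχc n).stronglyMeasurable.smul hpm).add (hum.smul (hgc n).stronglyMeasurable)
  have hunL : ∀ n, MemLp (un n) 2 volume := fun n =>
    MemLp.smul_of_hasCompactSupport (hχc n) (hχs n) hu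
  have htw : ∀ n v, twist (un n) (pn n) v = χ n v • P v + u v • gradient (χ n) v := fun n v => by
    simp only [twist, hun, hpn, hP]; module
  have hgu : ∀ n, MemLp (fun v => u v • gradient (χ n) v) 2 volume := fun n => by
    refine hu.of_le_mul (c := M) (hu.1.smul (hgc n).aestronglyMeasurable) (.of_forall fun v => ?_)
    rw [norm_smul, mul_comm]
    gcongr
    exact le_trans (le_mul_of_one_le_left (norm_nonneg _) (by linarith [norm_nonneg v]))
      ((hχ n).2.2.2.2 v)
  have hpnL : ∀ n, MemLp (pn n) 2 volume := fun n => by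
    have h1 := MemLp.of_hasFiniteForm hγ hγ₀ hp (hχc n) (hχs n)
    have h2 : MemLp (fun v => u v • (-(χ n v / 2) • v)) 2 volume := by
      have hc : Continuous fun v => -(χ n v / 2) • v := by have := hχc n; fun_prop
      obtain ⟨D, hD⟩ := hc.bounded_above_of_compact_support (HasCompactSupport.smul_right
        (f := fun v => -(χ n v / 2)) (f' := fun v : Vel => v)
        ((hχs n).comp_left (g := fun x => -(x / 2)) (by simp)))
      refine hu.of_le_mul (c := D) (hu.1.smul hc.aestronglyMeasurable) (.of_forall fun v => ?_)
      rw [norm_smul, mul_comm]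
      gcongr
      exact hD v
    refine ((h1.add h2).add (hgu n)).ae_eq (.of_forall fun v => ?_)
    simp only [Pi.add_apply, hP, twist, hpn]
    module
  have hd : ∀ n v, twist (un n) (pn n) v - P v = (χ n v - 1) • P v + u v • gradient (χ n) v :=
    fun n v => by rw [htw]; module
  -- An integrable majorant independent of n, for dominated convergence of the truncated twisted
  -- gradients.
  set B : Vel → ℝ := fun v => 2 * meanForm γ v (P v) (P v) + 2 * (C * M ^ 2 * u v ^ 2) with hB
  have hu2 : Integrable fun v => u v ^ 2 := (memLp_two_iff_integrable_sq hu.1).1 hu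
  have hBi : Integrable B := (hp.integrable.const_mul 2).add ((hu2.const_mul _).const_mul _)
  have hgb : ∀ n v, meanForm γ v (u v • gradient (χ n) v) (u v • gradient (χ n) v)
      ≤ C * M ^ 2 * u v ^ 2 := fun n v => by
    rw [meanForm_smul]
    have h1 := pow_le_pow_left₀ (by positivity) ((hχ n).2.2.2.2 v) 2
    calc _ ≤ u v ^ 2 * (C * (1 + ‖v‖) ^ 2 * ‖gradient (χ n) v‖ ^ 2) := by gcongr; exact hb v _
      _ = C * ((1 + ‖v‖) * ‖gradient (χ n) v‖) ^ 2 * u v ^ 2 := by ring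
      _ ≤ _ := by gcongr
  have hdb : ∀ n v (c : ℝ), c ^ 2 ≤ 1 → meanForm γ v (c • P v + u v • gradient (χ n) v)
      (c • P v + u v • gradient (χ n) v) ≤ B v := fun n v c hc => by
    refine (meanForm_add_le hγ v _ _).trans ?_
    rw [meanForm_smul]
    have h1 := hgb n v
    have h2 := meanForm_self_nonneg γ v (P v)
    simp only [hB]
    nlinarith
  have htm : ∀ n, AEStronglyMeasurable (twist (un n) (pn n)) := fun n => by
    simp only [funext (htw n)]
    exact ((hχc n).aestronglyMeasurable.smul hp.1).add (hgu n).1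
  have hfin : ∀ n, HasFiniteForm γ (twist (un n) (pn n)) := fun n => by
    refine hasFiniteForm_of_integrable hγ (htm n) (hBi.mono' (AEStronglyMeasurable.meanForm (htm n)
      (htm n)) (.of_forall fun v => ?_))
    rw [Real.norm_of_nonneg (meanForm_self_nonneg _ _ _), htw]
    obtain ⟨h0, h1⟩ := (hχ n).2.2.2.1 v
    exact hdb n v _ (by nlinarith)
  set Ψ : ℕ → EnergyAmbient := fun n => WithLp.toLp 2 ((hunL n).toLp _, (hfin n).2.toLp _) with hΨ
  have hΨp : ∀ n, IsPair γ (Ψ n) (un n) (pn n) := fun n => ⟨(hunL n).coeFn_toLp, (hfin n).2.coeFn_toLp⟩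
  have hBfin : ∫⁻ v, ENNReal.ofReal (B v) ≠ ⊤ := hBi.lintegral_lt_top.ne
  have hev : ∀ v : Vel, ∀ᶠ n : ℕ in atTop, ‖v‖ < (n : ℝ) + 1 := fun v => by
    obtain ⟨N, hN⟩ := exists_nat_gt ‖v‖
    filter_upwards [eventually_ge_atTop N] with n hn
    have : (N : ℝ) ≤ n := by exact_mod_cast hn
    linarith
  refine (Submodule.isClosed_topologicalClosure _).mem_of_tendsto (f := Ψ) (b := atTop) ?_
    (.of_forall fun n => mem_energySpace_of_compact hγ hγ₀ (hw n) (hunm n) (hpnm n) (hunL n) (hpnL n)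
      (R := 2 * ((n : ℝ) + 2)) (by positivity) (fun v hv => ?_) (fun v hv => ?_) (hΨp n))
  · refine tendsto_of_isPair hγ hΨp hΦ htm hp.1 ?_ ?_
    · have h1 := tendsto_lintegral_of_dominated_convergence' (μ := volume)
        (F := fun n v => ‖un n v - u v‖ₑ ^ 2) (f := fun _ => 0) (fun v => ‖u v‖ₑ ^ 2)
        (fun n => ((hunL n).1.sub hu.1).enorm.pow_const 2) (fun n => .of_forall fun v => ?_)
        ((lintegral_enorm_sq_lt_top_iff hu.1).1 hu).ne (.of_forall fun v => ?_)
      · simpa using h1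
      · refine pow_le_pow_left' ?_ 2
        obtain ⟨h0, h1⟩ := (hχ n).2.2.2.1 v
        rw [← ofReal_norm, ← ofReal_norm]
        refine ENNReal.ofReal_le_ofReal ?_
        rw [show un n v - u v = (χ n v - 1) * u v by simp only [hun]; ring, norm_mul]
        refine mul_le_of_le_one_left (norm_nonneg _) ?_
        rw [Real.norm_eq_abs, abs_le]
        constructor <;> linarith
      · refine tendsto_const_nhds.congr' ?_
        filter_upwards [hev v] with n hn
        simp [hun, ((hχ n).2.1 v hn).1]
    · have h1 := tendsto_lintegral_of_dominated_convergence' (μ := volume)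
        (F := fun n v => ENNReal.ofReal (meanForm γ v (twist (un n) (pn n) v - P v)
          (twist (un n) (pn n) v - P v))) (f := fun _ => 0) (fun v => ENNReal.ofReal (B v))
        (fun n => (AEStronglyMeasurable.meanForm ((htm n).sub hp.1)
          ((htm n).sub hp.1)).aemeasurable.ennreal_ofReal) (fun n => .of_forall fun v => ?_)
        hBfin (.of_forall fun v => ?_)
      · simpa using h1
      · refine ENNReal.ofReal_le_ofReal ?_
        rw [hd]
        obtain ⟨h0, h1⟩ := (hχ n).2.2.2.1 v
        exact hdb n v _ (by nlinarith)
      · refine tendsto_const_nhds.congr' ?_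
        filter_upwards [hev v] with n hn
        rw [hd, ((hχ n).2.1 v hn).1, ((hχ n).2.1 v hn).2]
        simp [meanForm, collisionForm]
  · simp [hun, ((hχ n).2.2.1 v hv).1]
  · simp [hpn, ((hχ n).2.2.1 v hv).1, ((hχ n).2.2.1 v hv).2]

/-! ### Elements of the energy space -/

theorem norm_sq_L2Vel {a : L2Vel} {u : Vel → ℝ} (h : a =ᵐ[volume] u) : ‖a‖ ^ 2 = ∫ v, u v ^ 2 := by
  rw [← real_inner_self_eq_norm_sq, L2.inner_def]
  refine integral_congr_ae ?_
  filter_upwards [h] with v hv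
  rw [hv]
  simp [sq]

theorem norm_sq_pairField {γ : ℝ} {k : PairField} {P : Vel → Vel} (hP : HasFiniteForm γ P)
    (h : k =ᵐ[volume] lift γ P) : ‖k‖ ^ 2 = ∫ v, meanForm γ v (P v) (P v) := by
  rw [← real_inner_self_eq_norm_sq, inner_pairField hP hP h h]

theorem continuous_meanForm {γ : ℝ} (hγ : -3 < γ) (v : Vel) : Continuous fun ξ => meanForm γ v ξ ξ := by
  simp only [meanForm_eq_sum hγ]
  fun_prop

theorem inner_L2Vel {a : L2Vel} {u h : Vel → ℝ} (ha : a =ᵐ[volume] u) (hh : MemLp h 2 volume) :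
    ⟪a, hh.toLp h⟫ = ∫ v, u v * h v := by
  rw [L2.inner_def]
  refine integral_congr_ae ?_
  filter_upwards [ha, hh.coeFn_toLp] with v h1 h2
  rw [h1, h2]
  simp [mul_comm]

/-- Convergence of the fields on ℝ³ × ℝ³ implies weighted L² convergence of the twisted gradients,
so the limit of a sequence of pairs can be read off. -/
theorem exists_norm_weight_le {γ : ℝ} (hγ : -3 < γ) (hγ₀ : γ < 0) :
    ∃ C, 0 < C ∧ ∀ (P Q : Vel → Vel) (k l : PairField) (a b : Lp Vel 2 (volume : Measure Vel)),
      HasFiniteForm γ P → HasFiniteForm γ Q → k =ᵐ[volume] lift γ P → l =ᵐ[volume] lift γ Q →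
      a =ᵐ[volume] (fun v => gaussWeight v • P v) → b =ᵐ[volume] (fun v => gaussWeight v • Q v) →
      ‖a - b‖ ≤ C * ‖k - l‖ := by
  obtain ⟨C, hC, hb⟩ := exists_gaussWeight_sq_le hγ hγ₀
  refine ⟨Real.sqrt C, by positivity, fun P Q k l a b hP hQ hk hl ha hb' => ?_⟩
  have hPQ := hP.sub hQ
  have hkl : ((k - l : PairField) : Vel × Vel → Vel) =ᵐ[volume] lift γ (P - Q) := by
    rw [lift_sub]; exact (Lp.coeFn_sub ..).trans (hk.sub hl)
  have e1 := norm_sq_pairField hPQ hkl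
  have e2 : ‖a - b‖ ^ 2 = ∫ v, ‖gaussWeight v • (P - Q) v‖ ^ 2 := by
    rw [← real_inner_self_eq_norm_sq, L2.inner_def]
    refine integral_congr_ae ?_
    filter_upwards [Lp.coeFn_sub a b, ha, hb'] with v h1 h2 h3
    rw [h1, Pi.sub_apply, h2, h3, ← smul_sub, real_inner_self_eq_norm_sq, Pi.sub_apply]
  have h3 : ‖a - b‖ ^ 2 ≤ C * ‖k - l‖ ^ 2 := by
    rw [e1, e2, ← integral_const_mul]
    refine integral_mono ((memLp_two_iff_integrable_sq_norm (hPQ.memLp_weight hγ hγ₀).1).1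
      (hPQ.memLp_weight hγ hγ₀)) (hPQ.integrable.const_mul C) fun v => ?_
    simp only [norm_smul, mul_pow, Real.norm_of_nonneg (gaussWeight_pos v).le]
    exact hb v _
  rw [← Real.sqrt_sq (norm_nonneg (k - l)), ← Real.sqrt_mul hC.le]
  exact Real.le_sqrt_of_sq_le h3

/-- Closedness of the weak gradient: approximating test functions converge together with their
twisted gradients, the limit is untwisted into a gradient, and Fatou's lemma carries the energy
bound over. -/
theorem exists_of_mem_energySpace {γ : ℝ} (hγ : -3 < γ) (hγ₀ : γ < 0) :
    ∃ C, 0 < C ∧ ∀ Φ ∈ energySpace γ, ∃ p, IsWeakGradient Φ.fst p ∧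
      HasFiniteForm γ (twist Φ.fst p) ∧ IsPair γ Φ Φ.fst p ∧
      normASq γ Φ.fst ≤ ENNReal.ofReal (‖Φ.snd‖ ^ 2 + C * ‖Φ.fst‖ ^ 2) := by
  obtain ⟨C, hC, hen⟩ := exists_energy_le hγ hγ₀
  obtain ⟨D, hD, hwt⟩ := exists_norm_weight_le hγ hγ₀
  refine ⟨C, hC, fun Φ hΦ => ?_⟩
  obtain ⟨Φs, hΦs, hlim⟩ := mem_closure_iff_seq_limit.1 hΦ
  choose φ hφ hpair using hΦs
  set P : ℕ → Vel → Vel := fun n => twist (φ n) (gradient (φ n)) with hPdef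
  have hP : ∀ n, HasFiniteForm γ (P n) := fun n => (hφ n).hasFiniteForm hγ hγ₀
  have hPw := fun n => (hP n).memLp_weight hγ hγ₀
  set q : ℕ → Lp Vel 2 (volume : Measure Vel) := fun n => (hPw n).toLp _ with hq
  have hqe : ∀ n, q n =ᵐ[volume] fun v => gaussWeight v • P n v := fun n => (hPw n).coeFn_toLp
  have hfst : Tendsto (fun n => (Φs n).fst) atTop (𝓝 Φ.fst) :=
    ((WithLp.fstL 2 ℝ L2Vel PairField).continuous.tendsto Φ).comp hlim
  have hsnd : Tendsto (fun n => (Φs n).snd) atTop (𝓝 Φ.snd) :=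
    ((WithLp.sndL 2 ℝ L2Vel PairField).continuous.tendsto Φ).comp hlim
  have hqc : CauchySeq q := by
    have h1 := (cauchySeq_iff_tendsto_dist_atTop_0.1 hsnd.cauchySeq).const_mul D
    rw [mul_zero] at h1
    refine cauchySeq_iff_tendsto_dist_atTop_0.2 (squeeze_zero (fun _ => dist_nonneg) (fun n => ?_) h1)
    rw [dist_eq_norm, dist_eq_norm]
    exact hwt _ _ _ _ _ _ (hP _) (hP _) (hpair _).2 (hpair _).2 (hqe _) (hqe _)
  obtain ⟨Q, hQ⟩ := cauchySeq_tendsto_of_complete hqc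
  -- Three nested subsequences make the functions, the fields and the weighted gradients converge
  -- almost everywhere simultaneously.
  obtain ⟨n₁, hn₁, a1⟩ := (tendstoInMeasure_of_tendsto_Lp hfst).exists_seq_tendsto_ae'
  obtain ⟨n₂, hn₂, a2⟩ := (tendstoInMeasure_of_tendsto_Lp (hsnd.comp hn₁)).exists_seq_tendsto_ae'
  obtain ⟨n₃, hn₃, a3⟩ := (tendstoInMeasure_of_tendsto_Lp
    (hQ.comp (hn₁.comp hn₂))).exists_seq_tendsto_ae'
  set ns : ℕ → ℕ := fun i => n₁ (n₂ (n₃ i)) with hns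
  have hnst : Tendsto ns atTop atTop := hn₁.comp (hn₂.comp hn₃)
  set u : Vel → ℝ := ⇑Φ.fst with hu
  set PP : Vel → Vel := fun v => (gaussWeight v)⁻¹ • Q v with hPP
  set p : Vel → Vel := fun v => PP v - (u v / 2) • v with hp
  have htw : twist u p = PP := by ext1 v; simp only [twist, hp]; module
  have b1 : ∀ᵐ v, Tendsto (fun i => φ (ns i) v) atTop (𝓝 (u v)) := by
    filter_upwards [a1, ae_all_iff.2 fun n => (hpair n).1] with v h1 h2
    exact (h1.comp (hn₂.comp hn₃)).congr fun i => h2 _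
  have b3 : ∀ᵐ v, Tendsto (fun i => P (ns i) v) atTop (𝓝 (PP v)) := by
    filter_upwards [a3, ae_all_iff.2 hqe] with v h1 h2
    refine (h1.const_smul (gaussWeight v)⁻¹).congr fun i => ?_
    rw [Function.comp_apply, Function.comp_apply, h2, smul_smul,
      inv_mul_cancel₀ (gaussWeight_pos v).ne', one_smul]
  have b2 : Φ.snd =ᵐ[volume] lift γ PP := by
    filter_upwards [a2, ae_all_iff.2 fun n => (hpair n).2, ae_comp_fst b3] with x h1 h2 h3
    refine tendsto_nhds_unique ((h1.comp hn₃).congr fun i => h2 _) ?_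
    exact (((continuous_collisionRoot γ (x.1 - x.2)).tendsto _).comp h3).const_smul (sqrtMaxwellian x.2)
  have hQm : AEStronglyMeasurable PP :=
    ((continuous_gaussWeight.inv₀ fun v => (gaussWeight_pos v).ne').aestronglyMeasurable).smul
      (Lp.aestronglyMeasurable Q)
  have hPPf : HasFiniteForm γ PP := ⟨hQm, (Lp.memLp Φ.snd).ae_eq b2⟩
  have hul : LocallyIntegrable u := (Lp.memLp Φ.fst).locallyIntegrable (by norm_num)
  have hpl : LocallyIntegrable p := by
    refine LocallyIntegrable.sub ?_ ?_
    · exact LocallyIntegrable.continuous_smul ((Lp.memLp Q).locallyIntegrable (by norm_num))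
        (continuous_gaussWeight.inv₀ fun v => (gaussWeight_pos v).ne')
    · refine locallyIntegrable_congr (.of_forall fun v => ?_)
        (LocallyIntegrable.smul_continuous hul (χ := fun v : Vel => (1 / 2 : ℝ) • v) (by fun_prop))
      simp only; module
  have hwg : IsWeakGradient u p := by
    refine ⟨hul, hpl, fun ψ hψ j => ?_⟩
    have hdm : MemLp (fun v => dirDeriv (basisVec j) ψ v - v j / 2 * ψ v) 2 volume := by
      have h1 := continuous_dirDeriv hψ.1 (basisVec j)
      have h2 := hψ.continuous
      exact Continuous.memLp_of_hasCompactSupport (by fun_prop)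
        ((hasCompactSupport_dirDeriv hψ.2 _).sub (HasCompactSupport.mul_left
          (f := fun v : Vel => v j / 2) hψ.2))
    have hgc : Continuous fun v => ((gaussWeight v)⁻¹ * ψ v) • basisVec j :=
      ((continuous_gaussWeight.inv₀ fun v => (gaussWeight_pos v).ne').mul hψ.continuous).smul
        continuous_const
    have hgm : MemLp (fun v => ((gaussWeight v)⁻¹ * ψ v) • basisVec j) 2 volume :=
      hgc.memLp_of_hasCompactSupport (HasCompactSupport.smul_right
        (f := fun v => (gaussWeight v)⁻¹ * ψ v) (f' := fun _ => basisVec j) hψ.2.mul_left)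
    have hi1 : ∀ (a : L2Vel) (w : Vel → ℝ), a =ᵐ[volume] w →
        ⟪a, hdm.toLp _⟫ = ∫ v, w v * (dirDeriv (basisVec j) ψ v - v j / 2 * ψ v) := fun a w h =>
      inner_L2Vel h hdm
    have hi2 : ∀ (a : Lp Vel 2 (volume : Measure Vel)) (w : Vel → Vel),
        a =ᵐ[volume] (fun v => gaussWeight v • w v) → ⟪a, hgm.toLp _⟫ = ∫ v, w v j * ψ v := by
      intro a w h
      rw [L2.inner_def]
      refine integral_congr_ae ?_
      filter_upwards [h, hgm.coeFn_toLp] with v h1 h2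
      have := (gaussWeight_pos v).ne'
      rw [h1, h2, real_inner_smul_left, real_inner_smul_right, real_inner_comm, inner_basisVec]
      field_simp
    -- The gradient identity in twisted form pairs the convergent quantities with fixed L²
    -- functions, so it passes to the limit.
    have hcalc : ∀ (w : Vel → ℝ) (r : Vel → Vel), LocallyIntegrable w → LocallyIntegrable r →
        (∫ v, w v * (dirDeriv (basisVec j) ψ v - v j / 2 * ψ v) = -∫ v, twist w r v j * ψ v ↔
          ∫ v, w v * dirDeriv (basisVec j) ψ v = -∫ v, r v j * ψ v) := by
      intro w r hw hr
      have i1 := integrable_mul_of_hasCompactSupport hw (continuous_dirDeriv hψ.1 (basisVec j))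
        (hasCompactSupport_dirDeriv hψ.2 _)
      have i2 : Integrable fun v => w v * (v j / 2 * ψ v) := integrable_mul_of_hasCompactSupport hw
        (Continuous.mul (by fun_prop) hψ.continuous)
        (HasCompactSupport.mul_left (f := fun v : Vel => v j / 2) hψ.2)
      have i3 := integrable_mul_of_hasCompactSupport (LocallyIntegrable.coord hr j) hψ.continuous hψ.2
      have e1 : ∀ v, twist w r v j * ψ v = r v j * ψ v + w v * (v j / 2 * ψ v) := fun v => by
        simp only [twist, PiLp.add_apply, PiLp.smul_apply, smul_eq_mul]; ring
      simp only [mul_sub, e1]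
      rw [integral_sub i1 i2, integral_add i3 i2]
      constructor <;> intro h <;> linarith
    have hn : ∀ n, ⟪(Φs n).fst, hdm.toLp _⟫ = -⟪q n, hgm.toLp _⟫ := fun n => by
      rw [hi1 _ _ (hpair n).1, hi2 _ _ (hqe n)]
      have hg := isWeakGradient_of_contDiff (hφ n).1
      exact (hcalc _ _ hg.1 hg.2.1).2 (hg.2.2 ψ hψ j)
    have hl : ⟪Φ.fst, hdm.toLp _⟫ = -⟪Q, hgm.toLp _⟫ :=
      tendsto_nhds_unique (hfst.inner tendsto_const_nhds)
        (((hQ.inner tendsto_const_nhds).neg).congr fun n => (hn n).symm)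
    rw [hi1 _ u (.of_forall fun _ => rfl), hi2 _ PP (.of_forall fun v => ?_), ← htw] at hl
    · exact (hcalc u p hul hpl).1 hl
    · simp only [hPP]
      rw [smul_smul, mul_inv_cancel₀ (gaussWeight_pos v).ne', one_smul]
  refine ⟨p, hwg, by rwa [htw], ⟨.of_forall fun _ => rfl, by rwa [htw]⟩, ?_⟩
  set F : ℕ → Vel → ℝ≥0∞ := fun n v => ENNReal.ofReal (meanForm γ v (gradient (φ n) v)
    (gradient (φ n) v) + 1 / 4 * meanForm γ v v v * φ n v ^ 2) with hF
  have hFi : ∀ n, ∫⁻ v, F n v ≤ ENNReal.ofReal (‖(Φs n).snd‖ ^ 2 + C * ‖(Φs n).fst‖ ^ 2) := fun n => by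
    rw [← ofReal_integral_eq_lintegral_ofReal (integrable_energy hγ hγ₀ (hφ n))
      (.of_forall fun v => by
        have h1 := meanForm_self_nonneg γ v (gradient (φ n) v)
        have h2 := meanForm_self_nonneg γ v v
        positivity), norm_sq_pairField (hP n) (hpair n).2, norm_sq_L2Vel (hpair n).1]
    exact ENNReal.ofReal_le_ofReal (hen (φ n) (hφ n))
  have hlim2 : Tendsto (fun n => ENNReal.ofReal (‖(Φs n).snd‖ ^ 2 + C * ‖(Φs n).fst‖ ^ 2)) atTop
      (𝓝 (ENNReal.ofReal (‖Φ.snd‖ ^ 2 + C * ‖Φ.fst‖ ^ 2))) :=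
    ENNReal.tendsto_ofReal ((hsnd.norm.pow 2).add ((hfst.norm.pow 2).const_mul C))
  rw [normASq, if_pos ⟨p, hwg⟩]
  calc ∫⁻ v, ENNReal.ofReal (energyDensity γ u v) = ∫⁻ v, liminf (fun i => F (ns i) v) atTop := by
        refine lintegral_congr_ae ?_
        filter_upwards [hwg.weakGrad_ae_eq, b1, b3] with v h1 h2 h3
        have h4 : Tendsto (fun i => gradient (φ (ns i)) v) atTop (𝓝 (p v)) := by
          refine (h3.sub ((h2.div_const 2).smul_const v)).congr fun i => ?_
          simp only [hPdef, twist]; module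
        rw [energyDensity_eq hγ, h1]
        refine (Tendsto.liminf_eq (ENNReal.tendsto_ofReal ?_)).symm
        exact (((continuous_meanForm hγ v).tendsto _).comp h4).add ((h2.pow 2).const_mul _)
    _ ≤ liminf (fun i => ∫⁻ v, F (ns i) v) atTop :=
        lintegral_liminf_le' fun i =>
          (integrable_energy hγ hγ₀ (hφ (ns i))).aestronglyMeasurable.aemeasurable.ennreal_ofReal
    _ ≤ liminf (fun i => ENNReal.ofReal (‖(Φs (ns i)).snd‖ ^ 2 + C * ‖(Φs (ns i)).fst‖ ^ 2)) atTop :=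
        liminf_le_liminf (.of_forall fun i => hFi _)
    _ = _ := (hlim2.comp hnst).liminf_eq

/-- The inequality is closed in the ambient norm, so it is enough to have it on test pairs, where
the exchange term costs half of the field norm. The added ½ covers the L² part of the ambient norm.
-/
theorem exchangeForm_coercive {γ : ℝ} (hγ : -3 < γ) (hγ₀ : γ < 0) :
    ∃ lam, 0 < lam ∧ ∀ Φ ∈ energySpace γ,
      1 / 2 * ‖Φ‖ ^ 2 ≤ exchangeForm Φ.snd Φ.snd + lam * ‖Φ.fst‖ ^ 2 := by
  obtain ⟨C, hC, h⟩ := exists_exchange_le hγ hγ₀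
  refine ⟨C + 1 / 2, by positivity, fun Φ hΦ => ?_⟩
  have hf := (WithLp.fstL 2 ℝ L2Vel PairField).continuous
  have hs := (WithLp.sndL 2 ℝ L2Vel PairField).continuous
  have hcl : IsClosed {Φ : EnergyAmbient |
      1 / 2 * ‖Φ‖ ^ 2 ≤ exchangeForm Φ.snd Φ.snd + (C + 1 / 2) * ‖Φ.fst‖ ^ 2} := by
    refine isClosed_le (by fun_prop) (Continuous.add ?_ ?_)
    · exact (exchangeForm.continuous.comp hs).clm_apply hs
    · exact (hf.norm.pow 2).const_mul _
  refine closure_minimal ?_ hcl hΦ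
  rintro Ψ ⟨φ, hφ, h1, h2⟩
  have h3 := h φ hφ _ h2
  rw [← norm_sq_L2Vel h1] at h3
  have h4 := le_abs_self ⟪exchange Ψ.snd, Ψ.snd⟫
  rw [mem_ofPred_eq]
  rw [WithLp.prod_norm_sq_eq_of_L2, exchangeForm_apply, real_inner_self_eq_norm_sq]
  linarith

/-- The field is determined by the function, because weak gradients are unique; hence the embedding
into L² is injective. -/
theorem eq_zero_of_fst_eq_zero {γ : ℝ} (hγ : -3 < γ) (hγ₀ : γ < 0) {Φ : EnergyAmbient}
    (hΦ : Φ ∈ energySpace γ) (h0 : Φ.fst = 0) : Φ = 0 := by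
  obtain ⟨C, -, h⟩ := exists_of_mem_energySpace hγ hγ₀
  obtain ⟨p, hw, -, ⟨-, hs⟩, -⟩ := h Φ hΦ
  have hz : Φ.fst =ᵐ[volume] fun _ => (0 : ℝ) := by rw [h0]; exact Lp.coeFn_zero ..
  have hg0 : gradient (fun _ : Vel => (0 : ℝ)) = 0 := by
    ext1 v
    exact ext_inner_right ℝ fun e => by rw [inner_gradient]; simp
  have hp0 : p =ᵐ[volume] 0 := by
    rw [← hg0]
    exact hw.unique ((isWeakGradient_of_contDiff contDiff_const).congr hz.symm (.refl _ _))
  have htw : twist Φ.fst p =ᵐ[volume] 0 := by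
    filter_upwards [hz, hp0] with v h1 h2
    simp [twist, h1, h2]
  have h1 : Φ.snd = 0 := by
    refine Lp.ext (hs.trans ((lift_congr γ htw).trans ?_))
    refine Filter.EventuallyEq.trans (.of_forall fun x => ?_) (Lp.coeFn_zero ..).symm
    simp [lift, collisionRoot]
  have h2 : ‖Φ‖ ^ 2 = 0 := by rw [WithLp.prod_norm_sq_eq_of_L2, h0, h1]; simp
  simpa using h2

/-! ### Curves of finite energy -/

instance (γ : ℝ) : CompleteSpace (energySpace γ) :=
  (Submodule.isClosed_topologicalClosure (testPairs γ)).completeSpace_coe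

instance : SecondCountableTopology EnergyAmbient := by
  have h2 : Fact ((2 : ℝ≥0∞) ≠ ⊤) := ⟨by simp⟩
  have h3 : SecondCountableTopology L2Vel := Lp.SecondCountableTopology
  have h5 : SFinite (volume : Measure (Vel × Vel)) := inferInstance
  have h4 : SecondCountableTopology PairField := Lp.SecondCountableTopology
  exact (WithLp.homeomorphProd 2 L2Vel PairField).secondCountableTopology

theorem exists_mem_energySpace {γ : ℝ} (hγ : -3 < γ) (hγ₀ : γ < 0) {u : L2Vel}
    (hu : normASq γ u < ⊤) : ∃ Φ ∈ energySpace γ, Φ.fst = u ∧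
      (∃ p, IsWeakGradient u p ∧ HasFiniteForm γ (twist u p) ∧ IsPair γ Φ u p) ∧
      ‖Φ.snd‖ₑ ^ 2 ≤ 2 * normASq γ u := by
  have hw : HasWeakGradient u := by
    by_contra h
    rw [normASq, if_neg h] at hu
    exact lt_irrefl _ hu
  rw [normASq, if_pos hw] at hu ⊢
  have h0 := hw.isWeakGradient
  have hm : AEStronglyMeasurable (weakGrad u) := h0.2.1.aestronglyMeasurable
  -- A strongly measurable representative of the chosen gradient, as the density argument requires.
  set p := hm.mk with hp
  have hpe : weakGrad u =ᵐ[volume] p := hm.ae_eq_mk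
  have h1 : IsWeakGradient u p := h0.congr (.refl _ _) hpe
  have hpm : StronglyMeasurable p := hm.stronglyMeasurable_mk
  have hum : StronglyMeasurable u := Lp.stronglyMeasurable u
  have htm : AEStronglyMeasurable (twist u p) :=
    hpm.aestronglyMeasurable.add (AEStronglyMeasurable.smul (f := fun v => u v / 2)
      (hum.measurable.div_const 2).aestronglyMeasurable continuous_id.aestronglyMeasurable)
  have hle : ∫⁻ v, ENNReal.ofReal (meanForm γ v (twist u p v) (twist u p v))
      ≤ 2 * ∫⁻ v, ENNReal.ofReal (energyDensity γ u v) := by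
    rw [← lintegral_const_mul' _ _ (by simp)]
    refine lintegral_mono_ae ?_
    filter_upwards [hpe] with v hv
    have h2 := meanForm_add_le hγ v (p v) ((u v / 2) • v)
    rw [meanForm_smul] at h2
    have h3 : ∀ x : ℝ, 2 * ENNReal.ofReal x = ENNReal.ofReal (2 * x) := fun x => by
      rw [ENNReal.ofReal_mul (by norm_num), ENNReal.ofReal_ofNat]
    rw [h3]
    refine ENNReal.ofReal_le_ofReal (h2.trans (le_of_eq ?_))
    rw [energyDensity_eq hγ, hv]
    ring
  have hfin : HasFiniteForm γ (twist u p) :=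
    hasFiniteForm_of_lintegral hγ htm (hle.trans_lt (ENNReal.mul_lt_top (by simp) hu))
  set Φ : EnergyAmbient := WithLp.toLp 2 (u, hfin.2.toLp _) with hΦ
  have hpair : IsPair γ Φ u p := ⟨.refl _ _, hfin.2.coeFn_toLp⟩
  refine ⟨Φ, mem_energySpace hγ hγ₀ h1 hum hpm (Lp.memLp u) hfin hpair, rfl, ⟨p, h1, hfin, hpair⟩, ?_⟩
  refine le_trans (le_of_eq ?_) hle
  rw [← lintegral_lift hγ htm]
  change ‖hfin.2.toLp _‖ₑ ^ 2 = _
  rw [Lp.enorm_toLp, eLpNorm_two_sq]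

/-- The embedding of the energy space into `L²`. -/
def energyEmbedding (γ : ℝ) : energySpace γ →L[ℝ] L2Vel :=
  (WithLp.fstL 2 ℝ L2Vel PairField).comp (energySpace γ).subtypeL

theorem energyEmbedding_apply {γ : ℝ} (Φ : energySpace γ) :
    energyEmbedding γ Φ = (Φ : EnergyAmbient).fst := rfl

theorem energyEmbedding_injective {γ : ℝ} (hγ : -3 < γ) (hγ₀ : γ < 0) :
    Function.Injective (energyEmbedding γ) := by
  refine (injective_iff_map_eq_zero _).2 fun Φ h => ?_
  exact Subtype.ext (eq_zero_of_fst_eq_zero hγ hγ₀ Φ.2 h)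

/-- An injective continuous image of a Polish space is Borel and has a measurable inverse
(Lusin-Souslin), so the lift of f to the energy space is measurable; the finite energy makes it
integrable. -/
theorem exists_integrable_curve {γ : ℝ} (hγ : -3 < γ) (hγ₀ : γ < 0) {T : ℝ} {f : ℝ → L2Vel}
    (hf : ContinuousOn f (Icc 0 T)) (he : ∫⁻ t in Ioc 0 T, normASq γ (f t) < ⊤) :
    ∃ U : ℝ → energySpace γ, IntegrableOn U (Ioc 0 T) ∧
      ∀ᵐ s ∂volume.restrict (Ioc 0 T), energyEmbedding γ (U s) = f s := by
  let : MeasurableSpace (energySpace γ) := borel _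
  have : BorelSpace (energySpace γ) := ⟨rfl⟩
  let : MeasurableSpace L2Vel := borel _
  have : BorelSpace L2Vel := ⟨rfl⟩
  have hemb : MeasurableEmbedding (energyEmbedding γ) :=
    (energyEmbedding γ).continuous.measurableEmbedding (energyEmbedding_injective hγ hγ₀)
  set r : L2Vel → energySpace γ := Function.extend (energyEmbedding γ) id fun _ => 0 with hr
  have hrm : Measurable r := hemb.measurable_extend measurable_id measurable_const
  have hre : ∀ Φ, r (energyEmbedding γ Φ) = Φ := fun Φ =>
    (energyEmbedding_injective hγ hγ₀).extend_apply _ _ Φ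
  have hfs : ContinuousOn f (Ioc 0 T) := hf.mono Ioc_subset_Icc_self
  have hfm : AEMeasurable f (volume.restrict (Ioc 0 T)) := hfs.aemeasurable measurableSet_Ioc
  have hrange : ∀ᵐ s ∂volume.restrict (Ioc 0 T), f s ∈ range (energyEmbedding γ) := by
    -- A measurable minorant of the A-norm, infinite off the range. It shows that f lies in the
    -- range almost everywhere without any measurability of the A-norm itself.
    set h : L2Vel → ℝ≥0∞ := (range (energyEmbedding γ))ᶜ.indicator fun _ => ⊤ with hh
    have hhm : Measurable h := measurable_const.indicator hemb.measurableSet_range.compl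
    have h1 : ∫⁻ s in Ioc 0 T, h (f s) < ⊤ := by
      refine (lintegral_mono fun s => ?_).trans_lt he
      by_cases hs : f s ∈ range (energyEmbedding γ)
      · rw [hh, indicator_of_notMem (by simpa using hs)]
        exact zero_le
      · have : normASq γ (f s) = ⊤ := by
          by_contra hne
          obtain ⟨Φ, hΦ, h2, -⟩ := exists_mem_energySpace hγ hγ₀ (lt_top_iff_ne_top.2 hne)
          exact hs ⟨⟨Φ, hΦ⟩, h2⟩
        rw [this]
        exact le_top
    filter_upwards [ae_lt_top' (hhm.comp_aemeasurable hfm) h1.ne] with s hs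
    by_contra hns
    have : h (f s) = ⊤ := by rw [hh, indicator_of_mem (by simpa using hns)]
    rw [Function.comp_apply, this] at hs
    exact lt_irrefl _ hs
  have hU : ∀ᵐ s ∂volume.restrict (Ioc 0 T), energyEmbedding γ (r (f s)) = f s := by
    filter_upwards [hrange] with s hs
    obtain ⟨Φ, hΦ⟩ := hs
    rw [← hΦ, hre]
  refine ⟨fun s => r (f s), ⟨(hrm.comp_aemeasurable hfm).aestronglyMeasurable, ?_⟩, hU⟩
  have hb : ∀ᵐ s ∂volume.restrict (Ioc 0 T),
      ‖r (f s)‖ₑ ≤ (1 + ‖f s‖ₑ ^ 2) + 2 * normASq γ (f s) := by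
    filter_upwards [hU] with s hs
    by_cases hN : normASq γ (f s) = ⊤
    · rw [hN, ENNReal.mul_top (by simp), add_top]; exact le_top
    · obtain ⟨Φ, hΦ, h2, -, h3⟩ := exists_mem_energySpace hγ hγ₀ (lt_top_iff_ne_top.2 hN)
      have h4 : r (f s) = ⟨Φ, hΦ⟩ := by
        rw [← hre ⟨Φ, hΦ⟩]; congr 1; exact h2.symm
      -- ‖Φ‖ ≤ 1 + ‖Φ‖², which converts the quadratic energy bound into integrability of the norm.
      have h5 : ‖Φ‖ₑ ≤ 1 + (‖Φ.fst‖ₑ ^ 2 + ‖Φ.snd‖ₑ ^ 2) := by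
        rw [← ofReal_norm, ← ofReal_norm, ← ofReal_norm, ← ENNReal.ofReal_pow (norm_nonneg _),
          ← ENNReal.ofReal_pow (norm_nonneg _), ← ENNReal.ofReal_add (by positivity) (by positivity),
          ← ENNReal.ofReal_one, ← ENNReal.ofReal_add (by positivity) (by positivity),
          ← WithLp.prod_norm_sq_eq_of_L2]
        refine ENNReal.ofReal_le_ofReal ?_
        nlinarith [sq_nonneg (‖Φ‖ - 1)]
      calc ‖r (f s)‖ₑ = ‖Φ‖ₑ := by rw [h4]; rfl
        _ ≤ _ := h5
        _ ≤ 1 + (‖f s‖ₑ ^ 2 + 2 * normASq γ (f s)) := by rw [h2]; gcongr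
        _ = _ := by rw [add_assoc]
  obtain ⟨M, hM⟩ := isCompact_Icc.exists_bound_of_continuousOn hf
  refine (lintegral_mono_ae hb).trans_lt ?_
  have hm1 : AEMeasurable (fun s => 1 + ‖f s‖ₑ ^ 2) (volume.restrict (Ioc 0 T)) :=
    (hfm.enorm.pow_const 2).const_add 1
  rw [lintegral_add_left' hm1, lintegral_const_mul' _ _ (by simp)]
  refine ENNReal.add_lt_top.2 ⟨?_, ENNReal.mul_lt_top (by simp) he⟩
  calc ∫⁻ s in Ioc 0 T, (1 + ‖f s‖ₑ ^ 2) ≤ ∫⁻ _ in Ioc 0 T, (1 + ENNReal.ofReal M ^ 2) := by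
        refine setLIntegral_mono measurable_const fun s hs => ?_
        gcongr
        rw [← ofReal_norm]
        exact ENNReal.ofReal_le_ofReal (hM s (Ioc_subset_Icc_self hs))
    _ < ⊤ := by
        rw [setLIntegral_const]
        refine ENNReal.mul_lt_top ?_ (by simp)
        exact ENNReal.add_lt_top.2 ⟨by simp, by simp⟩

/-! ### Time slices of an analytic source -/

theorem enorm_sub_le_lintegral {u u' : ℝ → ℝ} {s t : ℝ}
    (hu : ∀ r ∈ uIcc s t, HasDerivAt u (u' r) r) (hc : ContinuousOn u' (uIcc s t)) :
    ‖u t - u s‖ₑ ≤ ∫⁻ r in uIoc s t, ‖u' r‖ₑ := by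
  rw [← intervalIntegral.integral_eq_sub_of_hasDerivAt hu hc.intervalIntegrable,
    ← ofReal_norm, intervalIntegral.norm_intervalIntegral_eq, ofReal_norm]
  exact enorm_integral_le_lintegral_enorm _

theorem enorm_sub_sq_le {u u' : ℝ → ℝ} {s t : ℝ}
    (hu : ∀ r ∈ uIcc s t, HasDerivAt u (u' r) r) (hc : ContinuousOn u' (uIcc s t)) :
    ‖u t - u s‖ₑ ^ 2 ≤ ENNReal.ofReal |t - s| * ∫⁻ r in uIoc s t, ‖u' r‖ₑ ^ 2 := by
  have hm : AEMeasurable u' (volume.restrict (uIoc s t)) :=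
    (hc.mono uIoc_subset_uIcc).aemeasurable measurableSet_uIoc
  calc _ ≤ (∫⁻ r in uIoc s t, ‖u' r‖ₑ) ^ 2 := by gcongr; exact enorm_sub_le_lintegral hu hc
    _ ≤ _ := sq_lintegral_le_measure_mul hm.enorm
    _ = _ := by
      rw [Measure.restrict_apply_univ, Real.volume_uIoc]

/-- Curves `h k` of functions of `v`, each the pointwise time derivative of the one before. -/
structure IsSliceFamily (T : ℝ) (N : ℕ → ℝ) (h : ℕ → ℝ × Vel → ℝ) : Prop where
  continuousOn : ∀ k, ContinuousOn (h k) (Ioo 0 T ×ˢ univ)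
  hasDerivAt : ∀ k, ∀ t ∈ Ioo 0 T, ∀ v, HasDerivAt (fun s => h k (s, v)) (h (k + 1) (t, v)) t
  lintegral_le : ∀ k, ∫⁻ z in Ioo 0 T ×ˢ univ, ‖h k z‖ₑ ^ 2 ≤ ENNReal.ofReal (N k ^ 2)

namespace IsSliceFamily

variable {T : ℝ} {N : ℕ → ℝ} {h : ℕ → ℝ × Vel → ℝ}

theorem continuousOn_time (H : IsSliceFamily T N h) (k : ℕ) (v : Vel) :
    ContinuousOn (fun t => h k (t, v)) (Ioo 0 T) :=
  (H.continuousOn k).comp (by fun_prop) fun _ ht => ⟨ht, mem_univ _⟩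

theorem continuous_slice (H : IsSliceFamily T N h) (k : ℕ) {t : ℝ} (ht : t ∈ Ioo 0 T) :
    Continuous fun v => h k (t, v) :=
  (H.continuousOn k).comp_continuous (by fun_prop) fun _ => ⟨ht, mem_univ _⟩

theorem aemeasurable (H : IsSliceFamily T N h) (k : ℕ) {s : Set ℝ} (hs : s ⊆ Ioo 0 T)
    (hsm : MeasurableSet s) :
    AEMeasurable (h k) ((volume.restrict s).prod (volume : Measure Vel)) := by
  have h1 : (volume.restrict s).prod (volume : Measure Vel)
      = (volume : Measure (ℝ × Vel)).restrict (s ×ˢ univ) := by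
    rw [Measure.volume_eq_prod, ← Measure.prod_restrict, Measure.restrict_univ]
  rw [h1]
  exact ((H.continuousOn k).mono (prod_mono hs subset_rfl)).aemeasurable (hsm.prod .univ)

theorem lintegral_lintegral_le (H : IsSliceFamily T N h) (k : ℕ) :
    ∫⁻ v, (∫⁻ s in Ioo 0 T, ‖h k (s, v)‖ₑ ^ 2) ≤ ENNReal.ofReal (N k ^ 2) := by
  have hm := H.aemeasurable k subset_rfl measurableSet_Ioo
  have h1 : (volume.restrict (Ioo 0 T)).prod (volume : Measure Vel)
      = (volume : Measure (ℝ × Vel)).restrict (Ioo 0 T ×ˢ univ) := by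
    rw [Measure.volume_eq_prod, ← Measure.prod_restrict, Measure.restrict_univ]
  refine le_trans (le_of_eq ?_) (H.lintegral_le k)
  rw [← h1, lintegral_prod_symm _ (hm.enorm.pow_const 2)]

/-- One-dimensional Sobolev inequality in time: compare the value at t with the value at s by
Cauchy-Schwarz on the derivative, then average over s. -/
theorem slice_le (H : IsSliceFamily T N h) (hT : 0 < T) (k : ℕ) {t : ℝ} (ht : t ∈ Ioo 0 T) :
    ∫⁻ v, ‖h k (t, v)‖ₑ ^ 2 ≤ ENNReal.ofReal (2 / T * N k ^ 2 + 2 * T * N (k + 1) ^ 2) := by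
  have hpt : ∀ v, ENNReal.ofReal T * ‖h k (t, v)‖ₑ ^ 2
      ≤ 2 * (∫⁻ s in Ioo 0 T, ‖h k (s, v)‖ₑ ^ 2)
        + 2 * ENNReal.ofReal T ^ 2 * ∫⁻ s in Ioo 0 T, ‖h (k + 1) (s, v)‖ₑ ^ 2 := by
    intro v
    set I : ℝ≥0∞ := ∫⁻ s in Ioo 0 T, ‖h (k + 1) (s, v)‖ₑ ^ 2 with hI
    have h1 : ∀ s ∈ Ioo 0 T, ‖h k (t, v)‖ₑ ^ 2
        ≤ 2 * ‖h k (s, v)‖ₑ ^ 2 + 2 * (ENNReal.ofReal T * I) := by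
      intro s hs
      have hsub : uIcc s t ⊆ Ioo 0 T := ordConnected_Ioo.uIcc_subset hs ht
      have h2 := enorm_sub_sq_le (fun r hr => H.hasDerivAt k r (hsub hr) v)
        ((H.continuousOn_time (k + 1) v).mono hsub)
      have h3 : ‖h k (t, v) - h k (s, v)‖ₑ ^ 2 ≤ ENNReal.ofReal T * I := by
        refine h2.trans ?_
        gcongr
        · rw [abs_le]; constructor <;> linarith [hs.1, hs.2, ht.1, ht.2]
        · exact lintegral_mono_set (uIoc_subset_uIcc.trans hsub)
      have h4 : ‖h k (t, v)‖ₑ ≤ ‖h k (s, v)‖ₑ + ‖h k (t, v) - h k (s, v)‖ₑ := by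
        calc _ = ‖h k (s, v) + (h k (t, v) - h k (s, v))‖ₑ := by rw [add_sub_cancel]
          _ ≤ _ := enorm_add_le _ _
      calc _ ≤ (‖h k (s, v)‖ₑ + ‖h k (t, v) - h k (s, v)‖ₑ) ^ 2 := by gcongr
        _ ≤ 2 * (‖h k (s, v)‖ₑ ^ 2 + ‖h k (t, v) - h k (s, v)‖ₑ ^ 2) := by
          have h5 := ENNReal.rpow_add_le_mul_rpow_add_rpow ‖h k (s, v)‖ₑ ‖h k (t, v) - h k (s, v)‖ₑ
            (p := 2) (by norm_num)
          rw [show (2 : ℝ) - 1 = 1 by norm_num] at h5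
          simpa only [ENNReal.rpow_ofNat, ENNReal.rpow_one] using h5
        _ ≤ _ := by rw [mul_add]; gcongr
    have hm : AEMeasurable (fun s => 2 * ‖h k (s, v)‖ₑ ^ 2) (volume.restrict (Ioo 0 T)) :=
      (((H.continuousOn_time k v).aemeasurable measurableSet_Ioo).enorm.pow_const 2).const_mul 2
    calc _ = ∫⁻ _ in Ioo 0 T, ‖h k (t, v)‖ₑ ^ 2 := by
          rw [setLIntegral_const, Real.volume_Ioo, sub_zero, mul_comm]
      _ ≤ ∫⁻ s in Ioo 0 T, (2 * ‖h k (s, v)‖ₑ ^ 2 + 2 * (ENNReal.ofReal T * I)) :=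
          setLIntegral_mono' measurableSet_Ioo h1
      _ = _ := by
          rw [lintegral_add_left' hm, lintegral_const_mul' _ _ (by simp), setLIntegral_const,
            Real.volume_Ioo, sub_zero]
          ring
  have hm1 : ∀ k, AEMeasurable (fun v => ∫⁻ s in Ioo 0 T, ‖h k (s, v)‖ₑ ^ 2) volume := fun k =>
    ((H.aemeasurable k subset_rfl measurableSet_Ioo).enorm.pow_const 2).lintegral_prod_left
  have hT' : ENNReal.ofReal T ≠ 0 := by simpa using hT
  rw [← ENNReal.mul_le_mul_iff_right hT' ENNReal.ofReal_ne_top,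
    ← lintegral_const_mul' _ _ ENNReal.ofReal_ne_top]
  refine (lintegral_mono hpt).trans ?_
  rw [lintegral_add_left' ((hm1 k).const_mul 2), lintegral_const_mul' _ _ (by simp),
    lintegral_const_mul' _ _ (ENNReal.mul_ne_top (by simp) (by simp))]
  calc _ ≤ 2 * ENNReal.ofReal (N k ^ 2)
        + 2 * ENNReal.ofReal T ^ 2 * ENNReal.ofReal (N (k + 1) ^ 2) := by
        gcongr <;> exact H.lintegral_lintegral_le _
    _ = _ := by
      rw [← ENNReal.ofReal_ofNat 2, ← ENNReal.ofReal_pow hT.le, ← ENNReal.ofReal_mul (by norm_num),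
        ← ENNReal.ofReal_mul (by norm_num), ← ENNReal.ofReal_mul (by positivity),
        ← ENNReal.ofReal_add (by positivity) (by positivity), ← ENNReal.ofReal_mul hT.le]
      congr 1
      field_simp

theorem memLp (H : IsSliceFamily T N h) (hT : 0 < T) (k : ℕ) {t : ℝ} (ht : t ∈ Ioo 0 T) :
    MemLp (fun v => h k (t, v)) 2 volume := by
  refine ⟨(H.continuous_slice k ht).aestronglyMeasurable, ?_⟩
  have h1 := (H.slice_le hT k ht).trans_lt ENNReal.ofReal_lt_top
  rw [← eLpNorm_two_sq] at h1
  by_contra hne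
  rw [not_lt_top_iff.1 hne] at h1
  simp at h1

end IsSliceFamily

/-- A pointwise bound on the time derivative of a curve in `L²`, integrated. -/
theorem lintegral_sub_sq_le {p q : ℝ → Vel → ℝ} {s t : ℝ} {K : ℝ≥0∞}
    (hp : ∀ v, ∀ r ∈ uIcc s t, HasDerivAt (fun r => p r v) (q r v) r)
    (hc : ∀ v, ContinuousOn (fun r => q r v) (uIcc s t))
    (hm : AEMeasurable (Function.uncurry q) ((volume.restrict (uIoc s t)).prod volume))
    (hK : ∀ r ∈ uIoc s t, ∫⁻ v, ‖q r v‖ₑ ^ 2 ≤ K) :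
    ∫⁻ v, ‖p t v - p s v‖ₑ ^ 2 ≤ ENNReal.ofReal |t - s| ^ 2 * K := by
  calc _ ≤ ∫⁻ v, ENNReal.ofReal |t - s| * ∫⁻ r in uIoc s t, ‖q r v‖ₑ ^ 2 :=
        lintegral_mono fun v => enorm_sub_sq_le (hp v) (hc v)
    _ = ENNReal.ofReal |t - s| * ∫⁻ r in uIoc s t, (∫⁻ v, ‖q r v‖ₑ ^ 2) := by
        rw [lintegral_const_mul' _ _ ENNReal.ofReal_ne_top]
        congr 1
        exact (lintegral_lintegral_swap (hm.enorm.pow_const 2)).symm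
    _ ≤ ENNReal.ofReal |t - s| * ∫⁻ _ in uIoc s t, K := by
        gcongr 1
        exact setLIntegral_mono' measurableSet_uIoc hK
    _ = _ := by
        rw [setLIntegral_const, Real.volume_uIoc]
        ring

theorem norm_toLp_le {α : Type*} [MeasurableSpace α] {ν : Measure α} {u : α → ℝ}
    (hu : MemLp u 2 ν) {a : ℝ} (ha : 0 ≤ a)
    (h : ∫⁻ x, ‖u x‖ₑ ^ 2 ∂ν ≤ ENNReal.ofReal (a ^ 2)) : ‖hu.toLp u‖ ≤ a := by
  rw [← eLpNorm_two_sq, ENNReal.ofReal_pow ha] at h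
  rw [Lp.norm_toLp]
  exact ENNReal.toReal_le_of_le_ofReal ha ((ENNReal.pow_le_pow_left_iff two_ne_zero).1 h)

/-- A curve on an open interval which is Lipschitz extends continuously to the closed interval. -/
theorem exists_continuousOn_extension {E : Type*} [NormedAddCommGroup E] [CompleteSpace E]
    {T L : ℝ} (hT : 0 < T) {u : ℝ → E}
    (hu : ∀ s ∈ Ioo 0 T, ∀ t ∈ Ioo 0 T, ‖u t - u s‖ ≤ L * |t - s|) :
    ∃ w : ℝ → E, ContinuousOn w (Icc 0 T) ∧ ∀ t ∈ Ioo 0 T, w t = u t := by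
  have hlip : LipschitzOnWith L.toNNReal u (Ioo 0 T) :=
    LipschitzOnWith.of_dist_le_mul fun t ht s hs => by
      rw [dist_eq_norm, Real.dist_eq]
      refine (hu s hs t ht).trans ?_
      gcongr
      exact Real.le_coe_toNNReal L
  have hcl : Icc 0 T ⊆ closure (Ioo 0 T) := by rw [closure_Ioo hT.ne]
  refine ⟨extendFrom (Ioo 0 T) u, continuousOn_extendFrom hcl fun t ht => ?_, fun t ht => ?_⟩
  · have hne : (𝓝[Ioo 0 T] t).NeBot := mem_closure_iff_nhdsWithin_neBot.1 (hcl ht)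
    refine CompleteSpace.complete ⟨hne.map u, ?_⟩
    rw [prod_map_map_eq]
    refine Tendsto.mono_left hlip.uniformContinuousOn (le_inf ?_ ?_)
    · exact (Filter.prod_mono inf_le_left inf_le_left).trans cauchy_nhds.2
    · rw [← prod_principal_principal]
      exact Filter.prod_mono inf_le_right inf_le_right
  · refine extendFrom_eq (subset_closure ht) ?_
    exact hlip.continuousOn t ht

namespace IsSliceFamily

variable {T : ℝ} {N M : ℕ → ℝ} {h : ℕ → ℝ × Vel → ℝ}

theorem slice_sub_le (H : IsSliceFamily T N h)
    (hs : ∀ k, ∀ t ∈ Ioo 0 T, ∫⁻ v, ‖h k (t, v)‖ₑ ^ 2 ≤ ENNReal.ofReal (M k ^ 2)) (k : ℕ)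
    {s t : ℝ} (hs' : s ∈ Ioo 0 T) (ht : t ∈ Ioo 0 T) :
    ∫⁻ v, ‖h k (t, v) - h k (s, v)‖ₑ ^ 2 ≤ ENNReal.ofReal ((M (k + 1) * |t - s|) ^ 2) := by
  have hsub : uIcc s t ⊆ Ioo 0 T := ordConnected_Ioo.uIcc_subset hs' ht
  have h1 := lintegral_sub_sq_le (p := fun r v => h k (r, v)) (q := fun r v => h (k + 1) (r, v))
    (fun v r hr => H.hasDerivAt k r (hsub hr) v)
    (fun v => (H.continuousOn_time (k + 1) v).mono hsub)
    (H.aemeasurable (k + 1) (uIoc_subset_uIcc.trans hsub) measurableSet_uIoc)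
    (fun r hr => hs (k + 1) r (hsub (uIoc_subset_uIcc hr)))
  refine h1.trans (le_of_eq ?_)
  rw [← ENNReal.ofReal_pow (abs_nonneg _), ← ENNReal.ofReal_mul (by positivity), mul_pow, mul_comm]

theorem slice_taylor_le (H : IsSliceFamily T N h) (hM : ∀ k, 0 ≤ M k)
    (hs : ∀ k, ∀ t ∈ Ioo 0 T, ∫⁻ v, ‖h k (t, v)‖ₑ ^ 2 ≤ ENNReal.ofReal (M k ^ 2)) (k : ℕ)
    {s t : ℝ} (hs' : s ∈ Ioo 0 T) (ht : t ∈ Ioo 0 T) :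
    ∫⁻ v, ‖h k (t, v) - h k (s, v) - (t - s) * h (k + 1) (s, v)‖ₑ ^ 2
      ≤ ENNReal.ofReal ((M (k + 2) * |t - s| ^ 2) ^ 2) := by
  have hsub : uIcc s t ⊆ Ioo 0 T := ordConnected_Ioo.uIcc_subset hs' ht
  have hm : AEMeasurable (Function.uncurry fun r v => h (k + 1) (r, v) - h (k + 1) (s, v))
      ((volume.restrict (uIoc s t)).prod (volume : Measure Vel)) :=
    (H.aemeasurable (k + 1) (uIoc_subset_uIcc.trans hsub) measurableSet_uIoc).sub
      ((H.continuous_slice (k + 1) hs').measurable.comp measurable_snd).aemeasurable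
  have h1 := lintegral_sub_sq_le (p := fun r v => h k (r, v) - r * h (k + 1) (s, v))
    (q := fun r v => h (k + 1) (r, v) - h (k + 1) (s, v))
    (K := ENNReal.ofReal ((M (k + 2) * |t - s|) ^ 2))
    (fun v r hr => (H.hasDerivAt k r (hsub hr) v).sub (hasDerivAt_mul_const _))
    (fun v => ((H.continuousOn_time (k + 1) v).mono hsub).sub continuousOn_const) hm
    (fun r hr => by
      refine (H.slice_sub_le hs (k + 1) hs' (hsub (uIoc_subset_uIcc hr))).trans ?_
      have h2 : |r - s| ≤ |t - s| := abs_sub_left_of_mem_uIcc (uIoc_subset_uIcc hr)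
      have h3 := hM (k + 2)
      gcongr)
  calc _ = ∫⁻ v, ‖h k (t, v) - t * h (k + 1) (s, v) - (h k (s, v) - s * h (k + 1) (s, v))‖ₑ ^ 2 :=
        lintegral_congr fun v => by congr 2; ring
    _ ≤ _ := h1
    _ = _ := by
      rw [← ENNReal.ofReal_pow (abs_nonneg _), ← ENNReal.ofReal_mul (by positivity)]
      congr 1
      ring

/-- The slices of the family form a smooth curve in `L²`, up to the endpoints of the interval. -/
theorem exists_curve (H : IsSliceFamily T N h) (hT : 0 < T) (hM : ∀ k, 0 ≤ M k)
    (hs : ∀ k, ∀ t ∈ Ioo 0 T, ∫⁻ v, ‖h k (t, v)‖ₑ ^ 2 ≤ ENNReal.ofReal (M k ^ 2)) :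
    ∃ G : ℕ → ℝ → L2Vel,
      (∀ k, ∀ t ∈ Icc 0 T, HasDerivWithinAt (G k) (G (k + 1) t) (Icc 0 T) t) ∧
      (∀ k, ∀ t ∈ Icc 0 T, ‖G k t‖ ≤ M k) ∧
      ∀ k, ∀ t ∈ Ioo 0 T, G k t =ᵐ[volume] fun v => h k (t, v) := by
  have hL := fun k (t : ℝ) (ht : t ∈ Ioo 0 T) => H.memLp hT k ht
  set u : ℕ → ℝ → L2Vel := fun k t =>
    if ht : t ∈ Ioo 0 T then (hL k t ht).toLp _ else 0 with hu
  have hue : ∀ k t (ht : t ∈ Ioo 0 T), u k t = (hL k t ht).toLp _ := fun k t ht => dif_pos ht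
  have hub : ∀ k, ∀ t ∈ Ioo 0 T, ‖u k t‖ ≤ M k := fun k t ht => by
    rw [hue k t ht]
    exact norm_toLp_le _ (hM k) (hs k t ht)
  have hul : ∀ k, ∀ s ∈ Ioo 0 T, ∀ t ∈ Ioo 0 T, ‖u k t - u k s‖ ≤ M (k + 1) * |t - s| := by
    intro k s hs' t ht
    rw [hue k t ht, hue k s hs', ← MemLp.toLp_sub]
    exact norm_toLp_le _ (mul_nonneg (hM _) (abs_nonneg _)) (H.slice_sub_le hs k hs' ht)
  have hut : ∀ k, ∀ s ∈ Ioo 0 T, ∀ t ∈ Ioo 0 T,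
      ‖u k t - u k s - (t - s) • u (k + 1) s‖ ≤ M (k + 2) * |t - s| ^ 2 := by
    intro k s hs' t ht
    rw [hue k t ht, hue k s hs', hue (k + 1) s hs', ← MemLp.toLp_const_smul, ← MemLp.toLp_sub,
      ← MemLp.toLp_sub]
    exact norm_toLp_le _ (mul_nonneg (hM _) (by positivity)) (H.slice_taylor_le hM hs k hs' ht)
  choose G hGc hGu using fun k => exists_continuousOn_extension hT (hul k)
  have hcl : closure (Ioo 0 T) = Icc 0 T := closure_Ioo hT.ne
  refine ⟨G, fun k t ht => ?_, fun k t ht => ?_, fun k t ht => ?_⟩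
  · refine hasDerivWithinAt_of_quadratic (C := M (k + 2)) ?_
    filter_upwards [self_mem_nhdsWithin] with r hr
    have hcl2 : closure (Ioo 0 T ×ˢ Ioo 0 T) = Icc 0 T ×ˢ Icc 0 T := by
      rw [closure_prod_eq, hcl]
    have h1 : ∀ k, ContinuousOn (fun z : ℝ × ℝ => G k z.1) (Icc 0 T ×ˢ Icc 0 T) := fun k =>
      (hGc k).comp continuousOn_fst fun z hz => hz.1
    have h2 : ∀ k, ContinuousOn (fun z : ℝ × ℝ => G k z.2) (Icc 0 T ×ˢ Icc 0 T) := fun k =>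
      (hGc k).comp continuousOn_snd fun z hz => hz.2
    -- The Taylor inequality is a closed condition on the pair of times, so it extends from the open
    -- square to the closed one; this yields one-sided derivatives at the endpoints.
    refine le_on_closure (s := Ioo 0 T ×ˢ Ioo 0 T)
      (f := fun z : ℝ × ℝ => ‖G k z.1 - G k z.2 - (z.1 - z.2) • G (k + 1) z.2‖)
      (g := fun z : ℝ × ℝ => M (k + 2) * |z.1 - z.2| ^ 2) (fun z hz => ?_) ?_ ?_
      (x := (r, t)) ?_
    · rw [hGu k _ hz.1, hGu k _ hz.2, hGu _ _ hz.2]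
      exact hut k _ hz.2 _ hz.1
    · rw [hcl2]
      exact (((h1 k).sub (h2 k)).sub ((by fun_prop :
        ContinuousOn (fun z : ℝ × ℝ => z.1 - z.2) _).smul (h2 (k + 1)))).norm
    · fun_prop
    · rw [hcl2]; exact ⟨hr, ht⟩
  · refine le_on_closure (s := Ioo 0 T) (f := fun t => ‖G k t‖) (g := fun _ => M k)
      (fun s hs' => ?_) ?_ continuousOn_const (x := t) (hcl ▸ ht)
    · rw [hGu k s hs']; exact hub k s hs'
    · rw [hcl]; exact (hGc k).norm
  · rw [hGu k t ht, hue k t ht]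
    exact MemLp.coeFn_toLp _

end IsSliceFamily

/-! ### The slices of an analytic function -/

/-- Only pure time derivatives of the source are needed, i.e. multi-indices with no velocity part.
-/
theorem IsAnalyticL2.exists_isSliceFamily {T : ℝ} {g : ℝ × Vel → ℝ}
    (hg : IsAnalyticL2 g (Ioo 0 T ×ˢ univ)) :
    ∃ C > 0, ∃ h, h 0 = g ∧ IsSliceFamily T (fun k => C ^ (k + 1) * k.factorial) h := by
  obtain ⟨hsm, C, hC, hb⟩ := hg
  have hop : IsOpen (Ioo 0 T ×ˢ (univ : Set Vel)) := isOpen_Ioo.prod isOpen_univ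
  set h : ℕ → ℝ × Vel → ℝ := fun k => (dirDeriv ((1 : ℝ), (0 : Vel)))^[k] g with hh
  have hsucc : ∀ k, h (k + 1) = dirDeriv ((1 : ℝ), (0 : Vel)) (h k) := fun k =>
    Function.iterate_succ_apply' _ _ _
  have hsm' : ∀ k, ContDiffOn ℝ ∞ (h k) (Ioo 0 T ×ˢ univ) := by
    intro k
    induction k with
    | zero => exact hsm
    | succ k ih =>
      rw [hsucc]
      exact (ih.fderiv_of_isOpen hop (by simp)).clm_apply contDiffOn_const
  refine ⟨C, hC, h, rfl, fun k => (hsm' k).continuousOn, fun k t ht v => ?_, fun k => ?_⟩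
  · have h1 : HasFDerivAt (h k) (fderiv ℝ (h k) (t, v)) (t, v) :=
      (((hsm' k).contDiffAt (hop.mem_nhds ⟨ht, mem_univ _⟩)).differentiableAt (by simp)).hasFDerivAt
    have h2 : HasDerivAt (fun s : ℝ => (s, v)) ((1 : ℝ), (0 : Vel)) t :=
      (hasDerivAt_id t).prodMk (hasDerivAt_const t v)
    rw [hsucc]
    exact h1.comp_hasDerivAt t h2
  · have h1 := hb k 0
    simp only [mixedPartial, Pi.zero_apply, Function.iterate_zero, id_eq, Finset.sum_const_zero,
      add_zero, Nat.factorial_zero, Finset.prod_const_one, mul_one] at h1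
    rw [← eLpNorm_two_sq, ENNReal.ofReal_pow (by positivity)]
    gcongr

theorem IsAnalyticL2.exists_curve {T : ℝ} (hT : 0 < T) {g : ℝ × Vel → ℝ}
    (hg : IsAnalyticL2 g (Ioo 0 T ×ˢ univ)) :
    ∃ C > 0, ∃ G : ℕ → ℝ → L2Vel,
      (∀ k, ∀ t ∈ Icc 0 T, HasDerivWithinAt (G k) (G (k + 1) t) (Icc 0 T) t) ∧
      (∀ k, ∀ t ∈ Icc 0 T, ‖G k t‖ ≤ C ^ (k + 1) * k.factorial) ∧
      ∀ t ∈ Ioo 0 T, G 0 t =ᵐ[volume] fun v => g (t, v) := by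
  obtain ⟨C, hC, h, h0, H⟩ := hg.exists_isSliceFamily
  -- The Sobolev bound involves order k + 1, hence a surplus factor k + 1 ≤ 2^{k+1}; it and the
  -- fixed constants are absorbed into the base 2CA.
  set A : ℝ := 1 + 2 / T + 2 * T * C ^ 2 with hA
  have hA1 : 1 ≤ A := by
    have : 0 ≤ 2 / T + 2 * T * C ^ 2 := by positivity
    linarith
  have hle : ∀ k : ℕ, 2 / T * (C ^ (k + 1) * k.factorial) ^ 2
      + 2 * T * (C ^ (k + 1 + 1) * (k + 1).factorial) ^ 2
      ≤ ((2 * C * A) ^ (k + 1) * k.factorial) ^ 2 := by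
    intro k
    have h1 : ((k : ℝ) + 1) ≤ 2 ^ (k + 1) := by
      have := (Nat.lt_two_pow_self (n := k + 1)).le
      exact_mod_cast this
    have h2 : (1 : ℝ) ≤ 2 ^ (k + 1) := one_le_pow₀ (by norm_num)
    have h3 : A ≤ (A ^ (k + 1)) ^ 2 := by
      rw [← pow_mul]
      exact le_self_pow₀ hA1 (by positivity)
    have h4 : 2 / T + 2 * T * C ^ 2 * ((k : ℝ) + 1) ^ 2 ≤ (2 ^ (k + 1)) ^ 2 * A := by
      have h5 : 2 / T ≤ (2 ^ (k + 1)) ^ 2 * (2 / T) :=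
        le_mul_of_one_le_left (by positivity) (one_le_pow₀ h2)
      have h6 : 2 * T * C ^ 2 * ((k : ℝ) + 1) ^ 2 ≤ 2 * T * C ^ 2 * (2 ^ (k + 1)) ^ 2 := by gcongr
      have h7 : (0 : ℝ) ≤ (2 ^ (k + 1)) ^ 2 := by positivity
      rw [hA]
      linarith
    rw [Nat.factorial_succ]
    calc _ = (C ^ (k + 1) * k.factorial) ^ 2 * (2 / T + 2 * T * C ^ 2 * ((k : ℝ) + 1) ^ 2) := by
          push_cast; ring
      _ ≤ (C ^ (k + 1) * k.factorial) ^ 2 * ((2 ^ (k + 1)) ^ 2 * (A ^ (k + 1)) ^ 2) := by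
          gcongr
          exact h4.trans (by gcongr)
      _ = _ := by simp only [mul_pow]; ring
  obtain ⟨G, hG, hGb, hGe⟩ := H.exists_curve hT (M := fun k => (2 * C * A) ^ (k + 1) * k.factorial)
    (fun k => by positivity)
    (fun k t ht => (H.slice_le hT k ht).trans (ENNReal.ofReal_le_ofReal (hle k)))
  exact ⟨2 * C * A, by positivity, G, hG, hGb, fun t ht => by simpa only [h0] using hGe 0 t ht⟩

/-! ### The variational problem -/

theorem inner_eq_integral_of_ae {a b : L2Vel} {u w : Vel → ℝ} (ha : a =ᵐ[volume] u)
    (hb : b =ᵐ[volume] w) : ⟪a, b⟫ = ∫ v, u v * w v := by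
  rw [L2.inner_def]
  refine integral_congr_ae ?_
  filter_upwards [ha, hb] with v h1 h2
  rw [h1, h2]
  simp [mul_comm]

/-- The quadratic form of the linearized collision operator on the energy space. -/
def energyForm (γ : ℝ) : energySpace γ →L[ℝ] energySpace γ →L[ℝ] ℝ :=
  exchangeForm.bilinearComp ((WithLp.sndL 2 ℝ L2Vel PairField).comp (energySpace γ).subtypeL)
    ((WithLp.sndL 2 ℝ L2Vel PairField).comp (energySpace γ).subtypeL)

theorem energyForm_apply {γ : ℝ} (Φ Ψ : energySpace γ) :
    energyForm γ Φ Ψ = exchangeForm (Φ : EnergyAmbient).snd (Ψ : EnergyAmbient).snd := rfl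

/-- The elements of the energy space coming from test functions. -/
def testElements (γ : ℝ) : Set (energySpace γ) := {Φ | (Φ : EnergyAmbient) ∈ testPairs γ}

theorem dense_testElements (γ : ℝ) : Dense (testElements γ) := by
  refine Subtype.dense_iff.2 fun Φ hΦ => ?_
  refine closure_mono (s := (testPairs γ : Set EnergyAmbient)) (fun Ψ hΨ => ?_)
    (by rwa [← Submodule.topologicalClosure_coe])
  exact ⟨⟨Ψ, Submodule.le_topologicalClosure _ hΨ⟩, hΨ, rfl⟩

theorem denseRange_energyEmbedding {γ : ℝ} (hγ : -3 < γ) (hγ₀ : γ < 0) :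
    DenseRange (energyEmbedding γ) := by
  refine (Lp.dense_hasCompactSupport_contDiff (F := ℝ) (μ := (volume : Measure Vel))
    (p := 2) (by simp)).mono ?_
  rintro u ⟨φ, hu, hφs, hφ⟩
  have hfin := IsTestFunction.hasFiniteForm hγ hγ₀ ⟨hφ, hφs⟩
  have hmem : (WithLp.toLp 2 (u, hfin.2.toLp _) : EnergyAmbient) ∈ testPairs γ :=
    ⟨φ, ⟨hφ, hφs⟩, hu, hfin.2.coeFn_toLp⟩
  exact ⟨⟨_, Submodule.le_topologicalClosure _ hmem⟩, rfl⟩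

theorem linearPairing_eq_energyForm {γ : ℝ} (hγ : -3 < γ) (hγ₀ : γ < 0) (Φ : energySpace γ)
    {φ : Vel → ℝ} (hφ : IsTestFunction φ) {Ψ : energySpace γ} (hΨ : IsPair γ Ψ φ (gradient φ)) :
    linearPairing γ (energyEmbedding γ Φ) φ = energyForm γ Φ Ψ := by
  obtain ⟨C, -, h⟩ := exists_of_mem_energySpace hγ hγ₀
  obtain ⟨p, h1, h2, h3, -⟩ := h Φ Φ.2
  exact linearPairing_eq hγ hγ₀ h1 (Lp.memLp _) h2 hφ h3.2 hΨ.2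

theorem IsWeakSolution.variational_equation {γ : ℝ} (hγ : -3 < γ) (hγ₀ : γ < 0) {T : ℝ}
    {g : ℝ × Vel → ℝ} {f₀ : L2Vel} {f : ℝ → L2Vel} (hf : IsWeakSolution γ T g f₀ f)
    {U : ℝ → energySpace γ} (hU : ∀ᵐ s ∂volume.restrict (Ioc 0 T), energyEmbedding γ (U s) = f s)
    {G : ℝ → L2Vel} (hG : ∀ t ∈ Ioo 0 T, G t =ᵐ[volume] fun v => g (t, v))
    {Φ : energySpace γ} (hΦ : Φ ∈ testElements γ) {t : ℝ} (ht : t ∈ Icc 0 T) :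
    ⟪f t, energyEmbedding γ Φ⟫ - ⟪f 0, energyEmbedding γ Φ⟫ + ∫ s in (0 : ℝ)..t, energyForm γ (U s) Φ
      = ∫ s in (0 : ℝ)..t, ⟪G s, energyEmbedding γ Φ⟫ := by
  obtain ⟨φ, hφ, hpair⟩ := hΦ
  have hin : ∀ (a : L2Vel) (u : Vel → ℝ), a =ᵐ[volume] u →
      ⟪a, energyEmbedding γ Φ⟫ = ∫ v, u v * φ v := fun a u ha =>
    inner_eq_integral_of_ae ha hpair.1
  have hsub : uIoc 0 t ⊆ Ioc 0 T := by
    rw [uIoc_of_le ht.1]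
    exact Ioc_subset_Ioc_right ht.2
  have h1 : ∫ s in (0 : ℝ)..t, energyForm γ (U s) Φ = ∫ s in (0 : ℝ)..t, linearPairing γ (f s) φ := by
    refine intervalIntegral.integral_congr_ae ?_
    filter_upwards [(ae_restrict_iff' measurableSet_Ioc).1 hU] with s hs hst
    rw [← hs (hsub hst), linearPairing_eq_energyForm hγ hγ₀ _ hφ hpair]
  have h2 : ∫ s in (0 : ℝ)..t, ⟪G s, energyEmbedding γ Φ⟫
      = ∫ s in (0 : ℝ)..t, ∫ v, g (s, v) * φ v := by
    refine intervalIntegral.integral_congr_ae ?_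
    -- The curve of the source is identified with its slices only for times below T; the endpoint is
    -- a null set.
    filter_upwards [Measure.ae_ne volume T] with s hs hst
    exact hin _ _ (hG s ⟨(hsub hst).1, lt_of_le_of_ne (hsub hst).2 hs⟩)
  rw [hin _ _ (.refl _ _), hin _ _ (.refl _ _), h1, h2, hf.initial]
  exact hf.equation φ hφ t ht

/-! ### Regularity of curves with a tower of derivatives -/

section Tower

variable {E : Type*} [NormedAddCommGroup E] [NormedSpace ℝ E]

theorem iteratedDerivWithin_eq_of_tower {T : ℝ} {f : ℝ → E} {F : ℕ → ℝ → E}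
    (h0 : ∀ t ∈ Ioc 0 T, F 0 t = f t)
    (hF : ∀ k, ∀ t ∈ Ioc 0 T, HasDerivWithinAt (F k) (F (k + 1) t) (Ioc 0 T) t) (k : ℕ) :
    ∀ t ∈ Ioc 0 T, iteratedDerivWithin k f (Ioc 0 T) t = F k t := by
  induction k with
  | zero => exact fun t ht => by rw [iteratedDerivWithin_zero, h0 t ht]
  | succ k ih =>
    intro t ht
    rw [iteratedDerivWithin_succ, derivWithin_congr ih (ih t ht)]
    exact (hF k t ht).derivWithin (uniqueDiffOn_Ioc 0 T t ht)

theorem contDiffOn_of_tower {T : ℝ} {f : ℝ → E} {F : ℕ → ℝ → E}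
    (h0 : ∀ t ∈ Ioc 0 T, F 0 t = f t)
    (hF : ∀ k, ∀ t ∈ Ioc 0 T, HasDerivWithinAt (F k) (F (k + 1) t) (Ioc 0 T) t) :
    ContDiffOn ℝ ∞ f (Ioc 0 T) := by
  refine contDiffOn_of_differentiableOn_deriv fun m _ => ?_
  refine DifferentiableOn.congr (f := F m) (fun t ht => (hF m t ht).differentiableWithinAt) ?_
  exact iteratedDerivWithin_eq_of_tower h0 hF m

end Tower

/-- Coercivity bounds the squared norm of the field by twice the form plus 2 lam ‖u‖², and the
energy is at most that squared norm plus C‖u‖². -/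
theorem exists_normASq_le {γ : ℝ} (hγ : -3 < γ) (hγ₀ : γ < 0) :
    ∃ D, 0 < D ∧ ∀ Φ : energySpace γ, normASq γ (energyEmbedding γ Φ)
      ≤ 2 * ENNReal.ofReal (energyForm γ Φ Φ)
        + ENNReal.ofReal (D * ‖energyEmbedding γ Φ‖ ^ 2) := by
  obtain ⟨C, hC, h⟩ := exists_of_mem_energySpace hγ hγ₀
  obtain ⟨lam, hlam, hco⟩ := exchangeForm_coercive hγ hγ₀
  refine ⟨2 * lam + C, by positivity, fun Φ => ?_⟩
  obtain ⟨p, -, -, -, h1⟩ := h Φ Φ.2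
  have h2 := hco Φ Φ.2
  rw [WithLp.prod_norm_sq_eq_of_L2] at h2
  have hnn : 0 ≤ energyForm γ Φ Φ := exchangeForm_nonneg _
  have h3 : ∀ y : ℝ, 2 * ENNReal.ofReal y = ENNReal.ofReal (2 * y) := fun y => by
    rw [ENNReal.ofReal_mul (by norm_num), ENNReal.ofReal_ofNat]
  rw [h3, ← ENNReal.ofReal_add (by positivity) (by positivity)]
  refine h1.trans (ENNReal.ofReal_le_ofReal ?_)
  rw [energyForm_apply, energyEmbedding_apply]
  nlinarith [sq_nonneg ‖(Φ : EnergyAmbient).fst‖]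

theorem sup_add_lintegral_le {T B D : ℝ} (hT : 0 < T) (hB : 0 < B) (hD : 0 < D) (k : ℕ)
    {x : ℝ → L2Vel} {e a : ℝ → ℝ≥0∞}
    (hx : ∀ t ∈ Ioc 0 T, ‖x t‖ ≤ B ^ (k + 1) * k.factorial)
    (he : ∫⁻ t in Ioc 0 T, e t ≤ ENNReal.ofReal ((B ^ (k + 1) * k.factorial) ^ 2))
    (ha : ∀ t ∈ Ioc 0 T, a t ≤ 2 * e t + ENNReal.ofReal (D * ‖x t‖ ^ 2)) :
    (⨆ t ∈ Ioc 0 T, ‖x t‖ₑ ^ 2) + ∫⁻ t in Ioc 0 T, a t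
      ≤ ENNReal.ofReal ((((3 + T * D) * B) ^ (k + 1) * k.factorial) ^ 2) := by
  set Q : ℝ := B ^ (k + 1) * k.factorial with hQ
  have hQ0 : 0 ≤ Q := by positivity
  have h1 : (⨆ t ∈ Ioc 0 T, ‖x t‖ₑ ^ 2) ≤ ENNReal.ofReal (Q ^ 2) := by
    refine iSup₂_le fun t ht => ?_
    rw [← ofReal_norm, ← ENNReal.ofReal_pow (norm_nonneg _)]
    refine ENNReal.ofReal_le_ofReal ?_
    have := hx t ht
    gcongr
  have h2 : ∫⁻ t in Ioc 0 T, a t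
      ≤ 2 * ENNReal.ofReal (Q ^ 2) + ENNReal.ofReal (D * Q ^ 2) * ENNReal.ofReal T := by
    calc _ ≤ ∫⁻ t in Ioc 0 T, (2 * e t + ENNReal.ofReal (D * Q ^ 2)) := by
          refine setLIntegral_mono' measurableSet_Ioc fun t ht => (ha t ht).trans ?_
          have := hx t ht
          gcongr
      _ = 2 * (∫⁻ t in Ioc 0 T, e t) + ENNReal.ofReal (D * Q ^ 2) * ENNReal.ofReal T := by
          rw [lintegral_add_right _ measurable_const, lintegral_const_mul' _ _ (by simp),
            setLIntegral_const, Real.volume_Ioc, sub_zero]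
      _ ≤ _ := by gcongr
  -- The supremum contributes 1, the doubled form 2, and the L² term integrated over ]0, T]
  -- contributes TD. Since the total exceeds 1, it can be put into the base of the power.
  have hE : (1 : ℝ) ≤ 3 + T * D := by nlinarith [mul_pos hT hD]
  have hE2 : 3 + T * D ≤ ((3 + T * D) ^ (k + 1)) ^ 2 := by
    rw [← pow_mul]
    exact le_self_pow₀ hE (by positivity)
  refine (add_le_add h1 h2).trans ?_
  rw [← ENNReal.ofReal_ofNat 2, ← ENNReal.ofReal_mul (by norm_num),
    ← ENNReal.ofReal_mul (by positivity), ← ENNReal.ofReal_add (by positivity) (by positivity),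
    ← ENNReal.ofReal_add (by positivity) (by positivity)]
  refine ENNReal.ofReal_le_ofReal ?_
  calc _ = (3 + T * D) * Q ^ 2 := by ring
    _ ≤ ((3 + T * D) ^ (k + 1)) ^ 2 * Q ^ 2 := by gcongr
    _ = _ := by rw [hQ, mul_pow (3 + T * D)]; ring

end Landau
end

theorem proposition4p1 (γ : ℝ) (hγ : -3 < γ) (hγ₀ : γ < 0) (T : ℝ) (hT : 0 < T)
    (f₀ : Landau.L2Vel) (g : ℝ × Landau.Vel → ℝ)
    (hg : Landau.IsAnalyticL2 g (Ioo 0 T ×ˢ univ))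
    (f : ℝ → Landau.L2Vel) (hf : Landau.IsWeakSolution γ T g f₀ f) :
    ContDiffOn ℝ ∞ f (Ioc 0 T) ∧
      ∃ B : ℝ, 0 < B ∧ ∀ k : ℕ,
        (⨆ t ∈ Ioc 0 T, ‖t ^ k • iteratedDerivWithin k f (Ioc 0 T) t‖ₑ ^ 2)
          + ∫⁻ t in Ioc 0 T, Landau.normASq γ
            (t ^ k • iteratedDerivWithin k f (Ioc 0 T) t : Landau.L2Vel)
        ≤ ENNReal.ofReal ((B ^ (k + 1) * k.factorial) ^ 2) := by
  obtain ⟨C, hC, G, hG, hGb, hGe⟩ := hg.exists_curve hT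
  obtain ⟨U, hU, hUf⟩ := Landau.exists_integrable_curve hγ hγ₀ hf.continuousOn hf.energy_lt_top
  obtain ⟨lam, hlam, hco⟩ := Landau.exchangeForm_coercive hγ hγ₀
  obtain ⟨D, hD, hDn⟩ := Landau.exists_normASq_le hγ hγ₀
  obtain ⟨F, W, h0, hF, hW, B, hB, hbd⟩ := Landau.variational_smoothing
    (Landau.energyEmbedding γ) (Landau.energyForm γ)
    (fun _ _ => Landau.exchangeForm_symm _ _) (fun _ => Landau.exchangeForm_nonneg _)
    one_half_pos hlam (fun Φ => hco Φ Φ.2) (Landau.denseRange_energyEmbedding hγ hγ₀) hT hC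
    hf.continuousOn hG hGb hU hUf (Landau.dense_testElements γ)
    (fun Φ hΦ t ht => hf.variational_equation hγ hγ₀ hUf hGe hΦ ht)
  refine ⟨Landau.contDiffOn_of_tower h0 hF, (3 + T * D) * B, by positivity, fun k => ?_⟩
  have hit := Landau.iteratedDerivWithin_eq_of_tower h0 hF k
  refine Landau.sup_add_lintegral_le hT hB hD k (fun t ht => ?_) (hbd k).2 fun t ht => ?_
  · rw [hit t ht]
    exact (hbd k).1 t ht
  -- The weighted derivative is the image of an element of the energy space, so its A-norm is
  -- controlled by the form.
  · rw [hit t ht, ← hW k t ht, ← map_smul]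
    exact hDn (t ^ k • W k t)
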